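/- Let $\Omega$ be the category of planar rooted trees (one object for each planarized finite rooted tree; a map is a map of edge sets preserving the broad relations $e_1\cdots e_n\le e$, which are generated by the vertices under reflexivity and broad transitivity, with unordered tuples). A map in $\Omega$ is called *tall* if it sends the tuple of leaves to the tuple of leaves and the root to the root; a *face* if it is injective on edges; an *inner face* if it is a tall face; an *outer face* if it is a face which does not factor as a non-invertible inner face followed by a face; a *degeneracy* if it is surjective on edges and preserves leaves; and *planar* if it is compatible with the planar structures. For $T\in\Omega$ let $W(T)$ be the Boardman–Vogt simplicial operad of $T$: its colors are the edges of $T$; its simplicial set of operations $W(T)(e_1,\dots,e_n;e)$ is $\Delta[1]^{\times E^{\mathsf i}(F)}$ if there is a subtree $F$ of $T$ with leaves $e_1,\dots,e_n$ and root $e$, where $E^{\mathsf i}(F)$ is the set of inner edges of $F$, and is empty otherwise; composition is grafting, with newly arising inner edges given length $1$; and a map $T\to T'$ acts by giving an inner edge the maximum of the lengths of the inner edges mapped to it ($0$ if there are none). The nerve $NP$ of a simplicial operad $P$ is the simplicial dendroidal set whose set of $n$-simplices at $S\in\Omega$ is the set of operad maps from $\Omega(S)$ to $P_n$, where $\Omega(S)$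 is the colored operad of the tree $S$. There is a functor $NW\colon\Omega\to\mathsf{Set}^{\Delta^{op}\times\Omega^{op}}$ such that: 1. $NW(T)_n(S)$ is the set of composable strings of maps in $\Omega$ $$S\to J_0\to J_1\to\cdots\to J_n\to T$$ in which $S\to J_0$ is tall, each $J_i\to J_{i+1}$ is a planar inner face and $J_n\to T$ is a planar face; the simplicial operators forget or repeat the $J_i$. 2. For $f\colon S'\to S$, the map $NW(T)_n(S)\to NW(T)_n(S')$ sends a string to the unique string $S'\to J'_0\to\cdots\to J'_n\to T$ of the above type for which there are outer faces $J'_i\to J_i$ forming a commutative ladder over $f$ and $\mathrm{id}_T$ (so that $S'\to J'_i\to J_i$ is the factorization of $S'\to S\to J_i$ as a tall map followed by an outer face). 3. For $g\colon T\to T'$, the map $NW(T)_n(S)\to NW(T')_n(S)$ sends a string to the unique string $S\to J'_0\to\cdots\to J'_n\to T'$ of the above type for which there are degeneracies $J_i\to J'_i$ forming a commutative ladder over $\mathrm{id}_S$ and $g$ (so that $J_i\to J'_i\to T'$ is the factorization of $J_i\to T\to T'$ as a degeneracy followed by a face). 4. Each $NW(T)_n$ satisfies the strict Segal condition: for every tree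 $U$, restriction to the Segal core $Sc[U]\subseteq\Omega[U]$ (the union of the planar outer faces without inner edges) is a bijection from $NW(T)_n(U)$ to the set of maps $Sc[U]\to NW(T)_n$. Moreover $NW(T)(\eta)$ is a discrete simplicial set, where $\eta$ is the tree with one edge and no vertices. 5. $NW(T)$ is isomorphic to the nerve of $W(T)$, naturally in $T$, in $S$ and in the simplicial direction. -/

import Mathlib

open CategoryTheory Opposite

namespace Dendroidal

/-! ### Planar rooted trees -/

/-- Planar rooted trees: the stick (one edge, no vertices), or a root edge topped by a vertex
whose `n` ordered input edges carry the planar trees `t 0, …, t (n - 1)`.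
There is exactly one term for each planarized tree. -/
inductive PTree : Type
  | stick : PTree
  | node (n : ℕ) (t : Fin n → PTree) : PTree

/-- The edges of a planar tree. -/
inductive Edge : PTree → Type
  | root (T : PTree) : Edge T
  | sub {n : ℕ} {t : Fin n → PTree} (i : Fin n) (e : Edge (t i)) : Edge (.node n t)

/-- The tuple of leaves of a tree: the edges with no vertex above them. -/
def leaves : (T : PTree) → Multiset (Edge T)
  | .stick => {.root _}
  | .node n t => ∑ i : Fin n, (leaves (t i)).map (Edge.sub i)

/-- `Above x y`: the edge `x` is pictorially above (or equal to) the edge `y`. -/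
inductive Above : {T : PTree} → Edge T → Edge T → Prop
  | root {T : PTree} (x : Edge T) : Above x (.root T)
  | sub {n : ℕ} {t : Fin n → PTree} (i : Fin n) {x y : Edge (t i)} (h : Above x y) :
      Above (.sub (t := t) i x) (.sub i y)

/-- The total order on edges given by the planar structure: it extends `Above` (the root is the
largest edge) and, on edges lying over distinct inputs of a vertex, it is the left to right
order of these inputs. -/
inductive PlanarLE : {T : PTree} → Edge T → Edge T → Prop
  | root {T : PTree} (x : Edge T) : PlanarLE x (.root T)
  | left {n : ℕ} {t : Fin n → PTree} {i j : Fin n} (h : i < j) (x : Edge (t i))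
      (y : Edge (t j)) : PlanarLE (.sub (t := t) i x) (.sub j y)
  | sub {n : ℕ} {t : Fin n → PTree} (i : Fin n) {x y : Edge (t i)} (h : PlanarLE x y) :
      PlanarLE (.sub (t := t) i x) (.sub i y)

/-- The generating broad relations `e↑ ≤ e`, one for each vertex: `e` is the edge below the
vertex and `e↑` is the tuple of edges immediately above it. -/
inductive Vertex : {T : PTree} → Multiset (Edge T) → Edge T → Prop
  | root (n : ℕ) (t : Fin n → PTree) :
      Vertex (Finset.univ.val.map fun i : Fin n => Edge.sub i (.root (t i)))
        (.root (.node n t))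
  | sub {n : ℕ} {t : Fin n → PTree} (i : Fin n) {m : Multiset (Edge (t i))} {e : Edge (t i)}
      (h : Vertex m e) : Vertex (m.map (Edge.sub (t := t) i)) (.sub i e)

/-- The broad relations `e₁ ⋯ eₙ ≤ e` of a tree: generated by the vertices under reflexivity and
broad transitivity. Tuples are unordered. -/
inductive Broad {T : PTree} : Multiset (Edge T) → Edge T → Prop
  | refl (e : Edge T) : Broad {e} e
  | vertex {m : Multiset (Edge T)} {e : Edge T} (h : Vertex m e) : Broad m e
  | trans {n : ℕ} {c : Fin n → Edge T} {e : Edge T} {m : Fin n → Multiset (Edge T)}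
      (h : Broad (Finset.univ.val.map c) e) (h' : ∀ i, Broad (m i) (c i)) :
      Broad (∑ i, m i) e

/-! ### Elementary facts on edges and broad relations -/

theorem Above.rfl' {T : PTree} (x : Edge T) : Above x x := by
  induction x with
  | root T => exact .root _
  | sub i e ih => exact .sub i ih

theorem Above.trans {T : PTree} {x y z : Edge T} (h : Above x y) (h' : Above y z) :
    Above x z := by
  induction h' with
  | root y => exact .root _
  | sub i _ ih => cases h with
    | sub _ h => exact .sub i (ih h)

theorem Above.antisymm {T : PTree} {x y : Edge T} (h : Above x y) (h' : Above y x) : x = y := by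
  induction h with
  | root x => cases h'; rfl
  | sub i _ ih => cases h' with
    | sub _ h' => rw [ih h']

/-- Two edges below a common edge are comparable. -/
theorem Above.total {T : PTree} {x y z : Edge T} (h : Above x y) (h' : Above x z) :
    Above y z ∨ Above z y := by
  induction h with
  | root x => exact .inr (.root _)
  | sub i _ ih => cases h' with
    | root => exact .inl (.root _)
    | sub _ h' => exact (ih h').imp (.sub i) (.sub i)

theorem Above.sub_inv {n : ℕ} {t : Fin n → PTree} {i : Fin n} {x y : Edge (t i)}
    (h : Above (.sub (t := t) i x) (.sub i y)) : Above x y := by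
  cases h with
  | sub _ h => exact h

theorem Above.sub_idx {n : ℕ} {t : Fin n → PTree} {i j : Fin n} {x : Edge (t i)} {y : Edge (t j)}
    (h : Above (.sub (t := t) i x) (.sub j y)) : i = j := by
  cases h with
  | sub _ h => rfl

theorem sub_injective {n : ℕ} {t : Fin n → PTree} (i : Fin n) :
    Function.Injective (Edge.sub (t := t) i) := by
  intro x y h
  cases h
  rfl

theorem Broad.map_sub {n : ℕ} {t : Fin n → PTree} (i : Fin n) {m : Multiset (Edge (t i))}
    {e : Edge (t i)} (h : Broad m e) : Broad (m.map (Edge.sub (t := t) i)) (.sub i e) := by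
  induction h with
  | refl e => exact .refl _
  | vertex h => exact .vertex (.sub i h)
  | @trans n c e m _ _ ih ih' =>
    rw [Multiset.map_map] at ih
    have := Broad.trans ih ih'
    rwa [← Multiset.coe_mapAddMonoidHom, ← map_sum] at this

/-- Grafting relations on top of the root vertex. -/
theorem Broad.graft {n : ℕ} {t : Fin n → PTree} {m : ∀ i, Multiset (Edge (t i))}
    (h : ∀ i, Broad (m i) (.root (t i))) :
    Broad (∑ i, (m i).map (Edge.sub (t := t) i)) (.root (.node n t)) :=
  .trans (.vertex (.root n t)) fun i => (h i).map_sub i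

theorem Vertex.above {T : PTree} {m : Multiset (Edge T)} {e : Edge T} (h : Vertex m e) :
    ∀ x ∈ m, Above x e := by
  induction h with
  | root n t => exact fun x _ => .root x
  | sub i _ ih =>
    intro x hx
    obtain ⟨y, hy, rfl⟩ := Multiset.mem_map.1 hx
    exact .sub i (ih y hy)

theorem Broad.above {T : PTree} {m : Multiset (Edge T)} {e : Edge T} (h : Broad m e) :
    ∀ x ∈ m, Above x e := by
  induction h with
  | refl e => intro x hx; rw [Multiset.mem_singleton.1 hx]; exact .rfl' _
  | vertex h => exact h.above
  | @trans n c e m _ _ ih ih' =>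
    intro x hx
    obtain ⟨i, -, hi⟩ := Multiset.mem_sum.1 hx
    exact (ih' i x hi).trans (ih _ (Multiset.mem_map_of_mem c (Finset.mem_univ i)))

theorem Vertex.antichain {T : PTree} {m : Multiset (Edge T)} {e : Edge T} (h : Vertex m e) :
    m.Nodup ∧ ∀ x ∈ m, ∀ y ∈ m, Above x y → x = y := by
  induction h with
  | root n t =>
    refine ⟨Multiset.Nodup.map (fun i j h => ?_) Finset.univ.nodup, ?_⟩
    · cases h; rfl
    · intro x hx y hy h
      obtain ⟨i, -, rfl⟩ := Multiset.mem_map.1 hx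
      obtain ⟨j, -, rfl⟩ := Multiset.mem_map.1 hy
      obtain rfl := h.sub_idx
      rfl
  | sub i _ ih =>
    refine ⟨Multiset.Nodup.map (sub_injective i) ih.1, ?_⟩
    intro x hx y hy h
    obtain ⟨x', hx', rfl⟩ := Multiset.mem_map.1 hx
    obtain ⟨y', hy', rfl⟩ := Multiset.mem_map.1 hy
    rw [ih.2 x' hx' y' hy' h.sub_inv]

theorem Broad.antichain {T : PTree} {m : Multiset (Edge T)} {e : Edge T} (h : Broad m e) :
    m.Nodup ∧ ∀ x ∈ m, ∀ y ∈ m, Above x y → x = y := by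
  induction h with
  | refl e => simp
  | vertex h => exact h.antichain
  | @trans n c e m h h' ih ih' =>
    have key : ∀ i j, Above (c i) (c j) → i = j := by
      intro i j hij
      have := ih.2 _ (Multiset.mem_map_of_mem c (Finset.mem_univ i)) _
        (Multiset.mem_map_of_mem c (Finset.mem_univ j)) hij
      exact Multiset.inj_on_of_nodup_map ih.1 i (Finset.mem_univ i) j (Finset.mem_univ j) this
    have key' : ∀ i j x, Above x (c i) → Above x (c j) → i = j := by
      intro i j x hi hj
      rcases hi.total hj with h | h
      · exact key i j h
      · exact (key j i h).symm
    constructor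
    · have : ∑ i, m i = Finset.univ.val.bind m := rfl
      rw [this, Multiset.nodup_bind]
      refine ⟨fun i _ => (ih' i).1, Multiset.Nodup.pairwise ?_ Finset.univ.nodup⟩
      intro i _ j _ hij
      refine Multiset.disjoint_left.2 fun {x} hx hx' => hij ?_
      exact key' i j x ((h' i).above x hx) ((h' j).above x hx')
    · intro x hx y hy hxy
      obtain ⟨i, -, hi⟩ := Multiset.mem_sum.1 hx
      obtain ⟨j, -, hj⟩ := Multiset.mem_sum.1 hy
      obtain rfl := key' i j x ((h' i).above x hi) (hxy.trans ((h' j).above y hj))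
      exact (ih' i).2 x hi y hj hxy

theorem Broad.injective {T : PTree} {n : ℕ} {c : Fin n → Edge T} {e : Edge T}
    (h : Broad (Finset.univ.val.map c) e) {i j : Fin n} (hij : Above (c i) (c j)) : i = j :=
  Multiset.inj_on_of_nodup_map h.antichain.1 i (Finset.mem_univ i) j (Finset.mem_univ j)
    (h.antichain.2 _ (Multiset.mem_map_of_mem c (Finset.mem_univ i)) _
      (Multiset.mem_map_of_mem c (Finset.mem_univ j)) hij)

theorem Broad.disjoint {T : PTree} {n : ℕ} {c : Fin n → Edge T} {e x : Edge T}
    (h : Broad (Finset.univ.val.map c) e) {i j : Fin n} (hi : Above x (c i))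
    (hj : Above x (c j)) : i = j := by
  rcases hi.total hj with h' | h'
  · exact h.injective h'
  · exact (h.injective h').symm

theorem exists_broad_root {T : PTree} (x : Edge T) : ∃ m, Broad m (.root T) ∧ x ∈ m := by
  induction x with
  | root T => exact ⟨_, .refl _, Multiset.mem_singleton_self _⟩
  | @sub n t i e ih =>
    obtain ⟨m, hm, he⟩ := ih
    classical
    refine ⟨_, Broad.graft (m := Function.update (fun j => {.root (t j)}) i m) fun j => ?_, ?_⟩
    · by_cases h : j = i
      · subst h; simpa using hm
      · simpa [Function.update_of_ne h] using Broad.refl _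
    · refine Multiset.mem_sum.2 ⟨i, Finset.mem_univ _, Multiset.mem_map_of_mem _ ?_⟩
      simpa using he

/-- Description of the order on edges through broad relations: `x` is above `y` iff `x` occurs in
some broad relation with target `y`. -/
theorem above_iff {T : PTree} {x y : Edge T} : Above x y ↔ ∃ m, Broad m y ∧ x ∈ m := by
  constructor
  · intro h
    induction h with
    | root x => exact exists_broad_root x
    | sub i _ ih =>
      obtain ⟨m, hm, hx⟩ := ih
      exact ⟨_, hm.map_sub i, Multiset.mem_map_of_mem _ hx⟩
  · rintro ⟨m, hm, hx⟩
    exact hm.above x hx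

theorem exists_broad_pair {T : PTree} (x y : Edge T) (h : ¬ Above x y) (h' : ¬ Above y x) :
    ∃ m, Broad m (.root T) ∧ x ∈ m ∧ y ∈ m := by
  induction x with
  | root T => exact absurd (.root _) h'
  | @sub n t i x ih =>
    cases y with
    | root => exact absurd (.root _) h
    | sub j y =>
      classical
      by_cases hij : i = j
      · subst hij
        obtain ⟨m, hm, hx, hy⟩ := ih y (fun k => h (.sub i k)) (fun k => h' (.sub i k))
        refine ⟨_, Broad.graft (m := Function.update (fun j => {.root (t j)}) i m) fun j => ?_,
          ?_, ?_⟩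
        · by_cases h : j = i
          · subst h; simpa using hm
          · simpa [Function.update_of_ne h] using Broad.refl _
        · refine Multiset.mem_sum.2 ⟨i, Finset.mem_univ _, Multiset.mem_map_of_mem _ ?_⟩
          simpa using hx
        · refine Multiset.mem_sum.2 ⟨i, Finset.mem_univ _, Multiset.mem_map_of_mem _ ?_⟩
          simpa using hy
      · choose m hm hx using fun z : Σ k, Edge (t k) => exists_broad_root z.2
        refine ⟨_, Broad.graft (m := fun k =>
          if hk : i = k then m ⟨i, x⟩ |>.map (fun e => hk ▸ e) else
            if hk : j = k then m ⟨j, y⟩ |>.map (fun e => hk ▸ e) else {.root (t k)})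
          fun k => ?_, ?_, ?_⟩
        · by_cases hk : i = k
          · subst hk; simpa using hm ⟨i, x⟩
          · by_cases hk' : j = k
            · subst hk'; simpa [hij] using hm ⟨j, y⟩
            · simpa [hk, hk'] using Broad.refl _
        · refine Multiset.mem_sum.2 ⟨i, Finset.mem_univ _, Multiset.mem_map_of_mem _ ?_⟩
          simpa using hx ⟨i, x⟩
        · refine Multiset.mem_sum.2 ⟨j, Finset.mem_univ _, Multiset.mem_map_of_mem _ ?_⟩
          simpa [hij] using hx ⟨j, y⟩

/-! ### The category of trees -/

/-- A map of trees: a map of edge sets that preserves broad relations. -/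
@[ext]
structure PTree.Hom (S T : PTree) where
  edge : Edge S → Edge T
  broad : ∀ {m : Multiset (Edge S)} {e : Edge S}, Broad m e → Broad (m.map edge) (edge e)

instance : Category PTree where
  Hom := PTree.Hom
  id T := ⟨id, fun h => by simpa using h⟩
  comp f g := ⟨g.edge ∘ f.edge, fun h => by
    rw [← Multiset.map_map]; exact g.broad (f.broad h)⟩

@[ext]
theorem hom_ext {S T : PTree} {f g : S ⟶ T} (h : ∀ e, f.edge e = g.edge e) : f = g :=
  PTree.Hom.ext (funext h)

@[simp] theorem id_edge (T : PTree) (e : Edge T) : PTree.Hom.edge (𝟙 T) e = e := rfl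

@[simp] theorem comp_edge {S T U : PTree} (f : S ⟶ T) (g : T ⟶ U) (e : Edge S) :
    (f ≫ g).edge e = g.edge (f.edge e) := rfl

theorem hom_above {S T : PTree} (f : S ⟶ T) {x y : Edge S} (h : Above x y) :
    Above (f.edge x) (f.edge y) := by
  obtain ⟨m, hm, hx⟩ := above_iff.1 h
  exact above_iff.2 ⟨_, f.broad hm, Multiset.mem_map_of_mem _ hx⟩

/-- Maps of trees preserve incomparability. -/
theorem hom_not_above {S T : PTree} (f : S ⟶ T) {x y : Edge S} (h : ¬ Above x y)
    (h' : ¬ Above y x) : ¬ Above (f.edge x) (f.edge y) := by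
  intro hxy
  obtain ⟨m, hm, hx, hy⟩ := exists_broad_pair x y h h'
  have hne : x ≠ y := fun e => h (e ▸ .rfl' _)
  have h1 := (f.broad hm).antichain
  exact hne (Multiset.inj_on_of_nodup_map h1.1 x hx y hy (h1.2 _ (Multiset.mem_map_of_mem _ hx) _
    (Multiset.mem_map_of_mem _ hy) hxy))

/-! ### Classes of maps of trees -/

/-- Tall maps: they send the tuple of leaves to the tuple of leaves and the root to the root. -/
def IsTall {S T : PTree} (f : S ⟶ T) : Prop :=
  (leaves S).map f.edge = leaves T ∧ f.edge (.root S) = .root T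

/-- Face maps: injective on edges. -/
def IsFace {S T : PTree} (f : S ⟶ T) : Prop := Function.Injective f.edge

/-- Inner faces: tall face maps. -/
def IsInnerFace {S T : PTree} (f : S ⟶ T) : Prop := IsFace f ∧ IsTall f

/-- Outer faces: faces `f` such that, whenever `f` is an inner face followed by a face, the
inner face is an isomorphism. -/
def IsOuterFace {S T : PTree} (f : S ⟶ T) : Prop :=
  IsFace f ∧ ∀ (U : PTree) (f₂ : S ⟶ U) (f₁ : U ⟶ T),
    IsInnerFace f₂ → IsFace f₁ → f₂ ≫ f₁ = f → IsIso f₂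

/-- Degeneracies: surjective on edges and preserving leaves. -/
def IsDegeneracy {S T : PTree} (f : S ⟶ T) : Prop :=
  Function.Surjective f.edge ∧ ∀ e ∈ leaves S, f.edge e ∈ leaves T

/-- Planar maps: compatible with the planar orders. -/
def IsPlanar {S T : PTree} (f : S ⟶ T) : Prop :=
  ∀ x y : Edge S, PlanarLE x y → PlanarLE (f.edge x) (f.edge y)

theorem IsTall.comp {S T U : PTree} {f : S ⟶ T} {g : T ⟶ U} (hf : IsTall f) (hg : IsTall g) :
    IsTall (f ≫ g) := by
  refine ⟨?_, ?_⟩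
  · rw [← hg.1, ← hf.1, Multiset.map_map]; rfl
  · rw [comp_edge, hf.2, hg.2]

theorem IsFace.comp {S T U : PTree} {f : S ⟶ T} {g : T ⟶ U} (hf : IsFace f) (hg : IsFace g) :
    IsFace (f ≫ g) :=
  fun _ _ h => hf (hg h)

theorem IsPlanar.comp {S T U : PTree} {f : S ⟶ T} {g : T ⟶ U} (hf : IsPlanar f)
    (hg : IsPlanar g) : IsPlanar (f ≫ g) := fun x y h => hg _ _ (hf x y h)

/-! ### The strings of maps -/

/-- Composable strings `S ⟶ J₀ ⟶ J₁ ⟶ ⋯ ⟶ Jₙ ⟶ T` in which `S ⟶ J₀` is tall, the `Jᵢ ⟶ Jᵢ₊₁` are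
planar inner faces and `Jₙ ⟶ T` is a planar face. -/
@[ext]
structure NWString (n : SimplexCategory) (S T : PTree) where
  J : ComposableArrows PTree n.len
  fst : S ⟶ J.obj 0
  last : J.obj (Fin.last n.len) ⟶ T
  tall_fst : IsTall fst
  inner : ∀ i : Fin n.len, IsInnerFace (J.map (homOfLE i.castSucc_le_succ)) ∧
    IsPlanar (J.map (homOfLE i.castSucc_le_succ))
  face_last : IsFace last ∧ IsPlanar last

theorem NWString.inner_map {n : SimplexCategory} {S T : PTree} (x : NWString n S T) :
    ∀ {i j : Fin (n.len + 1)} (h : i ⟶ j), IsInnerFace (x.J.map h) ∧ IsPlanar (x.J.map h) := by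
  have key : ∀ (i j : Fin (n.len + 1)) (h : i ≤ j),
      IsInnerFace (x.J.map (homOfLE h)) ∧ IsPlanar (x.J.map (homOfLE h)) := by
    intro i j
    induction j using Fin.induction with
    | zero =>
      intro h
      obtain rfl : i = 0 := le_antisymm h (Fin.zero_le _)
      have : x.J.map (homOfLE h) = 𝟙 _ := x.J.map_id _
      rw [this]
      refine ⟨⟨Function.injective_id, ?_, rfl⟩, fun _ _ h => h⟩
      exact Multiset.map_id _
    | succ j ih =>
      intro h
      rcases h.lt_or_eq with hlt | rfl
      · have hle : i ≤ j.castSucc := Fin.le_castSucc_iff.2 hlt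
        have : x.J.map (homOfLE h) =
            x.J.map (homOfLE hle) ≫ x.J.map (homOfLE j.castSucc_le_succ) := by
          rw [← x.J.map_comp]; rfl
        rw [this]
        exact ⟨⟨(ih hle).1.1.comp (x.inner j).1.1, (ih hle).1.2.comp (x.inner j).1.2⟩,
          (ih hle).2.comp (x.inner j).2⟩
      · have : x.J.map (homOfLE h) = 𝟙 _ := x.J.map_id _
        rw [this]
        refine ⟨⟨Function.injective_id, ?_, rfl⟩, fun _ _ h => h⟩
        exact Multiset.map_id _
  exact fun {i j} h => key i j (leOfHom h)

/-- The simplicial operators forget or repeat the trees `Jᵢ` (composing the adjacent maps). -/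
def NWString.simp_op {m n : SimplexCategory} {S T : PTree} (θ : m ⟶ n) (x : NWString n S T) :
    NWString m S T where
  J := θ.toOrderHom.monotone.functor ⋙ x.J
  fst := x.fst ≫ x.J.map (homOfLE (Fin.zero_le (θ.toOrderHom 0)))
  last := x.J.map (homOfLE (Fin.le_last (θ.toOrderHom (Fin.last m.len)))) ≫ x.last
  tall_fst := x.tall_fst.comp (x.inner_map _).1.2
  inner _ := x.inner_map _
  face_last := ⟨(x.inner_map _).1.1.comp x.face_last.1, (x.inner_map _).2.comp x.face_last.2⟩

/-- `RestrictLadder f x' x`: there are outer faces `v i` from the trees of the string `x'` (on the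
source of `f`) to the trees of the string `x` (on the target of `f`) which form a commutative ladder
with the two strings, with `f` on the left and the identity of `T` on the right. As the first map of
`x'` is tall and its other maps are planar, this says that the trees of `x'` are obtained from those of
`x` by tall-followed-by-outer-face factorizations. -/
def RestrictLadder {n : SimplexCategory} {S' S T : PTree} (f : S' ⟶ S) (x' : NWString n S' T)
    (x : NWString n S T) : Prop :=
  ∃ v : x'.J ⟶ x.J, (∀ i, IsOuterFace (v.app i)) ∧
    x'.fst ≫ v.app 0 = f ≫ x.fst ∧ v.app (Fin.last n.len) ≫ x.last = x'.last

/-- `PushLadder g x x'`: there are degeneracies `v i` from the trees of the string `x` (into the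
source of `g`) to the trees of the string `x'` (into the target of `g`) which form a commutative
ladder with the two strings, with the identity of `S` on the left and `g` on the right. As the last
map of `x'` is a planar face, this says that the trees of `x'` are obtained from those of `x` by
degeneracy-followed-by-face factorizations. -/
def PushLadder {n : SimplexCategory} {S T T' : PTree} (g : T ⟶ T') (x : NWString n S T)
    (x' : NWString n S T') : Prop :=
  ∃ v : x.J ⟶ x'.J, (∀ i, IsDegeneracy (v.app i)) ∧
    x.fst ≫ v.app 0 = x'.fst ∧ v.app (Fin.last n.len) ≫ x'.last = x.last ≫ g

/-! ### Dendroidal sets and the strict Segal condition -/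

/-- Dendroidal sets. -/
abbrev DSet := PTreeᵒᵖ ⥤ Type

/-- Simplicial dendroidal sets. -/
abbrev SDSet := SimplicialObject DSet

/-- The Segal core of `T`: the union, inside the representable presheaf, of the images of
the planar outer faces with no inner edges. -/
def segalCore (T : PTree) : Subfunctor (yoneda.obj T) where
  obj S := {φ | ∃ (U : PTree) (u : U ⟶ T) (ψ : S.unop ⟶ U), IsOuterFace u ∧ IsPlanar u ∧
    (∀ e : Edge U, e = .root U ∨ e ∈ leaves U) ∧ ψ ≫ u = φ}
  map := by
    rintro S S' f φ ⟨U, u, ψ, hu, hu', hU, rfl⟩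
    exact ⟨U, u, f.unop ≫ ψ, hu, hu', hU, Category.assoc _ _ _⟩

/-- The strict Segal condition: for every tree `T`, restriction along the inclusion of the Segal
core is a bijection from maps out of the representable presheaf of `T` (that is, from `X(T)`)
to maps out of the Segal core. -/
def StrictSegal (X : DSet) : Prop :=
  ∀ T : PTree, Function.Bijective
    fun g : yoneda.obj T ⟶ X => (segalCore T).ι ≫ g

/-- `X(η)` is a discrete simplicial set: all simplicial operators are bijections on it. -/
def ConstantObjects (X : SDSet) : Prop :=
  ∀ {m n : SimplexCategory} (θ : m ⟶ n),
    Function.Bijective ((X.map θ.op).app (op PTree.stick))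

/-! ### Colored operads -/

/-- Colored (symmetric) operads in sets. The composition `comp` is taken along a bijection `e` of
`Fin m` with the inputs of the operations plugged in: for the lexicographic bijection it is the usual
operadic composition, and in general this followed by a symmetry. Colors of inputs are matched through
propositional equalities, so that all axioms are honest equations. -/
structure Operad where
  Color : Type
  /-- operations with inputs of colors `c 0, …, c (n - 1)` and output of color `c₀` -/
  Op : {n : ℕ} → (c : Fin n → Color) → (c₀ : Color) → Type
  /-- the symmetric group actions -/
  act : {m n : ℕ} → (σ : Fin m ≃ Fin n) → {c : Fin n → Color} → {c' : Fin m → Color} →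
    {c₀ : Color} → (h : ∀ t, c' t = c (σ t)) → Op c c₀ → Op c' c₀
  one : (c₀ : Color) → Op (fun _ : Fin 1 => c₀) c₀
  comp : {n : ℕ} → {k : Fin n → ℕ} → {m : ℕ} → (e : Fin m ≃ Σ i, Fin (k i)) →
    {c : Fin n → Color} → {d : ∀ i, Fin (k i) → Color} → {b : Fin m → Color} → {c₀ : Color} →
    (h : ∀ t, b t = d (e t).1 (e t).2) → Op c c₀ → (∀ i, Op (d i) (c i)) → Op b c₀
  act_refl : ∀ {n : ℕ} {c : Fin n → Color} {c₀ : Color} (x : Op c c₀),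
    act (Equiv.refl _) (fun _ => rfl) x = x
  act_trans : ∀ {l m n : ℕ} (τ : Fin l ≃ Fin m) (σ : Fin m ≃ Fin n) {c : Fin n → Color}
    {c' : Fin m → Color} {c'' : Fin l → Color} {c₀ : Color} (h : ∀ t, c' t = c (σ t))
    (h' : ∀ t, c'' t = c' (τ t)) (h'' : ∀ t, c'' t = c ((τ.trans σ) t)) (x : Op c c₀),
    act τ h' (act σ h x) = act (τ.trans σ) h'' x
  /-- reindexing a composite -/
  act_comp : ∀ {n : ℕ} {k : Fin n → ℕ} {m m' : ℕ} (τ : Fin m' ≃ Fin m)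
    (e : Fin m ≃ Σ i, Fin (k i)) {c : Fin n → Color} {d : ∀ i, Fin (k i) → Color}
    {b : Fin m → Color} {b' : Fin m' → Color} {c₀ : Color} (h : ∀ t, b t = d (e t).1 (e t).2)
    (h' : ∀ t, b' t = b (τ t)) (h'' : ∀ t, b' t = d ((τ.trans e) t).1 ((τ.trans e) t).2)
    (x : Op c c₀) (y : ∀ i, Op (d i) (c i)),
    act τ h' (comp e h x y) = comp (τ.trans e) h'' x y
  /-- equivariance in the outer operation -/
  comp_act_left : ∀ {n n' : ℕ} {k : Fin n → ℕ} {m : ℕ} (σ : Fin n' ≃ Fin n)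
    (e : Fin m ≃ Σ i, Fin (k (σ i))) {c : Fin n → Color} {d : ∀ i, Fin (k i) → Color}
    {b : Fin m → Color} {c₀ : Color} (h : ∀ t, b t = d (σ (e t).1) (e t).2)
    (x : Op c c₀) (y : ∀ i, Op (d i) (c i)),
    comp e (d := fun i => d (σ i)) h (act σ (c' := fun i => c (σ i)) (fun _ => rfl) x)
        (fun i => y (σ i)) =
      comp (e.trans (Equiv.sigmaCongrLeft (β := fun i => Fin (k i)) σ)) h x y
  /-- equivariance in the inner operations -/
  comp_act_right : ∀ {n : ℕ} {k k' : Fin n → ℕ} {m : ℕ} (σ : ∀ i, Fin (k' i) ≃ Fin (k i))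
    (e : Fin m ≃ Σ i, Fin (k' i)) {c : Fin n → Color} {d : ∀ i, Fin (k i) → Color}
    {b : Fin m → Color} {c₀ : Color} (h : ∀ t, b t = d (e t).1 (σ _ (e t).2))
    (x : Op c c₀) (y : ∀ i, Op (d i) (c i)),
    comp e (d := fun i j => d i (σ i j)) h x (fun i => act (σ i) (fun _ => rfl) (y i)) =
      comp (e.trans (Equiv.sigmaCongrRight σ)) h x y
  one_comp : ∀ {n m : ℕ} (e : Fin m ≃ Σ _ : Fin 1, Fin n) {c : Fin n → Color}
    {b : Fin m → Color} {c₀ : Color} (h : ∀ t, b t = c (e t).2) (x : Op c c₀),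
    comp e (d := fun _ => c) h (one c₀) (fun _ => x) =
      act (e.trans ((Equiv.sigmaEquivProd (Fin 1) (Fin n)).trans (Equiv.uniqueProd _ _))) h x
  comp_one : ∀ {n m : ℕ} (e : Fin m ≃ Σ _ : Fin n, Fin 1) {c : Fin n → Color}
    {b : Fin m → Color} {c₀ : Color} (h : ∀ t, b t = c (e t).1) (x : Op c c₀),
    comp e (d := fun i _ => c i) h x (fun i => one (c i)) =
      act (e.trans ((Equiv.sigmaEquivProd (Fin n) (Fin 1)).trans (Equiv.prodUnique _ _))) h x
  /-- associativity; `hidx` says that the two ways to index the inputs agree -/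
  assoc : ∀ {n : ℕ} {k : Fin n → ℕ} {l : ∀ i, Fin (k i) → ℕ} {m r : ℕ} {q : Fin n → ℕ}
    (f : Fin m ≃ Σ i, Fin (k i)) (g : Fin r ≃ Σ p, Fin (l (f p).1 (f p).2))
    (f' : ∀ i, Fin (q i) ≃ Σ j, Fin (l i j)) (g' : Fin r ≃ Σ i, Fin (q i))
    (_hidx : ∀ t, (⟨f (g t).1, (g t).2⟩ : Σ p : Σ i, Fin (k i), Fin (l p.1 p.2)) =
      ⟨⟨(g' t).1, (f' _ (g' t).2).1⟩, (f' _ (g' t).2).2⟩)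
    {c : Fin n → Color} {d : ∀ i, Fin (k i) → Color} {b : ∀ i j, Fin (l i j) → Color}
    {a : Fin r → Color} {c₀ : Color}
    (h : ∀ t, a t = b (f (g t).1).1 (f (g t).1).2 (g t).2)
    (h' : ∀ t, a t = b (g' t).1 (f' _ (g' t).2).1 (f' _ (g' t).2).2)
    (x : Op c c₀) (y : ∀ i, Op (d i) (c i)) (z : ∀ i j, Op (b i j) (d i j)),
    comp g (d := fun p => b (f p).1 (f p).2) h
        (comp f (b := fun p => d (f p).1 (f p).2) (fun _ => rfl) x y)
        (fun p => z (f p).1 (f p).2) =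
      comp g' (d := fun i s => b i (f' i s).1 (f' i s).2) h' x
        (fun i => comp (f' i) (fun _ => rfl) (y i) (z i))

/-- Maps of colored operads. -/
@[ext]
structure Operad.Hom (P Q : Operad) where
  color : P.Color → Q.Color
  op : {n : ℕ} → {c : Fin n → P.Color} → {c₀ : P.Color} → P.Op c c₀ →
    Q.Op (fun i => color (c i)) (color c₀)
  op_act : ∀ {m n : ℕ} (σ : Fin m ≃ Fin n) {c : Fin n → P.Color} {c' : Fin m → P.Color}
    {c₀ : P.Color} (h : ∀ t, c' t = c (σ t)) (x : P.Op c c₀),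
    op (P.act σ h x) = Q.act σ (fun t => congrArg color (h t)) (op x)
  op_one : ∀ c₀ : P.Color, op (P.one c₀) = Q.one (color c₀)
  op_comp : ∀ {n : ℕ} {k : Fin n → ℕ} {m : ℕ} (e : Fin m ≃ Σ i, Fin (k i))
    {c : Fin n → P.Color} {d : ∀ i, Fin (k i) → P.Color} {b : Fin m → P.Color} {c₀ : P.Color}
    (h : ∀ t, b t = d (e t).1 (e t).2) (x : P.Op c c₀) (y : ∀ i, P.Op (d i) (c i)),
    op (P.comp e h x y) =
      Q.comp e (d := fun i j => color (d i j)) (fun t => congrArg color (h t)) (op x)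
        (fun i => op (y i))

instance : Category Operad where
  Hom := Operad.Hom
  id P := ⟨id, id, fun _ _ _ _ _ _ => rfl, fun _ => rfl, fun _ _ _ _ _ _ _ _ => rfl⟩
  comp F G :=
    { color := G.color ∘ F.color
      op := fun x => G.op (F.op x)
      op_act := fun σ _ _ _ h x => by rw [F.op_act, G.op_act]
      op_one := fun c => by rw [F.op_one, G.op_one]; rfl
      op_comp := fun e _ _ _ _ h x y => by rw [F.op_comp, G.op_comp] }

/-- Simplicial operads: simplicial objects in operads with constant set of objects (colors). -/
abbrev SOperad := ObjectProperty.FullSubcategory (C := SimplicialObject Operad) fun X =>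
  ∀ {m n : SimplexCategory} (θ : m ⟶ n), Function.Bijective (X.map θ.op).color

/-! ### The operad of a tree and the nerve -/

theorem map_univ_comp {T : PTree} {m n : ℕ} (σ : Fin m ≃ Fin n) {c : Fin n → Edge T}
    {c' : Fin m → Edge T} (h : ∀ t, c' t = c (σ t)) :
    Finset.univ.val.map c' = Finset.univ.val.map c := by
  obtain rfl : c' = c ∘ σ := funext h
  rw [← Multiset.map_map]
  congr 1
  exact congrArg Finset.val (Finset.map_univ_equiv σ)

theorem broad_comp {T : PTree} {n : ℕ} {k : Fin n → ℕ} {m : ℕ} (e : Fin m ≃ Σ i, Fin (k i))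
    {c : Fin n → Edge T} {d : ∀ i, Fin (k i) → Edge T} {b : Fin m → Edge T} {c₀ : Edge T}
    (h : ∀ t, b t = d (e t).1 (e t).2) (hx : Broad (Finset.univ.val.map c) c₀)
    (hy : ∀ i, Broad (Finset.univ.val.map (d i)) (c i)) :
    Broad (Finset.univ.val.map b) c₀ := by
  have key : Finset.univ.val.map b = ∑ i, Finset.univ.val.map (d i) := by
    have h1 : ∀ {ι : Type} [Fintype ι] (g : ι → Edge T),
        Finset.univ.val.map g = ∑ i, ({g i} : Multiset (Edge T)) := fun g =>
      (Multiset.bind_singleton _ g).symm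
    simp_rw [h1]
    rw [← Fintype.sum_sigma', ← e.sum_comp]
    simp [h]
  rw [key]
  exact .trans hx hy

theorem Broad.above' {T : PTree} {n : ℕ} {c : Fin n → Edge T} {c₀ : Edge T}
    (h : Broad (Finset.univ.val.map c) c₀) (i : Fin n) : Above (c i) c₀ :=
  h.above _ (Multiset.mem_map_of_mem c (Finset.mem_univ i))

/-- The operad `Ω(T)`: its colors are the edges of `T`, and there is one operation for each
broad relation. -/
def omegaOperad (T : PTree) : Operad where
  Color := Edge T
  Op c c₀ := PLift (Broad (Finset.univ.val.map c) c₀)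
  act σ _ _ _ h x := ⟨map_univ_comp σ h ▸ x.down⟩
  one c₀ := ⟨by simpa using Broad.refl c₀⟩
  comp e _ _ _ _ h x y := ⟨broad_comp e h x.down fun i => (y i).down⟩
  act_refl _ := rfl
  act_trans _ _ _ _ _ _ _ _ _ _ := rfl
  act_comp _ _ _ _ _ _ _ _ _ _ _ _ := rfl
  comp_act_left _ _ _ _ _ _ _ _ _ := rfl
  comp_act_right _ _ _ _ _ _ _ _ _ := rfl
  one_comp _ _ _ _ _ _ := rfl
  comp_one _ _ _ _ _ _ := rfl
  assoc _ _ _ _ _ _ _ _ _ _ _ _ _ _ _ := rfl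

theorem broad_map {T T' : PTree} (f : T ⟶ T') {n : ℕ} {c : Fin n → Edge T} {c₀ : Edge T}
    (h : Broad (Finset.univ.val.map c) c₀) :
    Broad (Finset.univ.val.map fun i => f.edge (c i)) (f.edge c₀) := by
  have := f.broad h
  rwa [Multiset.map_map] at this

/-- `Ω(-)` as a functor from trees to operads. -/
def omega : PTree ⥤ Operad where
  obj := omegaOperad
  map f :=
    { color := f.edge
      op := fun x => ⟨broad_map f x.down⟩
      op_act := fun _ _ _ _ _ _ => rfl
      op_one := fun _ => rfl
      op_comp := fun _ _ _ _ _ _ _ _ => rfl }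
  map_id _ := rfl
  map_comp _ _ := rfl

/-- The nerve of operads: `N P (S)` is the set of operad maps `Ω(S) ⟶ P`. -/
def operadNerve : Operad ⥤ DSet := yoneda ⋙ (Functor.whiskeringLeft _ _ _).obj omega.op

/-- The nerve of simplicial operads, taken levelwise. -/
def simplicialNerve : SOperad ⥤ SDSet :=
  ObjectProperty.ι _ ⋙ (SimplicialObject.whiskering _ _).obj operadNerve

/-! ### The Boardman–Vogt operad of a tree -/

/-- The inner edges of the subtree of `T` with leaves `c 0, …, c (n - 1)` and root `c₀`: the edges
that are strictly above `c₀` and not above (or equal to) any of the `c i`. -/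
def Inn {T : PTree} {n : ℕ} (c : Fin n → Edge T) (c₀ : Edge T) : Set (Edge T) :=
  {x | Above x c₀ ∧ x ≠ c₀ ∧ ∀ i, ¬ Above x (c i)}

/-- The operations of the Boardman–Vogt construction with lengths in `L`: an operation of `Ω(T)`,
that is, a subtree of `T` with given leaves and root, together with a length for each of its inner
edges. -/
@[ext]
structure WOp {T : PTree} (L : Type) {n : ℕ} (c : Fin n → Edge T) (c₀ : Edge T) where
  rel : Broad (Finset.univ.val.map c) c₀
  len : Inn c c₀ → L

section W

variable {T T' T'' : PTree} {L L' : Type} [CompleteLattice L] [CompleteLattice L']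

open Classical in
/-- The length function extended by `1` off the inner edges. -/
noncomputable def WOp.full {n : ℕ} {c : Fin n → Edge T} {c₀ : Edge T} (a : WOp L c c₀)
    (x : Edge T) : L := if h : x ∈ Inn c c₀ then a.len ⟨x, h⟩ else ⊤

theorem WOp.full_of_mem {n : ℕ} {c : Fin n → Edge T} {c₀ : Edge T} (a : WOp L c c₀)
    {x : Edge T} (h : x ∈ Inn c c₀) : a.full x = a.len ⟨x, h⟩ := dif_pos h

theorem WOp.full_of_not_mem {n : ℕ} {c : Fin n → Edge T} {c₀ : Edge T} (a : WOp L c c₀)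
    {x : Edge T} (h : x ∉ Inn c c₀) : a.full x = ⊤ := dif_neg h

theorem WOp.ext_full {n : ℕ} {c : Fin n → Edge T} {c₀ : Edge T} {a b : WOp L c c₀}
    (h : ∀ x ∈ Inn c c₀, a.full x = b.full x) : a = b := by
  refine WOp.ext (funext fun x => ?_)
  rw [← a.full_of_mem x.2, ← b.full_of_mem x.2]
  exact h _ x.2

/-- Reindexing the inputs. -/
noncomputable def WOp.act {m n : ℕ} (σ : Fin m ≃ Fin n) {c : Fin n → Edge T}
    {c' : Fin m → Edge T} {c₀ : Edge T} (h : ∀ t, c' t = c (σ t)) (a : WOp L c c₀) :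
    WOp L c' c₀ where
  rel := map_univ_comp σ h ▸ a.rel
  len x := a.full x

/-- The composite: the inner edges of the grafted tree that are inner edges of one of the
composed trees keep their length, the newly arising inner edges get length `1 = ⊤`.
(At most one of the terms of the infimum is not `⊤`.) -/
noncomputable def WOp.comp {n : ℕ} {k : Fin n → ℕ} {m : ℕ} (e : Fin m ≃ Σ i, Fin (k i))
    {c : Fin n → Edge T} {d : ∀ i, Fin (k i) → Edge T} {b : Fin m → Edge T} {c₀ : Edge T}
    (h : ∀ t, b t = d (e t).1 (e t).2) (a : WOp L c c₀) (a' : ∀ i, WOp L (d i) (c i)) :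
    WOp L b c₀ where
  rel := broad_comp e h a.rel fun i => (a' i).rel
  len x := a.full x ⊓ ⨅ i, (a' i).full x

theorem Inn_act {m n : ℕ} (σ : Fin m ≃ Fin n) {c : Fin n → Edge T}
    {c' : Fin m → Edge T} {c₀ : Edge T} (h : ∀ t, c' t = c (σ t)) : Inn c' c₀ = Inn c c₀ := by
  ext x
  simp only [Inn, Set.mem_ofPred_eq, h]
  rw [σ.forall_congr_left (p := fun i => ¬ Above x (c (σ i)))]
  simp

@[simp] theorem WOp.full_act {m n : ℕ} (σ : Fin m ≃ Fin n) {c : Fin n → Edge T}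
    {c' : Fin m → Edge T} {c₀ : Edge T} (h : ∀ t, c' t = c (σ t)) (a : WOp L c c₀)
    (x : Edge T) : (WOp.act σ h a).full x = a.full x := by
  by_cases hx : x ∈ Inn c' c₀
  · rw [WOp.full_of_mem _ hx]; rfl
  · rw [WOp.full_of_not_mem _ hx, WOp.full_of_not_mem]
    rwa [← Inn_act σ h]

theorem Inn_comp_left {n : ℕ} {k : Fin n → ℕ} {m : ℕ} (e : Fin m ≃ Σ i, Fin (k i))
    {c : Fin n → Edge T} {d : ∀ i, Fin (k i) → Edge T} {b : Fin m → Edge T} {c₀ : Edge T}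
    (h : ∀ t, b t = d (e t).1 (e t).2) (hy : ∀ i, Broad (Finset.univ.val.map (d i)) (c i))
    {x : Edge T} (hx' : x ∈ Inn c c₀) : x ∈ Inn b c₀ := by
  refine ⟨hx'.1, hx'.2.1, fun t ht => hx'.2.2 (e t).1 ?_⟩
  rw [h t] at ht
  exact ht.trans ((hy _).above' _)

theorem Inn_comp_right {n : ℕ} {k : Fin n → ℕ} {m : ℕ} (e : Fin m ≃ Σ i, Fin (k i))
    {c : Fin n → Edge T} {d : ∀ i, Fin (k i) → Edge T} {b : Fin m → Edge T} {c₀ : Edge T}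
    (h : ∀ t, b t = d (e t).1 (e t).2) (hx : Broad (Finset.univ.val.map c) c₀)
    (hy : ∀ i, Broad (Finset.univ.val.map (d i)) (c i)) {i : Fin n}
    {x : Edge T} (hx' : x ∈ Inn (d i) (c i)) : x ∈ Inn b c₀ := by
  have h0 : Above (c i) c₀ := hx.above' i
  refine ⟨hx'.1.trans h0, ?_, fun t ht => ?_⟩
  · rintro rfl
    exact hx'.2.1 (hx'.1.antisymm h0)
  · rw [h t] at ht
    have h1 := ht.trans ((hy _).above' _)
    obtain rfl := hx.disjoint hx'.1 h1
    exact hx'.2.2 _ ht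

@[simp] theorem WOp.full_comp {n : ℕ} {k : Fin n → ℕ} {m : ℕ} (e : Fin m ≃ Σ i, Fin (k i))
    {c : Fin n → Edge T} {d : ∀ i, Fin (k i) → Edge T} {b : Fin m → Edge T} {c₀ : Edge T}
    (h : ∀ t, b t = d (e t).1 (e t).2) (a : WOp L c c₀) (a' : ∀ i, WOp L (d i) (c i))
    (x : Edge T) : (WOp.comp e h a a').full x = a.full x ⊓ ⨅ i, (a' i).full x := by
  by_cases hx : x ∈ Inn b c₀
  · rw [WOp.full_of_mem _ hx]; rfl
  · rw [WOp.full_of_not_mem _ hx,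
      WOp.full_of_not_mem _ fun h' => hx (Inn_comp_left e h (fun i => (a' i).rel) h')]
    simp only [le_top, inf_of_le_right]
    symm
    rw [iInf_eq_top]
    exact fun i => WOp.full_of_not_mem _ fun h' =>
      hx (Inn_comp_right e h a.rel (fun i => (a' i).rel) h')

/-- The identity operations: subtrees with one edge, having no inner edges. -/
noncomputable def WOp.one (L : Type) [CompleteLattice L] (c₀ : Edge T) :
    WOp L (fun _ : Fin 1 => c₀) c₀ where
  rel := by simpa using Broad.refl c₀
  len _ := ⊤

@[simp] theorem WOp.full_one (c₀ : Edge T) (x : Edge T) : (WOp.one L c₀).full x = ⊤ := by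
  by_cases hx : x ∈ Inn (fun _ : Fin 1 => c₀) c₀
  · rw [WOp.full_of_mem _ hx]; rfl
  · rw [WOp.full_of_not_mem _ hx]

/-- The Boardman–Vogt construction on `Ω(T)` with lengths in `L`. -/
noncomputable def wOperad (T : PTree) (L : Type) [CompleteLattice L] : Operad where
  Color := Edge T
  Op c c₀ := WOp L c c₀
  act σ _ _ _ h a := WOp.act σ h a
  one c₀ := WOp.one L c₀
  comp e _ _ _ _ h a a' := WOp.comp e h a a'
  act_refl a := WOp.ext_full fun x _ => WOp.full_act _ _ a x
  act_trans τ σ _ _ _ _ h h' h'' a := WOp.ext_full fun x _ =>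
    (WOp.full_act τ h' _ x).trans ((WOp.full_act σ h a x).trans
      (WOp.full_act (τ.trans σ) h'' a x).symm)
  act_comp τ e _ _ _ _ _ h h' h'' a a' := WOp.ext_full fun x _ =>
    (WOp.full_act τ h' _ x).trans ((WOp.full_comp e h a a' x).trans
      (WOp.full_comp (τ.trans e) h'' a a' x).symm)
  comp_act_left {n n' k m} σ e c d b c₀ h a a' := WOp.ext_full fun x _ => by
    refine Eq.trans ?_ (WOp.full_comp (d := d)
      (e.trans (Equiv.sigmaCongrLeft (β := fun i => Fin (k i)) σ)) h a a' x).symm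
    rw [WOp.full_comp, WOp.full_act, σ.iInf_comp (g := fun i => (a' i).full x)]
  comp_act_right σ e _ _ _ _ h a a' := WOp.ext_full fun x _ => by
    refine Eq.trans ?_ (WOp.full_comp (e.trans (Equiv.sigmaCongrRight σ)) h a a' x).symm
    simp
  one_comp _ _ _ _ h a := WOp.ext_full fun x _ => by
    refine Eq.trans ?_ (WOp.full_act _ h a x).symm
    simp
  comp_one _ _ _ _ h a := WOp.ext_full fun x _ => by
    refine Eq.trans ?_ (WOp.full_act _ h a x).symm
    simp
  assoc f g f' g' _ c d b a c₀ h h' x y z := WOp.ext_full fun s _ => by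
    simp only [WOp.full_comp]
    rw [inf_assoc, iInf_inf_eq]
    congr 2
    rw [f.iInf_comp (g := fun p => (z p.1 p.2).full s), iInf_sigma]

/-- Changing lengths. -/
def WOp.mapLen (g : CompleteLatticeHom L L') {n : ℕ} {c : Fin n → Edge T} {c₀ : Edge T}
    (a : WOp L c c₀) : WOp L' c c₀ := ⟨a.rel, fun x => g (a.len x)⟩

@[simp] theorem WOp.full_mapLen (g : CompleteLatticeHom L L') {n : ℕ} {c : Fin n → Edge T}
    {c₀ : Edge T} (a : WOp L c c₀) (x : Edge T) : (a.mapLen g).full x = g (a.full x) := by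
  by_cases hx : x ∈ Inn c c₀
  · rw [WOp.full_of_mem _ hx, WOp.full_of_mem _ hx]; rfl
  · rw [WOp.full_of_not_mem _ hx, WOp.full_of_not_mem _ hx, map_top]

theorem WOp.mapLen_comp (g : CompleteLatticeHom L L') {n : ℕ} {k : Fin n → ℕ} {m : ℕ}
    (e : Fin m ≃ Σ i, Fin (k i)) {c : Fin n → Edge T} {d : ∀ i, Fin (k i) → Edge T}
    {b : Fin m → Edge T} {c₀ : Edge T} (h : ∀ t, b t = d (e t).1 (e t).2) (a : WOp L c c₀)
    (a' : ∀ i, WOp L (d i) (c i)) :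
    (WOp.comp e h a a').mapLen g = WOp.comp e h (a.mapLen g) (fun i => (a' i).mapLen g) :=
  WOp.ext_full fun x _ => by simp [map_iInf]

/-- Changing lengths, as a map of operads. -/
noncomputable def wMapLen (T : PTree) (g : CompleteLatticeHom L L') :
    wOperad T L ⟶ wOperad T L' where
  color := id
  op a := WOp.mapLen g a
  op_act σ _ _ _ h a := WOp.ext_full fun x _ =>
    (WOp.full_mapLen g (a.act σ h) x).trans ((congrArg g (WOp.full_act σ h a x)).trans
      ((WOp.full_act σ h (a.mapLen g) x).trans (a.full_mapLen g x)).symm)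
  op_one c₀ := WOp.ext_full fun x _ =>
    (WOp.full_mapLen g (WOp.one L c₀) x).trans ((congrArg g (WOp.full_one c₀ x)).trans
      ((map_top g).trans (WOp.full_one c₀ x).symm))
  op_comp e _ _ _ _ h a a' := WOp.mapLen_comp g e h a a'

/-- The action of maps of trees: an inner edge of the image subtree gets as its length the maximum
of the lengths of the inner edges mapped to it, hence `0` if there are none. -/
def WOp.push (f : T ⟶ T') {n : ℕ} {c : Fin n → Edge T} {c₀ : Edge T} (a : WOp L c c₀) :
    WOp L (fun i => f.edge (c i)) (f.edge c₀) where
  rel := broad_map f a.rel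
  len y := ⨆ x : {x : Inn c c₀ // f.edge x = y}, a.len x

theorem WOp.full_push_of_mem (f : T ⟶ T') {n : ℕ} {c : Fin n → Edge T} {c₀ : Edge T}
    (a : WOp L c c₀) {y : Edge T'} (hy : y ∈ Inn (fun i => f.edge (c i)) (f.edge c₀)) :
    (a.push f).full y = ⨆ x ∈ Inn c c₀, ⨆ _ : f.edge x = y, a.full x := by
  rw [WOp.full_of_mem _ hy]
  apply le_antisymm
  · refine iSup_le fun x => ?_
    rw [← a.full_of_mem x.1.2]
    exact le_iSup₂_of_le x.1.1 x.1.2 (le_iSup_of_le x.2 le_rfl)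
  · refine iSup₂_le fun x hx => iSup_le fun h => ?_
    rw [a.full_of_mem hx]
    exact le_iSup (fun x : {x : Inn c c₀ // f.edge x = y} => a.len x) ⟨⟨x, hx⟩, h⟩

/-- Inner edges are mapped to inner edges or to the leaves or the root. -/
theorem Inn_map (f : T ⟶ T') {n : ℕ} {c : Fin n → Edge T} {c₀ : Edge T} {x : Edge T}
    (hx : x ∈ Inn c c₀) : f.edge x ∈ Inn (fun i => f.edge (c i)) (f.edge c₀) ∨
      f.edge x = f.edge c₀ ∨ ∃ i, f.edge x = f.edge (c i) := by
  by_cases h0 : f.edge x = f.edge c₀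
  · exact .inr (.inl h0)
  by_cases h1 : ∃ i, f.edge x = f.edge (c i)
  · exact .inr (.inr h1)
  refine .inl ⟨hom_above f hx.1, h0, fun i hi => ?_⟩
  by_cases h2 : Above (c i) x
  · exact h1 ⟨i, hi.antisymm (hom_above f h2)⟩
  · exact hom_not_above f (hx.2.2 i) h2 hi

theorem Inn_of_map (f : T ⟶ T') {n : ℕ} {c : Fin n → Edge T} {c₀ : Edge T} {x : Edge T}
    (hx : Above x c₀) (h : f.edge x ∈ Inn (fun i => f.edge (c i)) (f.edge c₀)) :
    x ∈ Inn c c₀ :=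
  ⟨hx, fun e => h.2.1 (e ▸ rfl), fun i hi => h.2.2 i (hom_above f hi)⟩

theorem Inn_disjoint_left {n k : ℕ} {c : Fin n → Edge T} {d : Fin k → Edge T} {c₀ : Edge T}
    {i : Fin n} {x : Edge T} (hx : x ∈ Inn c c₀) : x ∉ Inn d (c i) := fun h => hx.2.2 i h.1

theorem WOp.push_comp (f : T ⟶ T') {n : ℕ} {k : Fin n → ℕ} {m : ℕ}
    (e : Fin m ≃ Σ i, Fin (k i)) {c : Fin n → Edge T} {d : ∀ i, Fin (k i) → Edge T}
    {b : Fin m → Edge T} {c₀ : Edge T} (h : ∀ t, b t = d (e t).1 (e t).2) (a : WOp L c c₀)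
    (a' : ∀ i, WOp L (d i) (c i)) :
    (WOp.comp e h a a').push f =
      WOp.comp e (d := fun i j => f.edge (d i j)) (fun t => congrArg f.edge (h t)) (a.push f)
        (fun i => (a' i).push f) := by
  have hc : ∀ i, Above (c i) c₀ := a.rel.above'
  have hrel := broad_map f a.rel
  refine WOp.ext_full fun y hy => ?_
  rw [WOp.full_push_of_mem f _ hy, WOp.full_comp]
  simp only [WOp.full_comp]
  by_cases h1 : y ∈ Inn (fun i => f.edge (c i)) (f.edge c₀)
  · have h2 : ∀ i, ((a' i).push f).full y = ⊤ := fun i =>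
      WOp.full_of_not_mem _ (Inn_disjoint_left (c := fun i => f.edge (c i)) h1)
    rw [WOp.full_push_of_mem f _ h1]
    simp only [h2, iInf_top, le_top, inf_of_le_left]
    have h3 : ∀ x, Above x c₀ → f.edge x = y → x ∈ Inn c c₀ := by
      rintro x hx rfl
      exact Inn_of_map f hx h1
    have h4 : ∀ x ∈ Inn c c₀, a.full x ⊓ ⨅ i, (a' i).full x = a.full x := by
      intro x hx
      have : ∀ i, (a' i).full x = ⊤ := fun i => WOp.full_of_not_mem _ (Inn_disjoint_left hx)
      simp [this]
    apply le_antisymm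
    · refine iSup₂_le fun x hx => iSup_le fun hxy => ?_
      have hx' := h3 x hx.1 hxy
      rw [h4 x hx']
      exact le_iSup₂_of_le x hx' (le_iSup_of_le hxy le_rfl)
    · refine iSup₂_le fun x hx => iSup_le fun hxy => ?_
      rw [← h4 x hx]
      exact le_iSup₂_of_le x (Inn_comp_left e h (fun i => (a' i).rel) hx)
        (le_iSup_of_le hxy le_rfl)
  · rw [WOp.full_of_not_mem _ h1]
    simp only [le_top, inf_of_le_right]
    -- `y` lies above (or equals) some `f (c i)`
    have : ∃ i, Above y (f.edge (c i)) := by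
      by_contra! h2
      exact h1 ⟨hy.1, hy.2.1, h2⟩
    obtain ⟨i, hi⟩ := this
    have h5 : ∀ j, j ≠ i → ((a' j).push f).full y = ⊤ := fun j hj =>
      WOp.full_of_not_mem _ fun h' =>
        hj (hrel.disjoint (c := fun i => f.edge (c i)) h'.1 hi)
    have h6 : ⨅ j, ((a' j).push f).full y = ((a' i).push f).full y := by
      apply le_antisymm (iInf_le _ i)
      refine le_iInf fun j => ?_
      by_cases hj : j = i
      · rw [hj]
      · rw [h5 j hj]; exact le_top
    rw [h6]
    by_cases h7 : y = f.edge (c i)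
    · -- a newly arising inner edge
      have h8 : ((a' i).push f).full y = ⊤ := WOp.full_of_not_mem _ fun h' => h'.2.1 h7
      rw [h8, eq_top_iff]
      have h9 : c i ∈ Inn b c₀ := by
        refine Inn_of_map f (hc i) ?_
        rw [← h7]; exact hy
      refine le_iSup₂_of_le (c i) h9 (le_iSup_of_le h7.symm ?_)
      rw [WOp.full_of_not_mem a fun h' => h'.2.2 i (.rfl' _)]
      simp only [le_inf_iff, le_refl, true_and, le_iInf_iff]
      intro j
      rw [WOp.full_of_not_mem]
      intro h'
      obtain rfl := a.rel.disjoint h'.1 (.rfl' (c i))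
      exact h'.2.1 rfl
    · have h8 : y ∈ Inn (fun j => f.edge (d i j)) (f.edge (c i)) := by
        refine ⟨hi, h7, fun j hj => ?_⟩
        obtain ⟨t, ht⟩ := e.surjective ⟨i, j⟩
        have hb : b t = d i j := by rw [h, ht]
        exact hy.2.2 t (by beta_reduce; rw [hb]; exact hj)
      rw [WOp.full_push_of_mem f _ h8]
      have h10 : ∀ x ∈ Inn (d i) (c i), a.full x ⊓ ⨅ j, (a' j).full x = (a' i).full x := by
        intro x hx
        rw [WOp.full_of_not_mem a fun h' => h'.2.2 i hx.1]
        simp only [le_top, inf_of_le_right]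
        apply le_antisymm (iInf_le _ i)
        refine le_iInf fun j => ?_
        by_cases hj : j = i
        · rw [hj]
        · rw [WOp.full_of_not_mem (a' j) fun h' => hj (a.rel.disjoint h'.1 hx.1)]; exact le_top
      have h11 : ∀ x ∈ Inn b c₀, f.edge x = y → x ∈ Inn (d i) (c i) := by
        rintro x hx rfl
        have : Above x (c i) := by
          by_contra h12
          by_cases h13 : Above (c i) x
          · exact h7 (hi.antisymm (hom_above f h13))
          · exact hom_not_above f h12 h13 hi
        exact Inn_of_map f this h8
      apply le_antisymm
      · refine iSup₂_le fun x hx => iSup_le fun hxy => ?_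
        have hx' := h11 x hx hxy
        rw [h10 x hx']
        exact le_iSup₂_of_le x hx' (le_iSup_of_le hxy le_rfl)
      · refine iSup₂_le fun x hx => iSup_le fun hxy => ?_
        rw [← h10 x hx]
        exact le_iSup₂_of_le x (Inn_comp_right e h a.rel (fun i => (a' i).rel) hx)
          (le_iSup_of_le hxy le_rfl)

theorem WOp.push_act (f : T ⟶ T') {m n : ℕ} (σ : Fin m ≃ Fin n) {c : Fin n → Edge T}
    {c' : Fin m → Edge T} {c₀ : Edge T} (h : ∀ t, c' t = c (σ t)) (a : WOp L c c₀) :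
    (a.act σ h).push f = (a.push f).act σ (fun t => congrArg f.edge (h t)) := by
  refine WOp.ext_full fun y hy => ?_
  rw [WOp.full_push_of_mem f _ hy, WOp.full_act, WOp.full_push_of_mem, Inn_act σ h]
  · simp
  · rwa [← Inn_act σ (fun t => congrArg f.edge (h t))]

noncomputable def wPush (L : Type) [CompleteLattice L] (f : T ⟶ T') :
    wOperad T L ⟶ wOperad T' L where
  color := f.edge
  op a := WOp.push f a
  op_act σ _ _ _ h a := WOp.push_act f σ h a
  op_one _ := WOp.ext_full fun _ hy =>
    absurd hy.1 (hy.2.2 0)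
  op_comp e _ _ _ _ h a a' := WOp.push_comp f e h a a'

theorem WOp.push_id {n : ℕ} {c : Fin n → Edge T} {c₀ : Edge T} (a : WOp L c c₀) :
    a.push (𝟙 T) = a := by
  refine WOp.ext_full fun y hy => ?_
  rw [WOp.full_push_of_mem (𝟙 T) a hy]
  apply le_antisymm
  · refine iSup₂_le fun x hx => iSup_le fun hxy => ?_
    rw [← hxy]; rfl
  · exact le_iSup₂_of_le y hy (le_iSup_of_le rfl le_rfl)

theorem WOp.push_push (f : T ⟶ T') (g : T' ⟶ T'') {n : ℕ} {c : Fin n → Edge T} {c₀ : Edge T}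
    (a : WOp L c c₀) : a.push (f ≫ g) = (a.push f).push g := by
  refine WOp.ext_full fun z hz => ?_
  rw [WOp.full_push_of_mem (f ≫ g) a hz, WOp.full_push_of_mem g (a.push f) hz]
  apply le_antisymm
  · refine iSup₂_le fun x hx => iSup_le fun hxz => ?_
    have hy : f.edge x ∈ Inn (fun i => f.edge (c i)) (f.edge c₀) := by
      refine Inn_of_map g (hom_above f hx.1) ?_
      exact hxz.symm ▸ hz
    refine le_iSup₂_of_le (f.edge x) hy (le_iSup_of_le hxz ?_)
    rw [WOp.full_push_of_mem f a hy]
    exact le_iSup₂_of_le x hx (le_iSup_of_le rfl le_rfl)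
  · refine iSup₂_le fun y hy => iSup_le fun hyz => ?_
    rw [WOp.full_push_of_mem f a hy]
    refine iSup₂_le fun x hx => iSup_le fun hxy => ?_
    refine le_iSup₂_of_le x hx (le_iSup_of_le ?_ le_rfl)
    rw [comp_edge, hxy, hyz]

theorem WOp.push_mapLen (f : T ⟶ T') (g : CompleteLatticeHom L L') {n : ℕ} {c : Fin n → Edge T}
    {c₀ : Edge T} (a : WOp L c c₀) : (a.mapLen g).push f = (a.push f).mapLen g := by
  refine WOp.ext_full fun y hy => ?_
  rw [WOp.full_push_of_mem f _ hy, WOp.full_mapLen, WOp.full_push_of_mem f _ hy]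
  simp [map_iSup]

end W

/-- The `n`-simplices of `Δ[1]`: monotone maps from `[n]` to `{0 < 1}`, with `False` for `0`
and `True` for `1`. -/
abbrev Len (n : SimplexCategory) : Type := Fin (n.len + 1) →o Prop

/-- The simplicial operators of `Δ[1]`. -/
def lenMap {m n : SimplexCategory} (θ : m ⟶ n) : CompleteLatticeHom (Len n) (Len m) where
  toFun a := a.comp θ.toOrderHom
  map_sInf' s := by ext i; simp
  map_sSup' s := by ext i; simp

/-- The Boardman–Vogt simplicial operads `W(T)`: the colors are the edges of `T`, and the
simplicial set of operations from `c 0, …, c (n - 1)` to `c₀` is the power of `Δ[1]` indexed by the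
inner edges of the subtree with these leaves and this root if it exists, and empty otherwise. -/
noncomputable def W : PTree ⥤ SOperad :=
  ObjectProperty.lift _
    { obj := fun T =>
        { obj := fun n => wOperad T (Len n.unop)
          map := fun θ => wMapLen T (lenMap θ.unop) }
      map := fun f => { app := fun n => wPush (Len n.unop) f
                        naturality := fun m n θ => by
                          refine Operad.Hom.ext rfl (heq_of_eq ?_)
                          funext k c c₀ a
                          exact WOp.push_mapLen f (lenMap θ.unop) a }
      map_id := fun T => by
        ext n
        refine Operad.Hom.ext rfl (heq_of_eq ?_)
        funext k c c₀ a
        exact WOp.push_id a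
      map_comp := fun f g => by
        ext n
        refine Operad.Hom.ext rfl (heq_of_eq ?_)
        funext k c c₀ a
        exact WOp.push_push f g a }
    (fun _ _ _ _ => Function.bijective_id)

end Dendroidal

open Dendroidal

namespace Dendroidal

/-! ### Order theory of the edges of a tree -/

/-! The functor is the nerve of `W` itself, so functoriality and the comparison with the nerve cost
nothing. The content is a dictionary between operad maps `Ω(S) ⟶ W(T)ₙ` and strings `S ⟶ J₀ ⟶ ⋯ ⟶ Jₙ
⟶ T`, which passes through an intermediate notion, `Code`: a tree map `f : S ⟶ T` together with a
length for each inner edge of the subtree of `T` spanned by the images of the leaves and the root of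
`S`, such that edges in the image of `f` have length `1`.

From operad maps to codes (`codeEquiv`): every broad relation of `S` can be completed by grafting to
the maximal one, from the leaves to the root. Since grafting keeps lengths, all operations are
restrictions of the one assigned to the maximal relation (`lenOf_eq`). Since grafting gives length
`1` to new inner edges, the images of edges of `S` have length `1`. Conversely these are the only
constraints (`Code.op_comp`).

From codes to strings (`NWString.equivCode`): a length in `Δ[1]ₙ` is a monotone map from `[n]` to
`{0 < 1}`, so a code is `f` with an increasing chain `E₀ ⊆ ⋯ ⊆ Eₙ` of edge sets of the spanned
subtree, all containing the image of `f`. For fixed leaves and root, planar faces of `T` exist for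
each such edge set (`exists_planarFace_region`) and are determined by it (`planarFace_unique`). The
face on `Eᵢ` is `Jᵢ`, and the maps of the string are lifts through faces (`exists_tall_lift`). Lifts
are tree maps because broad relations are exactly the antichains above the target that meet the
branches of all leaves above it (`broad_of_antichain`).

In this language the three functorialities become transparent. Simplicial operators reindex the
chain. Restriction along `S' ⟶ S` keeps the edges of `Jᵢ` in the smaller spanned subtree, and
containing all such edges is what being an outer face means (`isOuterFace_iff`). Pushing along `T ⟶
T'` takes images of edge sets, whence the degeneracies. For the Segal condition, an inner edge of
the subtree spanned by `U ⟶ T` is either the image of an edge of `U`, with forced length `1`, or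
inner over exactly one vertex of `U`; so codes glue uniquely (`hom_ext_core`, `exists_hom_of_core`).
Over the stick there are no inner edges, hence discreteness. -/

instance Edge.finite (T : PTree) : Finite (Edge T) := by
  induction T with
  | stick =>
    have : ∀ e : Edge .stick, e = .root _ := fun e => by cases e; rfl
    exact ⟨⟨fun _ => 0, fun _ => .root _, fun e => (this e).symm,
      fun i => (Subsingleton.elim (0 : Fin 1) i)⟩⟩
  | node n t ih =>
    refine Finite.of_surjective (fun x : Option (Σ i, Edge (t i)) =>
      x.elim (Edge.root (.node n t)) fun y => .sub y.1 y.2) ?_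
    intro e
    cases e with
    | root => exact ⟨none, rfl⟩
    | sub i e => exact ⟨some ⟨i, e⟩, rfl⟩

theorem PlanarLE.antisymm {T : PTree} {x y : Edge T} (h : PlanarLE x y) (h' : PlanarLE y x) :
    x = y := by
  induction h with
  | root x => cases h'; rfl
  | left h x y =>
    cases h' with
    | left h' => exact absurd h' h.asymm
    | sub => exact absurd h (lt_irrefl _)
  | sub i h ih =>
    cases h' with
    | left h' => exact absurd h' (lt_irrefl _)
    | sub _ h' => rw [ih h']

theorem PlanarLE.total {T : PTree} (x y : Edge T) : PlanarLE x y ∨ PlanarLE y x := by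
  induction x with
  | root => exact .inr (.root _)
  | sub i x ih =>
    cases y with
    | root => exact .inl (.root _)
    | sub j y =>
      rcases lt_trichotomy i j with h | rfl | h
      · exact .inl (.left h _ _)
      · exact (ih y).imp (.sub i) (.sub i)
      · exact .inr (.left h _ _)

/-! ### Leaves, and broad relations as antichains -/

theorem leaves_stick : leaves .stick = {.root _} := rfl

theorem sub_mem_sum {n : ℕ} {t : Fin n → PTree} {m : ∀ i, Multiset (Edge (t i))} {i : Fin n}
    {x : Edge (t i)} : Edge.sub i x ∈ ∑ i, (m i).map (Edge.sub (t := t) i) ↔ x ∈ m i := by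
  rw [Multiset.mem_sum]
  constructor
  · rintro ⟨j, -, h⟩
    obtain ⟨y, hy, h⟩ := Multiset.mem_map.1 h
    cases h
    exact hy
  · exact fun h => ⟨i, Finset.mem_univ _, Multiset.mem_map_of_mem _ h⟩

theorem root_not_mem_sum {n : ℕ} {t : Fin n → PTree} {m : ∀ i, Multiset (Edge (t i))} :
    Edge.root (.node n t) ∉ ∑ i, (m i).map (Edge.sub (t := t) i) := by
  rw [Multiset.mem_sum]
  rintro ⟨j, -, h⟩
  obtain ⟨y, hy, h⟩ := Multiset.mem_map.1 h
  cases h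

/-- Every edge other than the root lies over exactly one input of the root vertex, so the tuple can
be sorted by inputs. This is what makes tuples accessible to recursion on the tree. -/
theorem exists_eq_sum {n : ℕ} {t : Fin n → PTree} (m : Multiset (Edge (.node n t)))
    (h : Edge.root _ ∉ m) : ∃ m' : ∀ i, Multiset (Edge (t i)),
      m = ∑ i, (m' i).map (Edge.sub (t := t) i) := by
  classical
  induction m using Multiset.induction_on with
  | empty => exact ⟨fun _ => 0, by simp⟩
  | cons a m ih =>
    obtain ⟨m', hm'⟩ := ih fun h' => h (Multiset.mem_cons_of_mem h')
    cases a with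
    | root => exact absurd (Multiset.mem_cons_self _ _) h
    | sub i a =>
      refine ⟨m' + Pi.single i {a}, ?_⟩
      simp only [Pi.add_apply, Multiset.map_add, Finset.sum_add_distrib, ← hm']
      rw [Finset.sum_eq_single i]
      · rw [Pi.single_eq_same, Multiset.map_singleton, add_comm, Multiset.singleton_add]
      · intro j _ hj
        rw [Pi.single_eq_of_ne hj]; rfl
      · exact fun h => absurd (Finset.mem_univ i) h

theorem sub_mem_leaves {n : ℕ} {t : Fin n → PTree} {i : Fin n} {x : Edge (t i)} :
    Edge.sub i x ∈ leaves (.node n t) ↔ x ∈ leaves (t i) := sub_mem_sum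

theorem root_not_mem_leaves {n : ℕ} {t : Fin n → PTree} :
    Edge.root (.node n t) ∉ leaves (.node n t) := root_not_mem_sum

theorem leaves_broad (T : PTree) : Broad (leaves T) (.root T) := by
  induction T with
  | stick => exact .refl _
  | node n t ih => exact .graft ih

theorem eq_of_above_leaf {T : PTree} {x l : Edge T} (hl : l ∈ leaves T) (h : Above x l) :
    x = l := by
  induction h with
  | @root T x =>
    cases T with
    | stick => cases x; rfl
    | node => exact absurd hl root_not_mem_leaves
  | sub i h ih => rw [ih (sub_mem_leaves.1 hl)]

theorem Vertex.cover {T : PTree} {m : Multiset (Edge T)} {e : Edge T} (h : Vertex m e) :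
    ∀ x, Above x e → x = e ∨ ∃ y ∈ m, Above x y := by
  induction h with
  | root n t =>
    intro x _
    cases x with
    | root => exact .inl rfl
    | sub i x =>
      exact .inr ⟨_, Multiset.mem_map_of_mem _ (Finset.mem_univ i), .sub i (.root x)⟩
  | sub i h ih =>
    intro x hx
    cases hx with
    | sub _ hx =>
      rcases ih _ hx with rfl | ⟨y, hy, h⟩
      · exact .inl rfl
      · exact .inr ⟨_, Multiset.mem_map_of_mem _ hy, .sub i h⟩

theorem Vertex.not_mem {T : PTree} {m : Multiset (Edge T)} {e : Edge T} (h : Vertex m e) :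
    e ∉ m := by
  induction h with
  | root n t =>
    intro h
    obtain ⟨i, -, h⟩ := Multiset.mem_map.1 h
    cases h
  | sub i h ih => exact fun h => ih ((Multiset.mem_map_of_injective (sub_injective i)).1 h)

theorem Vertex.not_mem_leaves {T : PTree} {m : Multiset (Edge T)} {e : Edge T}
    (h : Vertex m e) : e ∉ leaves T := by
  induction h with
  | root n t => exact root_not_mem_leaves
  | sub i h ih => exact fun h => ih (sub_mem_leaves.1 h)

/-- A leaf is never the bottom of a vertex, so it passes to one of the inputs at each step of a
generation. Only leaves are covered: a branch ending in a nullary vertex may be missed by the tuple.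
-/
theorem Broad.cover_leaf {T : PTree} {m : Multiset (Edge T)} {e : Edge T} (h : Broad m e) :
    ∀ l ∈ leaves T, Above l e → ∃ x ∈ m, Above l x := by
  induction h with
  | refl e => exact fun l _ h => ⟨e, Multiset.mem_singleton_self _, h⟩
  | vertex h =>
    intro l hl h'
    rcases h.cover l h' with rfl | h'
    · exact absurd hl h.not_mem_leaves
    · exact h'
  | trans h h' ih ih' =>
    intro l hl hle
    obtain ⟨x, hx, hlx⟩ := ih l hl hle
    obtain ⟨i, -, rfl⟩ := Multiset.mem_map.1 hx
    obtain ⟨y, hy, hly⟩ := ih' i l hl hlx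
    exact ⟨y, Multiset.mem_sum.2 ⟨i, Finset.mem_univ _, hy⟩, hly⟩

theorem eq_singleton_of_mem {T : PTree} {m : Multiset (Edge T)} {e : Edge T}
    (h1 : m.Nodup) (h2 : ∀ x ∈ m, ∀ y ∈ m, Above x y → x = y) (h3 : ∀ x ∈ m, Above x e)
    (h : e ∈ m) : m = {e} :=
  (Multiset.Nodup.ext h1 (Multiset.nodup_singleton e)).2 fun x =>
    ⟨fun hx => Multiset.mem_singleton.2 (h2 x hx e h (h3 x hx)),
      fun hx => Multiset.mem_singleton.1 hx ▸ h⟩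

/-- The tuples occurring in broad relations with a given target are the antichains meeting the
branches of all leaves above the target. -/
theorem broad_of_antichain {T : PTree} {e : Edge T} : ∀ {m : Multiset (Edge T)}, m.Nodup →
    (∀ x ∈ m, ∀ y ∈ m, Above x y → x = y) → (∀ x ∈ m, Above x e) →
    (∀ l ∈ leaves T, Above l e → ∃ x ∈ m, Above l x) → Broad m e := by
  induction e with
  | root T =>
    induction T with
    | stick =>
      intro m h1 h2 h3 h4
      obtain ⟨x, hx, h⟩ := h4 (.root _) (Multiset.mem_singleton_self _) (.root _)
      cases h
      rw [eq_singleton_of_mem h1 h2 h3 hx]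
      exact .refl _
    | node n t ih =>
      intro m h1 h2 h3 h4
      by_cases hr : Edge.root _ ∈ m
      · rw [eq_singleton_of_mem h1 h2 h3 hr]
        exact .refl _
      · obtain ⟨m, rfl⟩ := exists_eq_sum m hr
        refine .graft fun i => ih i ?_ ?_ (fun x _ => .root x) ?_
        · refine Multiset.Nodup.of_map (Edge.sub (t := t) i) (Multiset.nodup_of_le ?_ h1)
          exact Finset.single_le_sum (f := fun i => (m i).map (Edge.sub (t := t) i))
            (fun _ _ => Multiset.zero_le _) (Finset.mem_univ i)
        · intro x hx y hy hxy
          exact sub_injective i (h2 _ (sub_mem_sum.2 hx) _ (sub_mem_sum.2 hy) (.sub i hxy))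
        · intro l hl _
          obtain ⟨x, hx, h⟩ := h4 (.sub i l) (sub_mem_leaves.2 hl) (.root _)
          cases h with
          | root => exact absurd hx hr
          | sub _ h => exact ⟨_, sub_mem_sum.1 hx, h⟩
  | sub i e ih =>
    intro m h1 h2 h3 h4
    -- Everything above the target lies over the input `i`; the tuple is lifted along `Edge.sub i`
    -- on an underlying list.
    obtain ⟨m', rfl⟩ : ∃ m' : Multiset _, m = m'.map (Edge.sub i) := by
      have : ∃ m' : List _, m'.map (Edge.sub i) = m.toList := by
        have : m.toList ∈ Set.range (List.map (Edge.sub i)) := by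
          rw [Set.range_list_map]
          intro x hx
          cases h3 x (Multiset.mem_toList.1 hx) with
          | sub _ h => exact ⟨_, rfl⟩
        exact this
      obtain ⟨m', hm'⟩ := this
      exact ⟨m', by rw [Multiset.map_coe, hm', Multiset.coe_toList]⟩
    refine (ih (h1.of_map _) ?_ ?_ ?_).map_sub i
    · intro x hx y hy hxy
      exact sub_injective i (h2 _ (Multiset.mem_map_of_mem _ hx) _
        (Multiset.mem_map_of_mem _ hy) (.sub i hxy))
    · exact fun x hx => (h3 _ (Multiset.mem_map_of_mem _ hx)).sub_inv
    · intro l hl hle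
      obtain ⟨x, hx, h⟩ := h4 (.sub i l) (sub_mem_leaves.2 hl) (.sub i hle)
      obtain ⟨x, hx', rfl⟩ := Multiset.mem_map.1 hx
      exact ⟨x, hx', h.sub_inv⟩

/-- A map of edge sets which preserves comparability and incomparability and sends the leaves to
a tuple below the image of the root preserves all broad relations. -/
theorem broad_map_of_order {S J : PTree} (k : Edge S → Edge J)
    (h1 : ∀ x y, Above x y → Above (k x) (k y))
    (h2 : ∀ x y, Above (k x) (k y) → Above x y ∨ Above y x)
    (h3 : Broad ((leaves S).map k) (k (.root S))) {m : Multiset (Edge S)} {e : Edge S}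
    (h : Broad m e) : Broad (m.map k) (k e) := by
  have inj : ∀ x ∈ m, ∀ y ∈ m, Above (k x) (k y) → x = y := by
    intro x hx y hy hxy
    rcases h2 x y hxy with h' | h'
    · exact h.antichain.2 x hx y hy h'
    · exact (h.antichain.2 y hy x hx h').symm
  refine broad_of_antichain ?_ ?_ ?_ ?_
  · refine Multiset.Nodup.map_on ?_ h.antichain.1
    exact fun x hx y hy hxy => inj x hx y hy (hxy ▸ .rfl' _)
  · intro x hx y hy hxy
    obtain ⟨x, hx', rfl⟩ := Multiset.mem_map.1 hx
    obtain ⟨y, hy', rfl⟩ := Multiset.mem_map.1 hy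
    rw [inj x hx' y hy' hxy]
  · intro x hx
    obtain ⟨x, hx', rfl⟩ := Multiset.mem_map.1 hx
    exact h1 _ _ (h.above x hx')
  · intro l hl hle
    obtain ⟨y, hy, hly⟩ := h3.cover_leaf l hl (hle.trans (h1 _ _ (.root e)))
    obtain ⟨y, hy', rfl⟩ := Multiset.mem_map.1 hy
    -- The images of `y` and `e` both lie below `l`, so `y` and `e` are comparable; as `y` is a
    -- leaf, it cannot lie strictly below `e`.
    have hye : Above y e := by
      have : Above y e ∨ Above e y := by
        rcases hly.total hle with h' | h'
        · exact h2 _ _ h'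
        · exact (h2 _ _ h').symm
      rcases this with h' | h'
      · exact h'
      · rw [eq_of_above_leaf hy' h']; exact .rfl' _
    obtain ⟨x, hx, hyx⟩ := h.cover_leaf y hy' hye
    exact ⟨_, Multiset.mem_map_of_mem _ hx, hly.trans (h1 _ _ hyx)⟩

/-! ### Faces and lifting through them -/

theorem hom_comparable {S T : PTree} (f : S ⟶ T) {x y : Edge S}
    (h : Above (f.edge x) (f.edge y)) : Above x y ∨ Above y x := by
  by_contra! h'
  exact hom_not_above f h'.1 h'.2 h

/-- Any tree map reflects comparability. If the order were reversed in the source, antisymmetry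
would identify the images, and injectivity the edges. -/
theorem IsFace.above_iff {S T : PTree} {f : S ⟶ T} (hf : IsFace f) {x y : Edge S} :
    Above (f.edge x) (f.edge y) ↔ Above x y := by
  refine ⟨fun h => ?_, hom_above f⟩
  rcases hom_comparable f h with h' | h'
  · exact h'
  · rw [hf (h.antisymm (hom_above f h'))]; exact .rfl' _

theorem IsFace.planar_iff {S T : PTree} {f : S ⟶ T} (hf : IsFace f) (hf' : IsPlanar f)
    {x y : Edge S} : PlanarLE (f.edge x) (f.edge y) ↔ PlanarLE x y := by
  refine ⟨fun h => ?_, hf' x y⟩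
  rcases PlanarLE.total x y with h' | h'
  · exact h'
  · rw [hf (h.antisymm (hf' _ _ h'))]
    -- Reflexivity of the planar order, as totality applied to a single edge.
    exact (PlanarLE.total y y).elim id id

theorem IsFace.mono {S J T : PTree} {j : J ⟶ T} (hj : IsFace j) {k k' : S ⟶ J}
    (h : k ≫ j = k' ≫ j) : k = k' :=
  hom_ext fun e => hj (by rw [← comp_edge, h, comp_edge])

/-- A map of trees whose image lies in a face factors through the face. -/
theorem exists_lift {S J T : PTree} {j : J ⟶ T} (hj : IsFace j) (f : S ⟶ T)
    (hr : ∀ x, f.edge x ∈ Set.range j.edge)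
    (hl : ∀ k : Edge S → Edge J, (∀ x, j.edge (k x) = f.edge x) →
      Broad ((leaves S).map k) (k (.root S))) : ∃ k : S ⟶ J, k ≫ j = f := by
  -- Faces reflect the order, so any edgewise lift preserves and reflects comparability; the
  -- relation on the leaves is the only further input needed.
  choose k hk using hr
  refine ⟨⟨k, broad_map_of_order k (fun x y h => ?_) (fun x y h => ?_) (hl k hk)⟩, hom_ext hk⟩
  · rw [← hj.above_iff, hk, hk]; exact hom_above f h
  · rw [← hj.above_iff, hk, hk] at h; exact hom_comparable f h

/-- Lifting through a face with the same leaves and the same root. -/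
theorem exists_tall_lift {S J T : PTree} {j : J ⟶ T} (hj : IsFace j) (f : S ⟶ T)
    (hr : ∀ x, f.edge x ∈ Set.range j.edge) (hl : (leaves S).map f.edge = (leaves J).map j.edge)
    (h0 : f.edge (.root S) = j.edge (.root J)) : ∃ k : S ⟶ J, k ≫ j = f ∧ IsTall k := by
  -- Tallness holds already for an edgewise lift, since `j` is injective on tuples. It then supplies
  -- the relation on the leaves.
  have key : ∀ k : Edge S → Edge J, (∀ x, j.edge (k x) = f.edge x) →
      (leaves S).map k = leaves J ∧ k (.root S) = .root J := fun k hk =>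
    ⟨Multiset.map_injective hj (by
      rw [Multiset.map_map, ← hl]
      exact Multiset.map_congr rfl fun x _ => hk x), hj (by rw [hk, h0])⟩
  obtain ⟨k, hk⟩ := exists_lift hj f hr fun k hk => by
    rw [(key k hk).1, (key k hk).2]; exact leaves_broad J
  exact ⟨k, hk, key k.edge fun x => by rw [← hk]; rfl⟩

end Dendroidal

namespace Dendroidal

/-! ### Planar embeddings with given image -/

/-- A tree together with a map from its edges to the edges of `T`. -/
abbrev Emb (T : PTree) := Σ J : PTree, Edge J → Edge T

variable {T : PTree}

/-- The map preserves and reflects the order on edges and preserves the planar order. -/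
def Emb.IsPlanarEmb (p : Emb T) : Prop :=
  (∀ x y, Above (p.2 x) (p.2 y) ↔ Above x y) ∧ ∀ x y, PlanarLE x y → PlanarLE (p.2 x) (p.2 y)

/-- The image of the leaves. -/
def Emb.leafTuple (p : Emb T) : Multiset (Edge T) := (leaves p.1).map p.2

/-- Two trees over `T` whose edges are incomparable, those of the first being to the left of those
of the second. -/
def Emb.Left (p q : Emb T) : Prop :=
  ∀ x y, PlanarLE (p.2 x) (q.2 y) ∧ ¬ Above (p.2 x) (q.2 y) ∧ ¬ Above (q.2 y) (p.2 x)

def Emb.push {T' : PTree} (k : Edge T → Edge T') (p : Emb T) : Emb T' := ⟨p.1, k ∘ p.2⟩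

/-- The edge map of a tree obtained by joining trees over `T` with a root edge `r`. -/
def Emb.nodeEdge {n : ℕ} (p : Fin n → Emb T) (r : Edge T) :
    Edge (.node n fun i => (p i).1) → Edge T
  | .root _ => r
  | .sub i e => (p i).2 e

def Emb.node {n : ℕ} (p : Fin n → Emb T) (r : Edge T) : Emb T :=
  ⟨.node n fun i => (p i).1, Emb.nodeEdge p r⟩

theorem Emb.node_eq {n : ℕ} {t : Fin n → PTree} (j : Edge (.node n t) → Edge T) :
    (⟨.node n t, j⟩ : Emb T) =
      Emb.node (fun i => ⟨t i, fun e => j (.sub i e)⟩) (j (.root _)) := by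
  refine Sigma.ext rfl (heq_of_eq ?_)
  funext e
  cases e <;> rfl

theorem Emb.IsPlanarEmb.injective {p : Emb T} (h : p.IsPlanarEmb) : Function.Injective p.2 :=
  fun x y hxy => ((h.1 x y).1 (hxy ▸ .rfl' _)).antisymm ((h.1 y x).1 (hxy ▸ .rfl' _))

theorem Emb.IsPlanarEmb.planar_iff {p : Emb T} (h : p.IsPlanarEmb) {x y : Edge p.1} :
    PlanarLE (p.2 x) (p.2 y) ↔ PlanarLE x y := by
  refine ⟨fun h' => ?_, h.2 x y⟩
  rcases PlanarLE.total x y with h1 | h1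
  · exact h1
  · rw [h.injective (h'.antisymm (h.2 _ _ h1))]
    exact (PlanarLE.total y y).elim id id

theorem Emb.IsPlanarEmb.push {p : Emb T} (h : p.IsPlanarEmb) {T' : PTree}
    {k : Edge T → Edge T'} (hk : ∀ x y, Above (k x) (k y) ↔ Above x y)
    (hk' : ∀ x y, PlanarLE x y → PlanarLE (k x) (k y)) : (p.push k).IsPlanarEmb :=
  ⟨fun x y => (hk _ _).trans (h.1 x y), fun x y hxy => hk' _ _ (h.2 x y hxy)⟩

theorem sub_above_iff {n : ℕ} {t : Fin n → PTree} (i : Fin n) (x y : Edge (t i)) :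
    Above (Edge.sub (t := t) i x) (.sub i y) ↔ Above x y := ⟨Above.sub_inv, .sub i⟩

/-- Pairs of edges over distinct inputs are settled by `Emb.Left`, which gives both incomparability
and the planar order. The last hypothesis keeps the new root edge distinct from all others. -/
theorem Emb.node_isPlanarEmb {n : ℕ} {t : Fin n → PTree} {k : ℕ} {p : Fin k → Emb (.node n t)}
    (h : ∀ i, (p i).IsPlanarEmb) (hlt : ∀ i j, i < j → (p i).Left (p j))
    (hr : ∀ i x, (p i).2 x ≠ .root _) : (Emb.node p (.root _)).IsPlanarEmb := by
  constructor
  · intro x y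
    cases y with
    | root => exact ⟨fun _ => .root _, fun _ => .root _⟩
    | sub j y =>
      cases x with
      | root =>
        refine ⟨fun h' => ?_, fun h' => by cases h'⟩
        exact absurd (Above.antisymm (.root _) h') (hr j y)
      | sub i x =>
        constructor
        · intro h'
          rcases lt_trichotomy i j with hij | rfl | hij
          · exact absurd h' (hlt i j hij x y).2.1
          · exact .sub i (((h i).1 x y).1 h')
          · exact absurd h' (hlt j i hij y x).2.2
        · intro h'
          cases h' with
          | sub _ h' => exact ((h _).1 _ _).2 h'
  · intro x y hxy
    cases hxy with
    | root x => exact .root _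
    | left hij x y => exact (hlt _ _ hij x y).1
    | sub _ hxy => exact (h _).2 _ _ hxy

theorem Emb.node_leafTuple {n : ℕ} (p : Fin n → Emb T) (r : Edge T) :
    (Emb.node p r).leafTuple = ∑ i, (p i).leafTuple := by
  show ((∑ i, (leaves (p i).1).map (Edge.sub i)).map (Emb.nodeEdge p r)) = _
  rw [← Multiset.coe_mapAddMonoidHom, map_sum]
  refine Finset.sum_congr rfl fun i _ => ?_
  rw [Multiset.coe_mapAddMonoidHom, Multiset.map_map]
  rfl

theorem Emb.push_leafTuple {T' : PTree} (k : Edge T → Edge T') (p : Emb T) :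
    (p.push k).leafTuple = p.leafTuple.map k := by
  show (leaves p.1).map (k ∘ p.2) = ((leaves p.1).map p.2).map k
  rw [Multiset.map_map]

theorem sum_map_flatMap {α β M : Type*} [AddCommMonoid M] (g : β → M) (f : α → List β)
    (l : List α) : ((l.flatMap f).map g).sum = (l.map fun a => ((f a).map g).sum).sum := by
  induction l with
  | nil => rfl
  | cons a l ih => simp [ih]

/-- The edges in a set `E` form a planar forest, which has any given tuple of leaves that is part
of `E`, covers the branches of `T` and lies above all other elements of `E`. -/
theorem exists_forest (T : PTree) : ∀ (E : Set (Edge T)) (m : Multiset (Edge T)),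
    Broad m (.root T) → (∀ x ∈ m, x ∈ E) → (∀ x ∈ E, ∀ y ∈ m, Above x y → x = y) →
    ∃ l : List (Emb T), (∀ p ∈ l, p.IsPlanarEmb) ∧ l.Pairwise Emb.Left ∧
      (∀ x, x ∈ E ↔ ∃ p ∈ l, x ∈ Set.range p.2) ∧ (l.map Emb.leafTuple).sum = m := by
  -- The case where the root is in the tuple: then the tuple and `E` are both reduced to the root,
  -- and the forest is one stick.
  have single : ∀ {T : PTree} (E : Set (Edge T)),
      (∀ x ∈ E, x = Edge.root T) → .root T ∈ E →
      ∃ l : List (Emb T), (∀ p ∈ l, p.IsPlanarEmb) ∧ l.Pairwise Emb.Left ∧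
      (∀ x, x ∈ E ↔ ∃ p ∈ l, x ∈ Set.range p.2) ∧ (l.map Emb.leafTuple).sum = {.root T} := by
    intro T E h h'
    have hs : ∀ e : Edge .stick, e = .root _ := fun e => by cases e; rfl
    refine ⟨[⟨.stick, fun _ => .root T⟩], ?_, List.pairwise_singleton _ _, ?_, ?_⟩
    · intro p hp
      obtain rfl := List.mem_singleton.1 hp
      refine ⟨fun x y => ?_, fun x y _ => .root _⟩
      rw [hs x, hs y]
      exact ⟨fun _ => .root _, fun _ => .root _⟩
    · intro x
      constructor
      · intro hx
        exact ⟨_, List.mem_singleton_self _, .root _, (h x hx).symm⟩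
      · rintro ⟨p, hp, y, rfl⟩
        obtain rfl := List.mem_singleton.1 hp
        exact h'
    · simp [Emb.leafTuple, leaves_stick]
  induction T with
  | stick =>
    intro E m hm hmE hE
    have : m = {.root _} := by
      obtain ⟨x, hx, h⟩ := hm.cover_leaf (.root _) (Multiset.mem_singleton_self _) (.root _)
      cases h
      exact eq_singleton_of_mem hm.antichain.1 hm.antichain.2 hm.above hx
    subst this
    exact single E (fun x _ => by cases x; rfl) (hmE _ (Multiset.mem_singleton_self _))
  | node n t ih =>
    intro E m hm hmE hE
    by_cases hr : Edge.root _ ∈ m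
    · have := eq_singleton_of_mem hm.antichain.1 hm.antichain.2 hm.above hr
      subst this
      exact single E (fun x hx => hE x hx _ hr (.root _)) (hmE _ hr)
    obtain ⟨m, rfl⟩ := exists_eq_sum m hr
    have hmi : ∀ i, Broad (m i) (.root (t i)) := by
      intro i
      refine broad_of_antichain ?_ ?_ (fun x _ => .root x) ?_
      · refine Multiset.Nodup.of_map (Edge.sub (t := t) i)
          (Multiset.nodup_of_le ?_ hm.antichain.1)
        exact Finset.single_le_sum (f := fun i => (m i).map (Edge.sub (t := t) i))
          (fun _ _ => Multiset.zero_le _) (Finset.mem_univ i)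
      · intro x hx y hy hxy
        exact sub_injective i
          (hm.antichain.2 _ (sub_mem_sum.2 hx) _ (sub_mem_sum.2 hy) (.sub i hxy))
      · intro l hl _
        obtain ⟨x, hx, h⟩ := hm.cover_leaf (.sub i l) (sub_mem_leaves.2 hl) (.root _)
        cases h with
        | root => exact absurd hx hr
        | sub _ h => exact ⟨_, sub_mem_sum.1 hx, h⟩
    choose l hl1 hl2 hl3 hl4 using fun i => ih i {x | Edge.sub i x ∈ E} (m i) (hmi i)
      (fun x hx => hmE _ (sub_mem_sum.2 hx))
      (fun x hx y hy hxy => sub_injective i (hE _ hx _ (sub_mem_sum.2 hy) (.sub i hxy)))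
    -- The forests over the inputs, concatenated from left to right.
    set l' : List (Emb (.node n t)) :=
      (List.finRange n).flatMap fun i => (l i).map (Emb.push (Edge.sub (t := t) i)) with hl'
    have mem_l' : ∀ {p}, p ∈ l' ↔ ∃ i, ∃ q ∈ l i, Emb.push (Edge.sub (t := t) i) q = p := by
      intro p
      simp [hl', List.mem_flatMap]
    have h1 : ∀ p ∈ l', p.IsPlanarEmb := by
      intro p hp
      obtain ⟨i, q, hq, rfl⟩ := mem_l'.1 hp
      exact (hl1 i q hq).push (sub_above_iff i) fun x y h => .sub i h
    have h2 : l'.Pairwise Emb.Left := by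
      rw [hl', List.pairwise_flatMap]
      constructor
      · intro i _
        rw [List.pairwise_map]
        refine (hl2 i).imp fun {p q} h x y => ⟨.sub i (h x y).1, fun h' => ?_, fun h' => ?_⟩
        · exact (h x y).2.1 h'.sub_inv
        · exact (h x y).2.2 h'.sub_inv
      · refine (List.pairwise_lt_finRange n).imp fun {i j} hij => ?_
        intro p hp q hq x y
        obtain ⟨p, -, rfl⟩ := List.mem_map.1 hp
        obtain ⟨q, -, rfl⟩ := List.mem_map.1 hq
        exact ⟨.left hij _ _, fun h => hij.ne h.sub_idx, fun h => hij.ne h.sub_idx.symm⟩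
    have h3 : ∀ i (x : Edge (t i)), Edge.sub i x ∈ E ↔ ∃ p ∈ l', .sub i x ∈ Set.range p.2 := by
      intro i x
      refine (hl3 i x).trans ⟨?_, ?_⟩
      · rintro ⟨p, hp, y, rfl⟩
        exact ⟨_, mem_l'.2 ⟨i, p, hp, rfl⟩, y, rfl⟩
      · rintro ⟨p, hp, y, hy⟩
        obtain ⟨j, q, hq, rfl⟩ := mem_l'.1 hp
        cases hy
        exact ⟨q, hq, y, rfl⟩
    have h3' : ∀ p ∈ l', ∀ x, p.2 x ≠ .root _ := by
      intro p hp x hx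
      obtain ⟨j, q, hq, rfl⟩ := mem_l'.1 hp
      cases hx
    have h4 : (l'.map Emb.leafTuple).sum = ∑ i, (m i).map (Edge.sub (t := t) i) := by
      rw [hl', sum_map_flatMap, Fin.sum_univ_def]
      congr 2
      funext i
      rw [← hl4 i, ← Multiset.coe_mapAddMonoidHom, map_list_sum, List.map_map, List.map_map]
      congr 2
      funext p
      exact Emb.push_leafTuple _ p
    -- If the root is kept, it joins the forest into one tree; otherwise the forest is passed down,
    -- to be joined at a lower edge. An empty forest under a kept root gives a nullary vertex rather
    -- than a leaf, in accordance with its empty leaf tuple.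
    by_cases hE0 : Edge.root _ ∈ E
    · refine ⟨[Emb.node (fun i => l'.get i) (.root _)], ?_, List.pairwise_singleton _ _, ?_, ?_⟩
      · intro p hp
        obtain rfl := List.mem_singleton.1 hp
        exact Emb.node_isPlanarEmb (fun i => h1 _ (List.get_mem _ _))
          (List.pairwise_iff_get.1 h2) fun i x => h3' _ (List.get_mem _ _) x
      · intro x
        constructor
        · intro hx
          refine ⟨_, List.mem_singleton_self _, ?_⟩
          cases x with
          | root => exact ⟨.root _, rfl⟩
          | sub i x =>
            obtain ⟨p, hp, y, hy⟩ := (h3 i x).1 hx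
            obtain ⟨k, rfl⟩ := List.get_of_mem hp
            exact ⟨.sub k y, hy⟩
        · rintro ⟨p, hp, y, rfl⟩
          obtain rfl := List.mem_singleton.1 hp
          cases y with
          | root => exact hE0
          | sub k y =>
            show (l'.get k).2 y ∈ E
            cases hy : (l'.get k).2 y with
            | root => exact absurd hy (h3' _ (List.get_mem _ _) _)
            | sub i x => exact (h3 i x).2 ⟨_, List.get_mem _ _, y, hy⟩
      · rw [List.map_singleton, List.sum_singleton, Emb.node_leafTuple, ← h4]
        exact Fin.sum_univ_fun_getElem l' Emb.leafTuple
    · refine ⟨l', h1, h2, fun x => ?_, h4⟩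
      cases x with
      | root =>
        refine ⟨fun h => absurd h hE0, ?_⟩
        rintro ⟨p, hp, y, hy⟩
        exact absurd hy (h3' p hp y)
      | sub i x => exact h3 i x

/-- The forest has a tree containing the root of `T`. All edges of other trees would lie above that
root, while distinct trees of the forest are incomparable, so there is no other tree. -/
theorem exists_planarEmb_root (E : Set (Edge T)) (m : Multiset (Edge T))
    (hm : Broad m (.root T)) (hmE : ∀ x ∈ m, x ∈ E) (h0 : .root T ∈ E)
    (hE : ∀ x ∈ E, ∀ y ∈ m, Above x y → x = y) :
    ∃ p : Emb T, p.IsPlanarEmb ∧ Set.range p.2 = E ∧ p.leafTuple = m := by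
  obtain ⟨l, h1, h2, h3, h4⟩ := exists_forest T E m hm hmE hE
  obtain ⟨p, hp, x, hx⟩ := (h3 _).1 h0
  have : l = [p] := by
    have h5 : ∀ q ∈ l, ∀ y : Edge q.1, Above (q.2 y) (p.2 x) := fun q _ y => hx ▸ .root _
    obtain ⟨l₁, l₂, rfl⟩ := List.append_of_mem hp
    rw [List.pairwise_append, List.pairwise_cons] at h2
    have e1 : l₁ = [] := List.eq_nil_iff_forall_not_mem.2 fun q hq =>
      (h2.2.2 q hq p List.mem_cons_self (.root _) x).2.1 (h5 q (by simp [hq]) _)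
    have e2 : l₂ = [] := List.eq_nil_iff_forall_not_mem.2 fun q hq =>
      (h2.2.1.1 q hq x (.root _)).2.2 (h5 q (by simp [hq]) _)
    rw [e1, e2]; rfl
  subst this
  refine ⟨p, h1 p hp, ?_, by simpa using h4⟩
  ext y
  rw [h3]
  simp

/-- Existence of planar faces with given edges and leaves. -/
theorem exists_planarEmb {r : Edge T} : ∀ (E : Set (Edge T)) (m : Multiset (Edge T)),
    Broad m r → (∀ x ∈ m, x ∈ E) → r ∈ E → (∀ x ∈ E, Above x r) →
    (∀ x ∈ E, ∀ y ∈ m, Above x y → x = y) →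
    ∃ p : Emb T, p.IsPlanarEmb ∧ Set.range p.2 = E ∧ p.leafTuple = m := by
  induction r with
  | root T => exact fun E m hm hmE h0 _ hE => exists_planarEmb_root E m hm hmE h0 hE
  | @sub n t i r ih =>
    intro E m hm hmE h0 h1 hE
    have hEr : ∀ x ∈ E, ∃ y, x = Edge.sub i y := by
      intro x hx
      cases h1 x hx with
      | sub _ h => exact ⟨_, rfl⟩
    obtain ⟨m', rfl⟩ : ∃ m' : Multiset _, m = m'.map (Edge.sub i) := by
      have : m.toList ∈ Set.range (List.map (Edge.sub (t := t) i)) := by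
        rw [Set.range_list_map]
        intro x hx
        obtain ⟨y, rfl⟩ := hEr x (hmE x (Multiset.mem_toList.1 hx))
        exact ⟨_, rfl⟩
      obtain ⟨m', hm'⟩ := this
      exact ⟨m', by rw [Multiset.map_coe, hm', Multiset.coe_toList]⟩
    have hm' : Broad m' r := by
      refine broad_of_antichain (hm.antichain.1.of_map _) ?_ ?_ ?_
      · intro x hx y hy hxy
        exact sub_injective i (hm.antichain.2 _ (Multiset.mem_map_of_mem _ hx) _
          (Multiset.mem_map_of_mem _ hy) (.sub i hxy))
      · exact fun x hx => (hm.above _ (Multiset.mem_map_of_mem _ hx)).sub_inv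
      · intro l hl hle
        obtain ⟨x, hx, h⟩ := hm.cover_leaf (.sub i l) (sub_mem_leaves.2 hl) (.sub i hle)
        obtain ⟨x, hx', rfl⟩ := Multiset.mem_map.1 hx
        exact ⟨x, hx', h.sub_inv⟩
    obtain ⟨p, hp1, hp2, hp3⟩ := ih {x | Edge.sub i x ∈ E} m' hm'
      (fun x hx => hmE _ (Multiset.mem_map_of_mem _ hx)) h0 (fun x hx => (h1 _ hx).sub_inv)
      (fun x hx y hy hxy => sub_injective i
        (hE _ hx _ (Multiset.mem_map_of_mem _ hy) (.sub i hxy)))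
    refine ⟨p.push (Edge.sub i), hp1.push (sub_above_iff i) (fun x y h => .sub i h), ?_, ?_⟩
    · ext x
      constructor
      · rintro ⟨y, rfl⟩
        have : p.2 y ∈ Set.range p.2 := ⟨y, rfl⟩
        rw [hp2] at this
        exact this
      · intro hx
        obtain ⟨y, rfl⟩ := hEr x hx
        have : y ∈ Set.range p.2 := by rw [hp2]; exact hx
        obtain ⟨z, rfl⟩ := this
        exact ⟨z, rfl⟩
    · rw [Emb.push_leafTuple, hp3]

end Dendroidal

namespace Dendroidal

variable {T : PTree}

/-! ### Uniqueness of planar faces -/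

theorem Emb.IsPlanarEmb.root_eq {p q : Emb T} (hp : p.IsPlanarEmb) (hq : q.IsPlanarEmb)
    (h : Set.range p.2 = Set.range q.2) : p.2 (.root _) = q.2 (.root _) := by
  obtain ⟨x, hx⟩ : p.2 (.root _) ∈ Set.range q.2 := h ▸ ⟨_, rfl⟩
  obtain ⟨y, hy⟩ : q.2 (.root _) ∈ Set.range p.2 := h ▸ ⟨_, rfl⟩
  apply Above.antisymm
  · rw [← hx, hq.1]; exact .root _
  · rw [← hy, hp.1]; exact .root _

/-- The inputs of the root vertex are the lowest edges strictly above the root, and this is visible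
in the image, because the embedding preserves and reflects the order. -/
theorem Emb.IsPlanarEmb.child_eq {n n' : ℕ} {t : Fin n → PTree} {t' : Fin n' → PTree}
    {j : Edge (.node n t) → Edge T} {j' : Edge (.node n' t') → Edge T}
    (hp : Emb.IsPlanarEmb ⟨_, j⟩) (hq : Emb.IsPlanarEmb ⟨_, j'⟩)
    (h : Set.range j = Set.range j') (i : Fin n) :
    ∃ i', j (.sub i (.root _)) = j' (.sub i' (.root _)) := by
  have h0 : j (.root _) = j' (.root _) := hp.root_eq hq h
  obtain ⟨y, hy⟩ : j (.sub i (.root _)) ∈ Set.range j' := h ▸ ⟨_, rfl⟩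
  cases y with
  | root =>
    rw [← h0] at hy
    cases hp.injective hy
  | sub i' y =>
    obtain ⟨z, hz⟩ : j' (.sub i' (.root _)) ∈ Set.range j := h ▸ ⟨_, rfl⟩
    cases z with
    | root =>
      rw [h0] at hz
      cases hq.injective hz
    | sub k z =>
      have h1 : Above (j (.sub i (.root _))) (j (.sub k z)) := by
        rw [← hy, hz]
        exact (hq.1 _ _).2 (.sub _ (.root y))
      have h2 : Above (Edge.sub (t := t) i (.root _)) (.sub k z) := (hp.1 _ _).1 h1
      cases h2 with
      | sub _ h2 =>
        have h3 := h2.antisymm (.root _)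
        subst h3
        exact ⟨i', hz⟩

theorem PlanarLE.idx_le {n : ℕ} {t : Fin n → PTree} {i j : Fin n} {x : Edge (t i)}
    {y : Edge (t j)} (h : PlanarLE (Edge.sub (t := t) i x) (.sub j y)) : i ≤ j := by
  cases h with
  | left h => exact h.le
  | sub => exact le_rfl

/-- Planar embeddings are determined by their images and their leaves. -/
theorem Emb.IsPlanarEmb.ext {J : PTree} : ∀ {j : Edge J → Edge T} {q : Emb T},
    Emb.IsPlanarEmb ⟨J, j⟩ → q.IsPlanarEmb → Set.range j = Set.range q.2 →
    (∀ x y, j x = q.2 y → (x ∈ leaves J ↔ y ∈ leaves q.1)) → (⟨J, j⟩ : Emb T) = q := by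
  induction J with
  | stick =>
    rintro j ⟨J', j'⟩ hp hq h hl
    have h0 : j (.root _) = j' (.root _) := hp.root_eq hq h
    -- The stick and the tree with a single nullary vertex have the same edges; the leaf condition
    -- tells them apart.
    have h1 := (hl _ _ h0).1 (Multiset.mem_singleton_self _)
    cases J' with
    | node => exact absurd h1 root_not_mem_leaves
    | stick =>
      refine Sigma.ext rfl (heq_of_eq ?_)
      funext e
      cases e
      exact h0
  | node n t ih =>
    rintro j ⟨J', j'⟩ hp hq h hl
    have h0 : j (.root _) = j' (.root _) := hp.root_eq hq h
    cases J' with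
    | stick => exact absurd ((hl _ _ h0).2 (Multiset.mem_singleton_self _)) root_not_mem_leaves
    | node n' t' =>
      choose σ hσ using hp.child_eq hq h
      choose τ hτ using hq.child_eq hp h.symm
      have idx : ∀ {i k}, j (.sub i (.root _)) = j (.sub k (.root _)) → i = k := fun {i k} h' => by
        cases hp.injective h'; rfl
      have idx' : ∀ {i k}, j' (.sub i (.root _)) = j' (.sub k (.root _)) → i = k :=
        fun {i k} h' => by cases hq.injective h'; rfl
      -- The inputs of the two root vertices correspond bijectively, and by planarity monotonically,
      -- hence identically.
      let e : Fin n ≃ Fin n' := ⟨σ, τ, fun i => idx (by rw [← hτ, ← hσ]),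
        fun i => idx' (by rw [← hσ, ← hτ])⟩
      have hmono : ∀ {i k}, i ≤ k → σ i ≤ σ k := by
        intro i k hik
        have : PlanarLE (j (.sub i (.root _))) (j (.sub k (.root _))) := by
          apply hp.2
          rcases hik.lt_or_eq with h' | rfl
          · exact .left h' _ _
          · exact .sub _ (.root _)
        rw [hσ, hσ] at this
        exact (hq.planar_iff.1 this).idx_le
      obtain rfl : n = n' := by simpa using Fintype.card_congr e
      have hid : ∀ i, σ i = i := by
        have hs : StrictMono σ := Monotone.strictMono_of_injective (fun _ _ => hmono) e.injective
        let e' : Fin n ≃o Fin n := StrictMono.orderIsoOfSurjective σ hs e.surjective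
        intro i
        have : e' = OrderIso.refl _ := Subsingleton.elim _ _
        exact DFunLike.congr_fun this i
      replace hσ : ∀ i, j (.sub i (.root _)) = j' (.sub i (.root _)) := fun i => by
        rw [hσ i, hid i]
      rw [Emb.node_eq j, Emb.node_eq j', h0]
      congr 1
      funext i
      refine ih i ⟨fun x y => (hp.1 _ _).trans (sub_above_iff i x y),
        fun x y hxy => hp.2 _ _ (.sub i hxy)⟩ ⟨fun x y => (hq.1 _ _).trans (sub_above_iff i x y),
        fun x y hxy => hq.2 _ _ (.sub i hxy)⟩ ?_ fun x y hxy => ?_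
      -- The edges over the `i`-th input are recognized in the image as those above the image of
      -- that input, so the two subtrees have the same image.
      · have key : ∀ {t t' : Fin n → PTree} {j : Edge (.node n t) → Edge T}
            {j' : Edge (.node n t') → Edge T} (_ : Emb.IsPlanarEmb ⟨_, j⟩)
            (hq : Emb.IsPlanarEmb ⟨_, j'⟩) (h : Set.range j = Set.range j')
            (_ : j (.sub i (.root _)) = j' (.sub i (.root _))),
            (Set.range fun x : Edge (t i) => j (.sub i x)) ⊆
              Set.range fun x : Edge (t' i) => j' (.sub i x) := by
          rintro t t' j j' hp hq h hσ _ ⟨x, rfl⟩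
          obtain ⟨y, hy⟩ : j (.sub i x) ∈ Set.range j' := h ▸ ⟨_, rfl⟩
          have : Above (j (.sub i x)) (j (.sub i (.root _))) := (hp.1 _ _).2 (.sub i (.root x))
          rw [hσ, ← hy] at this
          have : Above y (.sub i (.root _)) := (hq.1 _ _).1 this
          cases this with
          | sub _ _ => exact ⟨_, hy⟩
        exact (key hp hq h (hσ i)).antisymm (key hq hp h.symm (hσ i).symm)
      · have := hl _ _ hxy
        rwa [sub_mem_leaves, sub_mem_leaves] at this

theorem IsFace.isPlanarEmb {J : PTree} {j : J ⟶ T} (hj : IsFace j) (hj' : IsPlanar j) :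
    Emb.IsPlanarEmb ⟨J, j.edge⟩ := ⟨fun _ _ => hj.above_iff, hj'⟩

/-- Planar faces are determined by their images and their leaves. -/
theorem planarFace_unique {J J' : PTree} {j : J ⟶ T} {j' : J' ⟶ T} (hj : IsFace j)
    (hp : IsPlanar j) (hj' : IsFace j') (hp' : IsPlanar j')
    (hr : Set.range j.edge = Set.range j'.edge)
    (hl : (leaves J).map j.edge = (leaves J').map j'.edge) :
    ∃ h : J = J', eqToHom h ≫ j' = j := by
  have := (hj.isPlanarEmb hp).ext (hj'.isPlanarEmb hp') hr fun x y hxy => by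
    rw [← Multiset.mem_map_of_injective hj, hl]
    simp only at hxy
    rw [hxy]
    exact Multiset.mem_map_of_injective hj'
  obtain ⟨rfl, h⟩ := Sigma.mk.inj_iff.1 this
  refine ⟨rfl, hom_ext fun e => ?_⟩
  rw [eq_of_heq h]
  rfl

/-- The planar embedding with these edges and leaves is a tree map: it preserves and reflects the
order, and it sends the maximal relation to the given relation `Broad m r`. -/
theorem exists_planarFace {r : Edge T} (E : Set (Edge T)) (m : Multiset (Edge T))
    (hm : Broad m r) (hmE : ∀ x ∈ m, x ∈ E) (h0 : r ∈ E) (h1 : ∀ x ∈ E, Above x r)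
    (hE : ∀ x ∈ E, ∀ y ∈ m, Above x y → x = y) :
    ∃ (J : PTree) (j : J ⟶ T), IsFace j ∧ IsPlanar j ∧ Set.range j.edge = E ∧
      (leaves J).map j.edge = m ∧ j.edge (.root J) = r := by
  obtain ⟨⟨J, j⟩, hp, hr, hl⟩ := exists_planarEmb E m hm hmE h0 h1 hE
  have hroot : j (.root J) = r := by
    obtain ⟨y, rfl⟩ : r ∈ Set.range j := hr ▸ h0
    exact (h1 _ (hr ▸ ⟨_, rfl⟩)).antisymm ((hp.1 _ _).2 (.root y))
  refine ⟨J, ⟨j, broad_map_of_order j (fun x y => (hp.1 x y).2)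
    (fun x y h => .inl ((hp.1 x y).1 h)) ?_⟩, hp.injective, hp.2, hr, hl, hroot⟩
  rw [hroot]
  exact (show (leaves J).map j = m from hl) ▸ hm

/-! ### The region of the target spanned by a map -/

/-- The edges of the subtree of `T` spanned by the images of the root and the leaves. -/
def region {S : PTree} (f : S ⟶ T) : Set (Edge T) :=
  {x | Above x (f.edge (.root S)) ∧ ∀ l ∈ leaves S, Above x (f.edge l) → x = f.edge l}

/-- The inner edges of the subtree of `T` spanned by the images of the root and the leaves. -/
def innerRegion {S : PTree} (f : S ⟶ T) : Set (Edge T) :=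
  {x | Above x (f.edge (.root S)) ∧ x ≠ f.edge (.root S) ∧ ∀ l ∈ leaves S, ¬ Above x (f.edge l)}

variable {S : PTree}

/-- If the image of an edge lies above the image of a leaf, the two edges are comparable; whichever
is the upper one, the images agree. -/
theorem edge_mem_region (f : S ⟶ T) (x : Edge S) : f.edge x ∈ region f := by
  refine ⟨hom_above f (.root x), fun l hl h => ?_⟩
  rcases hom_comparable f h with h' | h'
  · rw [eq_of_above_leaf hl h']
  · exact h.antisymm (hom_above f h')

theorem mem_region_iff (f : S ⟶ T) {x : Edge T} : x ∈ region f ↔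
    x ∈ innerRegion f ∨ x = f.edge (.root S) ∨ ∃ l ∈ leaves S, x = f.edge l := by
  constructor
  · intro h
    by_cases h0 : x = f.edge (.root S)
    · exact .inr (.inl h0)
    by_cases h1 : ∃ l ∈ leaves S, x = f.edge l
    · exact .inr (.inr h1)
    exact .inl ⟨h.1, h0, fun l hl h' => h1 ⟨l, hl, h.2 l hl h'⟩⟩
  · rintro (h | rfl | ⟨l, -, rfl⟩)
    · exact ⟨h.1, fun l hl h' => absurd h' (h.2.2 l hl)⟩
    · exact edge_mem_region f _
    · exact edge_mem_region f _

theorem innerRegion_subset (f : S ⟶ T) : innerRegion f ⊆ region f :=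
  fun _ h => (mem_region_iff f).2 (.inl h)

/-- The planar face of `T` with prescribed edges and the leaves and the root of `f`. -/
theorem exists_planarFace_region (f : S ⟶ T) (E : Set (Edge T))
    (h0 : f.edge (.root S) ∈ E) (hl : ∀ l ∈ leaves S, f.edge l ∈ E) (hE : E ⊆ region f) :
    ∃ (J : PTree) (j : J ⟶ T), IsFace j ∧ IsPlanar j ∧ Set.range j.edge = E ∧
      (leaves S).map f.edge = (leaves J).map j.edge ∧ f.edge (.root S) = j.edge (.root J) := by
  obtain ⟨J, j, h1, h2, h3, h4, h5⟩ := exists_planarFace E _ (f.broad (leaves_broad S))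
    (fun x hx => by obtain ⟨l, hl', rfl⟩ := Multiset.mem_map.1 hx; exact hl l hl') h0
    (fun x hx => (hE hx).1) (fun x hx y hy hxy => by
      obtain ⟨l, hl', rfl⟩ := Multiset.mem_map.1 hy
      exact (hE hx).2 l hl' hxy)
  exact ⟨J, j, h1, h2, h3, h4.symm, h5.symm⟩

theorem region_eq {S' : PTree} {f : S ⟶ T} {f' : S' ⟶ T}
    (hl : (leaves S).map f.edge = (leaves S').map f'.edge)
    (h0 : f.edge (.root S) = f'.edge (.root S')) : region f = region f' := by
  have : ∀ {S} (f : S ⟶ T), region f = {x | Above x (f.edge (.root S)) ∧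
      ∀ y ∈ (leaves S).map f.edge, Above x y → x = y} := by
    intro S f
    simp [region]
  rw [this, this, hl, h0]

theorem IsTall.leaves_comp {J : PTree} {k : S ⟶ J} (hk : IsTall k) (j : J ⟶ T) :
    (leaves S).map (k ≫ j).edge = (leaves J).map j.edge := by
  rw [← hk.1, Multiset.map_map]; rfl

theorem IsTall.root_comp {J : PTree} {k : S ⟶ J} (hk : IsTall k) (j : J ⟶ T) :
    (k ≫ j).edge (.root S) = j.edge (.root J) := by
  rw [comp_edge, hk.2]

/-- Outer faces are the faces containing all edges of the region spanned by their leaves and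
their root. -/
theorem isOuterFace_iff {v : S ⟶ T} :
    IsOuterFace v ↔ IsFace v ∧ region v ⊆ Set.range v.edge := by
  constructor
  · rintro ⟨hv, h⟩
    refine ⟨hv, ?_⟩
    -- The planar face on the whole region has the same leaves and root as `v`, so `v` factors
    -- through it by an inner face. By hypothesis this is invertible, and `v` reaches the whole
    -- region.
    obtain ⟨U, u, hu, -, hr, hl, h0⟩ := exists_planarFace_region v (region v)
      (edge_mem_region v _) (fun l _ => edge_mem_region v l) le_rfl
    obtain ⟨k, hk, hk'⟩ := exists_tall_lift hu v (fun x => hr ▸ edge_mem_region v x) hl h0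
    have hkf : IsFace k := fun x y hxy => hv (by rw [← hk, comp_edge, comp_edge, hxy])
    have := h U k u ⟨hkf, hk'⟩ hu hk
    rw [← hr]
    rintro _ ⟨x, rfl⟩
    refine ⟨(inv k).edge x, ?_⟩
    rw [← hk, comp_edge, ← comp_edge (inv k) k, IsIso.inv_hom_id]
    rfl
  · rintro ⟨hv, h⟩
    refine ⟨hv, fun U f₂ f₁ h2 h1 e => ?_⟩
    subst e
    have hr : ∀ x, f₁.edge x ∈ Set.range (f₂ ≫ f₁).edge := fun x => h <| by
      rw [region_eq (h2.2.leaves_comp f₁) (h2.2.root_comp f₁)]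
      exact edge_mem_region f₁ x
    -- The edges of `f₁` lie in the region, hence in the image of `v`; lifting `f₁` through `v`
    -- gives the inverse of `f₂`.
    obtain ⟨k, hk, -⟩ := exists_tall_lift hv f₁ hr (h2.2.leaves_comp f₁).symm
      (h2.2.root_comp f₁).symm
    have hk2 : k ≫ f₂ = 𝟙 _ := h1.mono (by rw [Category.assoc, hk, Category.id_comp])
    exact ⟨k, h2.1.mono (by rw [Category.assoc, hk2, Category.comp_id, Category.id_comp]), hk2⟩

end Dendroidal

namespace Dendroidal

/-! ### Operad maps into the Boardman–Vogt operad -/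

variable {S S' T T' : PTree} {L L' : Type} [CompleteLattice L] [CompleteLattice L']

theorem exists_enum {α : Type*} (m : Multiset α) :
    ∃ (n : ℕ) (c : Fin n → α), Finset.univ.val.map c = m := by
  induction m using Quotient.inductionOn with
  | h l =>
    refine ⟨l.length, l.get, ?_⟩
    rw [Fin.univ_val_map, List.ofFn_get]
    rfl

/-- Enumerations of a tuple without repetition differ by a permutation. With equivariance this
allows operations to be indexed by unordered tuples. -/
theorem exists_equiv_of_enum {α : Type*} {n n' : ℕ} {c : Fin n → α} {c' : Fin n' → α}
    (hc : (Finset.univ.val.map c).Nodup)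
    (h : Finset.univ.val.map c' = Finset.univ.val.map c) :
    ∃ σ : Fin n' ≃ Fin n, ∀ t, c' t = c (σ t) := by
  have key : ∀ {n n' : ℕ} {c : Fin n → α} {c' : Fin n' → α},
      Finset.univ.val.map c' = Finset.univ.val.map c → ∀ t, ∃ s, c' t = c s := by
    intro n n' c c' h t
    have : c' t ∈ Finset.univ.val.map c := h ▸ Multiset.mem_map_of_mem c' (Finset.mem_univ t)
    obtain ⟨s, -, hs⟩ := Multiset.mem_map.1 this
    exact ⟨s, hs.symm⟩
  choose σ hσ using key h
  choose τ hτ using key h.symm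
  have inj : ∀ {n : ℕ} {c : Fin n → α}, (Finset.univ.val.map c).Nodup → ∀ {i j}, c i = c j → i = j :=
    fun {n c} hc {i j} hij =>
      Multiset.inj_on_of_nodup_map hc i (Finset.mem_univ i) j (Finset.mem_univ j) hij
  exact ⟨⟨σ, τ, fun i => inj (h ▸ hc) (by rw [← hτ, ← hσ]), fun i => inj hc (by rw [← hσ, ← hτ])⟩,
    hσ⟩

/-- The inner edges of the subtree of `T` with leaves `f m` and root `f e`. -/
def innerSet (f : S ⟶ T) (m : Multiset (Edge S)) (e : Edge S) : Set (Edge T) :=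
  {x | Above x (f.edge e) ∧ x ≠ f.edge e ∧ ∀ y ∈ m, ¬ Above x (f.edge y)}

theorem Inn_eq_innerSet (f : S ⟶ T) {n : ℕ} {c : Fin n → Edge S} {m : Multiset (Edge S)}
    (h : Finset.univ.val.map c = m) (e : Edge S) :
    Inn (fun i => f.edge (c i)) (f.edge e) = innerSet f m e := by
  subst h
  ext x
  simp [Inn, innerSet]

open Classical in
/-- The tuple of leaves above an edge. -/
noncomputable def leavesAbove (e : Edge S) : Multiset (Edge S) :=
  (leaves S).filter fun l => Above l e

theorem mem_leavesAbove {e l : Edge S} : l ∈ leavesAbove e ↔ l ∈ leaves S ∧ Above l e := by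
  classical
  simp [leavesAbove]

theorem leavesAbove_broad (e : Edge S) : Broad (leavesAbove e) e := by
  have h := (leaves_broad S).antichain
  refine broad_of_antichain (by classical exact h.1.filter _) ?_ (fun x hx => (mem_leavesAbove.1 hx).2) ?_
  · exact fun x hx y hy => h.2 x (mem_leavesAbove.1 hx).1 y (mem_leavesAbove.1 hy).1
  · exact fun l hl h => ⟨l, mem_leavesAbove.2 ⟨hl, h⟩, .rfl' l⟩

theorem leavesAbove_root : leavesAbove (.root S) = leaves S := by
  classical
  rw [leavesAbove, Multiset.filter_eq_self]
  exact fun l _ => .root l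

/-- The full subtree above `e` is obtained by grafting the full subtrees above the `c i`. This is
how an arbitrary relation gets compared with the maximal one. -/
theorem leavesAbove_eq_sum {n : ℕ} {c : Fin n → Edge S} {e : Edge S}
    (h : Broad (Finset.univ.val.map c) e) : leavesAbove e = ∑ i, leavesAbove (c i) := by
  refine (Multiset.Nodup.ext (leavesAbove_broad e).antichain.1
    (Broad.trans h fun i => leavesAbove_broad (c i)).antichain.1).2 fun l => ?_
  rw [Multiset.mem_sum, mem_leavesAbove]
  constructor
  · rintro ⟨hl, hle⟩
    obtain ⟨x, hx, hlx⟩ := h.cover_leaf l hl hle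
    obtain ⟨i, -, rfl⟩ := Multiset.mem_map.1 hx
    exact ⟨i, Finset.mem_univ _, mem_leavesAbove.2 ⟨hl, hlx⟩⟩
  · rintro ⟨i, -, hi⟩
    rw [mem_leavesAbove] at hi
    exact ⟨hi.1, hi.2.trans (h.above' i)⟩

/-- The map of trees underlying a map of operads. -/
def treeHom (F : omegaOperad S ⟶ wOperad T L) : S ⟶ T where
  edge := F.color
  broad {m e} h := by
    obtain ⟨n, c, rfl⟩ := exists_enum m
    refine (congrArg (fun m => Broad m _) (Multiset.map_map (β := Edge S) (γ := Edge T)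
      F.color c _)).mpr ?_
    exact WOp.rel (Operad.Hom.op F (c := c) (c₀ := e) ⟨h⟩)

/-- The operation of `W(T)` assigned to a broad relation. -/
def opOf (F : omegaOperad S ⟶ wOperad T L) {n : ℕ} {c : Fin n → Edge S} {e : Edge S}
    (h : Broad (Finset.univ.val.map c) e) :
    WOp L (fun i => (treeHom F).edge (c i)) ((treeHom F).edge e) :=
  Operad.Hom.op F (c := c) (c₀ := e) ⟨h⟩

theorem opOf_act (F : omegaOperad S ⟶ wOperad T L) {m n : ℕ} (σ : Fin m ≃ Fin n)
    {c : Fin n → Edge S} {c' : Fin m → Edge S} {e : Edge S} (hc : ∀ t, c' t = c (σ t))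
    (h : Broad (Finset.univ.val.map c) e) (h' : Broad (Finset.univ.val.map c') e) (x : Edge T) :
    (opOf F h').full x = (opOf F h).full x := by
  have : opOf F h' = WOp.act σ (fun t => congrArg (treeHom F).edge (hc t)) (opOf F h) :=
    F.op_act σ (c := c) (c' := c') (c₀ := e) hc ⟨h⟩
  rw [this, WOp.full_act]

theorem opOf_comp (F : omegaOperad S ⟶ wOperad T L) {n : ℕ} {k : Fin n → ℕ} {m : ℕ}
    (eq : Fin m ≃ Σ i, Fin (k i)) {c : Fin n → Edge S} {d : ∀ i, Fin (k i) → Edge S}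
    {b : Fin m → Edge S} {e : Edge S} (hb : ∀ t, b t = d (eq t).1 (eq t).2)
    (h : Broad (Finset.univ.val.map c) e) (hd : ∀ i, Broad (Finset.univ.val.map (d i)) (c i))
    (h' : Broad (Finset.univ.val.map b) e) (x : Edge T) :
    (opOf F h').full x = (opOf F h).full x ⊓ ⨅ i, (opOf F (hd i)).full x := by
  have : opOf F h' = WOp.comp eq (d := fun i j => (treeHom F).edge (d i j))
      (fun t => congrArg (treeHom F).edge (hb t)) (opOf F h) (fun i => opOf F (hd i)) :=
    F.op_comp eq (c := c) (d := d) (b := b) (c₀ := e) hb ⟨h⟩ fun i => ⟨hd i⟩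
  rw [this, WOp.full_comp]

/-- The length function of the operation assigned to a broad relation. -/
noncomputable def lenOf (F : omegaOperad S ⟶ wOperad T L) (m : Multiset (Edge S)) (e : Edge S)
    (h : Broad m e) (x : Edge T) : L :=
  (opOf F (c := (exists_enum m).choose_spec.choose) (e := e)
    ((exists_enum m).choose_spec.choose_spec.symm ▸ h)).full x

/-- The enumeration chosen in `lenOf` is immaterial, since permuting inputs does not change lengths.
-/
theorem opOf_full (F : omegaOperad S ⟶ wOperad T L) {n : ℕ} {c : Fin n → Edge S} {e : Edge S}
    (h : Broad (Finset.univ.val.map c) e) (x : Edge T) :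
    (opOf F h).full x = lenOf F _ e h x := by
  obtain ⟨σ, hσ⟩ := exists_equiv_of_enum h.antichain.1
    (exists_enum (Finset.univ.val.map c)).choose_spec.choose_spec
  exact (opOf_act F σ hσ _ _ x).symm

theorem lenOf_off (F : omegaOperad S ⟶ wOperad T L) {m : Multiset (Edge S)} {e : Edge S}
    (h : Broad m e) {x : Edge T} (hx : x ∉ innerSet (treeHom F) m e) : lenOf F m e h x = ⊤ := by
  obtain ⟨n, c, rfl⟩ := exists_enum m
  rw [← opOf_full]
  exact WOp.full_of_not_mem _ (by rwa [Inn_eq_innerSet _ rfl])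

theorem lenOf_sum (F : omegaOperad S ⟶ wOperad T L) {n : ℕ} {c : Fin n → Edge S}
    {m : Fin n → Multiset (Edge S)} {e : Edge S} (h : Broad (Finset.univ.val.map c) e)
    (hm : ∀ i, Broad (m i) (c i)) (h' : Broad (∑ i, m i) e) (x : Edge T) :
    lenOf F _ e h' x = lenOf F _ e h x ⊓ ⨅ i, lenOf F _ _ (hm i) x := by
  choose k d hd using fun i => exists_enum (m i)
  obtain rfl : (fun i => Finset.univ.val.map (d i)) = m := funext hd
  -- The lexicographic enumeration of the sum of the tuples turns the sum into an operadic
  -- composite.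
  have hb : Finset.univ.val.map (fun t => d (finSigmaFinEquiv.symm t).1
      (finSigmaFinEquiv.symm t).2) = ∑ i, Finset.univ.val.map (d i) := by
    have h1 : ∀ {ι : Type} [Fintype ι] (g : ι → Edge S),
        Finset.univ.val.map g = ∑ i, ({g i} : Multiset (Edge S)) := fun g =>
      (Multiset.bind_singleton _ g).symm
    simp_rw [h1]
    rw [← Fintype.sum_sigma', ← (finSigmaFinEquiv (n := k)).symm.sum_comp]
  have := opOf_comp F finSigmaFinEquiv.symm (fun _ => rfl) h hm (hb ▸ h') x
  simp only [opOf_full] at this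
  rw [← this]
  congr 1
  exact hb.symm

/-- All length functions are restrictions of the one for the maximal relation. -/
theorem lenOf_eq (F : omegaOperad S ⟶ wOperad T L) {m : Multiset (Edge S)} {e : Edge S}
    (h : Broad m e) {x : Edge T} (hx : x ∈ innerSet (treeHom F) m e) :
    lenOf F m e h x = lenOf F _ _ (leaves_broad S) x := by
  obtain ⟨n, c, rfl⟩ := exists_enum m
  have hc : ∀ i, ¬ Above x ((treeHom F).edge (c i)) := fun i =>
    hx.2.2 _ (Multiset.mem_map_of_mem c (Finset.mem_univ i))
  -- Graft the full subtrees above the `c i`. As `x` is not above any image of `c i`, the grafted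
  -- operations contribute `⊤`.
  have h1 : lenOf F _ e h x = lenOf F _ e (leavesAbove_broad e) x := by
    have h' := leavesAbove_broad e
    have := lenOf_sum F h (fun i => leavesAbove_broad (c i)) (leavesAbove_eq_sum h ▸ h') x
    simp only [← leavesAbove_eq_sum h] at this
    rw [this, iInf_eq_top.2 fun i => lenOf_off F _ fun h' => hc i h'.1, inf_top_eq]
  rw [h1]
  -- Complete `e` to a relation with target the root and graft full subtrees on it. As `x` lies
  -- above the image of `e`, only the subtree above `e` contributes.
  obtain ⟨m', hm', he⟩ := exists_broad_root e
  obtain ⟨n', c', rfl⟩ := exists_enum m'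
  obtain ⟨i, -, rfl⟩ := Multiset.mem_map.1 he
  have := lenOf_sum F hm' (fun i => leavesAbove_broad (c' i))
    (leavesAbove_eq_sum hm' ▸ leavesAbove_broad _) x
  simp only [← leavesAbove_eq_sum hm', leavesAbove_root] at this
  rw [this, lenOf_off F hm' fun h' => h'.2.2 _ he hx.1, top_inf_eq]
  refine le_antisymm (le_iInf fun j => ?_) (iInf_le _ i)
  by_cases hj : j = i
  · rw [hj]
  · rw [lenOf_off F (leavesAbove_broad (c' j)) fun h' => hj
      ((broad_map (treeHom F) hm').disjoint (c := fun i => (treeHom F).edge (c' i)) h'.1 hx.1)]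
    exact le_top

/-! ### Codes for operad maps -/

/-- A map of trees together with lengths for the inner edges of the subtree spanned by it, in which
the edges in the image have length `1`. -/
structure Code (L : Type) [CompleteLattice L] (S T : PTree) where
  hom : S ⟶ T
  len : Edge T → L
  len_off : ∀ x, x ∉ innerRegion hom → len x = ⊤
  len_edge : ∀ s, len (hom.edge s) = ⊤

theorem Code.ext_inner {a b : Code L S T} (h : a.hom = b.hom)
    (h' : ∀ x ∈ innerRegion a.hom, a.len x = b.len x) : a = b := by
  obtain ⟨f, φ, hφ, _⟩ := a
  obtain ⟨g, ψ, hψ, _⟩ := b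
  obtain rfl : f = g := h
  have : φ = ψ := funext fun x => by
    by_cases hx : x ∈ innerRegion f
    · exact h' x hx
    · rw [hφ x hx, hψ x hx]
  subst this
  rfl

noncomputable def Code.ofHom (F : omegaOperad S ⟶ wOperad T L) : Code L S T where
  hom := treeHom F
  len := lenOf F _ _ (leaves_broad S)
  len_off _ hx := lenOf_off F _ hx
  -- The edge `s` occurs in some relation with target the root. Grafting full subtrees on it yields
  -- the maximal relation, with the image of `s` at a grafting place; so none of the composed
  -- operations has it as an inner edge.
  len_edge s := by
    obtain ⟨m, hm, hs⟩ := exists_broad_root s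
    obtain ⟨n, c, rfl⟩ := exists_enum m
    obtain ⟨i, -, rfl⟩ := Multiset.mem_map.1 hs
    have := lenOf_sum F hm (fun i => leavesAbove_broad (c i))
      (leavesAbove_eq_sum hm ▸ leavesAbove_broad _) ((treeHom F).edge (c i))
    simp only [← leavesAbove_eq_sum hm, leavesAbove_root] at this
    rw [this, lenOf_off F hm fun h' => h'.2.2 _ hs (.rfl' _), top_inf_eq, iInf_eq_top]
    refine fun j => lenOf_off F _ fun h' => h'.2.1 ?_
    rw [(broad_map (treeHom F) hm).disjoint (c := fun i => (treeHom F).edge (c i)) h'.1 (.rfl' _)]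

theorem Code.ofHom_opOf (F : omegaOperad S ⟶ wOperad T L) {n : ℕ} {c : Fin n → Edge S}
    {e : Edge S} (h : Broad (Finset.univ.val.map c) e) {x : Edge T}
    (hx : x ∈ Inn (fun i => (treeHom F).edge (c i)) ((treeHom F).edge e)) :
    (opOf F h).full x = (Code.ofHom F).len x := by
  rw [opOf_full]
  exact lenOf_eq F h (by rwa [← Inn_eq_innerSet _ rfl])

theorem Code.ofHom_injective : Function.Injective (Code.ofHom (S := S) (T := T) (L := L)) := by
  intro F G h
  have h1 : treeHom F = treeHom G := congrArg Code.hom h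
  have h2 : F.color = G.color := congrArg PTree.Hom.edge h1
  have h3 := congrArg Code.len h
  -- The types of the operations depend on the color map, so equality is heterogeneous until the two
  -- tree maps are identified.
  have key : ∀ {n : ℕ} (c : Fin n → Edge S) (e : Edge S) (p : PLift _),
      HEq (Operad.Hom.op F (c := c) (c₀ := e) p) (Operad.Hom.op G (c := c) (c₀ := e) p) := by
    intro n c e p
    have h4 : ∀ x ∈ Inn (fun i => (treeHom F).edge (c i)) ((treeHom F).edge e),
        (opOf F p.down).full x = (opOf G p.down).full x := fun x hx => by
      rw [Code.ofHom_opOf F p.down hx, Code.ofHom_opOf G p.down (h1 ▸ hx), h3]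
    show HEq (opOf F p.down) (opOf G p.down)
    generalize opOf F p.down = a at h4
    generalize opOf G p.down = b at h4
    revert a b
    rw [h1]
    exact fun a b h4 => heq_of_eq (WOp.ext_full h4)
  obtain ⟨color, op, _, _, _⟩ := F
  obtain ⟨color', op', _, _, _⟩ := G
  obtain rfl : color = color' := h2
  have : @op = @op' := by
    funext n c e p
    exact eq_of_heq (key c e p)
  subst this
  rfl

/-- The operation of `W(T)` assigned to a broad relation by a code. -/
def Code.op (a : Code L S T) {n : ℕ} {c : Fin n → Edge S} {e : Edge S}
    (h : Broad (Finset.univ.val.map c) e) :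
    WOp L (fun i => a.hom.edge (c i)) (a.hom.edge e) := ⟨broad_map a.hom h, fun x => a.len x⟩

theorem Code.op_full (a : Code L S T) {n : ℕ} {c : Fin n → Edge S} {e : Edge S}
    (h : Broad (Finset.univ.val.map c) e) {x : Edge T}
    (hx : x ∈ Inn (fun i => a.hom.edge (c i)) (a.hom.edge e)) : (a.op h).full x = a.len x :=
  WOp.full_of_mem _ hx

theorem Code.le_op_full (a : Code L S T) {n : ℕ} {c : Fin n → Edge S} {e : Edge S}
    (h : Broad (Finset.univ.val.map c) e) (x : Edge T) : a.len x ≤ (a.op h).full x := by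
  by_cases hx : x ∈ Inn (fun i => a.hom.edge (c i)) (a.hom.edge e)
  · rw [a.op_full h hx]
  · rw [WOp.full_of_not_mem _ hx]; exact le_top

theorem Code.op_act (a : Code L S T) {m n : ℕ} (σ : Fin m ≃ Fin n) {c : Fin n → Edge S}
    {c' : Fin m → Edge S} {e : Edge S} (hc : ∀ t, c' t = c (σ t))
    (h : Broad (Finset.univ.val.map c) e) (h' : Broad (Finset.univ.val.map c') e) :
    a.op h' = WOp.act σ (fun t => congrArg a.hom.edge (hc t)) (a.op h) := by
  refine WOp.ext_full fun x hx => ?_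
  rw [WOp.full_act, a.op_full h' hx, a.op_full h]
  rwa [← Inn_act σ fun t => congrArg a.hom.edge (hc t)]

/-- An inner edge of the composite is inner for the outer operation, inner for one of the inserted
operations, or the image of a grafting edge `c i`. In the last case the composite prescribes length
`1`, which is exactly what `len_edge` ensures. -/
theorem Code.op_comp (a : Code L S T) {n : ℕ} {k : Fin n → ℕ} {m : ℕ}
    (eq : Fin m ≃ Σ i, Fin (k i)) {c : Fin n → Edge S} {d : ∀ i, Fin (k i) → Edge S}
    {b : Fin m → Edge S} {e : Edge S} (hb : ∀ t, b t = d (eq t).1 (eq t).2)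
    (h : Broad (Finset.univ.val.map c) e) (hd : ∀ i, Broad (Finset.univ.val.map (d i)) (c i))
    (h' : Broad (Finset.univ.val.map b) e) :
    a.op h' = WOp.comp eq (d := fun i j => a.hom.edge (d i j))
      (fun t => congrArg a.hom.edge (hb t)) (a.op h) (fun i => a.op (hd i)) := by
  refine WOp.ext_full fun x hx => ?_
  rw [WOp.full_comp, a.op_full h' hx]
  refine le_antisymm (le_inf (a.le_op_full h x) (le_iInf fun i => a.le_op_full (hd i) x)) ?_
  by_cases h1 : x ∈ Inn (fun i => a.hom.edge (c i)) (a.hom.edge e)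
  · rw [a.op_full h h1]; exact inf_le_left
  · obtain ⟨i, hi⟩ : ∃ i, Above x (a.hom.edge (c i)) := by
      by_contra! h2
      exact h1 ⟨hx.1, hx.2.1, h2⟩
    by_cases h2 : x = a.hom.edge (c i)
    · rw [h2, a.len_edge]; exact le_top
    · rw [← a.op_full (hd i) (x := x) ⟨hi, h2, fun j hj => ?_⟩]
      · exact inf_le_right.trans (iInf_le _ i)
      · obtain ⟨t, ht⟩ := eq.surjective ⟨i, j⟩
        refine hx.2.2 t ?_
        beta_reduce
        rw [hb, ht]
        exact hj

/-- The map of operads given by a code. -/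
def Code.toHom (a : Code L S T) : omegaOperad S ⟶ wOperad T L where
  color := a.hom.edge
  op p := a.op p.down
  op_act σ _ _ _ h p := a.op_act σ h p.down _
  op_one _ := WOp.ext_full fun _ hy => absurd hy.1 (hy.2.2 0)
  op_comp eq _ _ _ _ hb x y := a.op_comp eq hb x.down (fun i => (y i).down) _

theorem Code.ofHom_toHom (a : Code L S T) : Code.ofHom a.toHom = a := by
  refine Code.ext_inner rfl fun x hx => ?_
  obtain ⟨n, c, hc⟩ := exists_enum (leaves S)
  have hx' : x ∈ Inn (fun i => a.hom.edge (c i)) (a.hom.edge (.root S)) := by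
    rw [Inn_eq_innerSet a.hom hc]; exact hx
  have h := leaves_broad S
  rw [← hc] at h
  exact (Code.ofHom_opOf a.toHom h hx').symm.trans (a.op_full h hx')

/-- Maps of operads from `Ω(S)` to the Boardman–Vogt operad of `T` in terms of codes. -/
noncomputable def codeEquiv : (omegaOperad S ⟶ wOperad T L) ≃ Code L S T where
  toFun := Code.ofHom
  invFun := Code.toHom
  left_inv _ := Code.ofHom_injective (Code.ofHom_toHom _)
  right_inv := Code.ofHom_toHom

/-- The functoriality of `Ω(-)`, as a map between operads of trees. -/
def omegaMap (g : S' ⟶ S) : omegaOperad S' ⟶ omegaOperad S := omega.map g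

/-! ### Functoriality of codes -/

theorem codeEquiv_comp_hom (g : S' ⟶ S) (F : omegaOperad S ⟶ wOperad T L) :
    (codeEquiv (omegaMap g ≫ F)).hom = g ≫ (codeEquiv F).hom := rfl

/-- The maximal relation of `S'` is sent by `g` to some relation of `S`, and the operation of `F` on
it has the lengths of the code of `F`. -/
theorem codeEquiv_comp_len (g : S' ⟶ S) (F : omegaOperad S ⟶ wOperad T L) {x : Edge T}
    (hx : x ∈ innerRegion (g ≫ (codeEquiv F).hom)) :
    (codeEquiv (omegaMap g ≫ F)).len x = (codeEquiv F).len x := by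
  obtain ⟨n, c, hc⟩ := exists_enum (leaves S')
  have h := leaves_broad S'
  rw [← hc] at h
  have hx' : x ∈ Inn (fun i => (g ≫ (codeEquiv F).hom).edge (c i))
      ((g ≫ (codeEquiv F).hom).edge (.root S')) := by
    rw [Inn_eq_innerSet _ hc]; exact hx
  exact (Code.ofHom_opOf (omegaMap g ≫ F) h hx').symm.trans
    (Code.ofHom_opOf F (c := fun i => g.edge (c i)) (broad_map g h) hx')

theorem codeEquiv_mapLen_hom (F : omegaOperad S ⟶ wOperad T L) (θ : CompleteLatticeHom L L') :
    (codeEquiv (F ≫ wMapLen T θ)).hom = (codeEquiv F).hom := rfl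

theorem codeEquiv_mapLen_len (F : omegaOperad S ⟶ wOperad T L) (θ : CompleteLatticeHom L L')
    (x : Edge T) : (codeEquiv (F ≫ wMapLen T θ)).len x = θ ((codeEquiv F).len x) :=
  WOp.full_mapLen θ _ x

theorem codeEquiv_push_hom (F : omegaOperad S ⟶ wOperad T L) (g : T ⟶ T') :
    (codeEquiv (F ≫ wPush L g)).hom = (codeEquiv F).hom ≫ g := rfl

theorem codeEquiv_push_len (F : omegaOperad S ⟶ wOperad T L) (g : T ⟶ T') {y : Edge T'}
    (hy : y ∈ innerRegion ((codeEquiv F).hom ≫ g)) :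
    (codeEquiv (F ≫ wPush L g)).len y =
      ⨆ x ∈ innerRegion (codeEquiv F).hom, ⨆ _ : g.edge x = y, (codeEquiv F).len x := by
  obtain ⟨n, c, hc⟩ := exists_enum (leaves S)
  have h := leaves_broad S
  rw [← hc] at h
  have hy' : y ∈ Inn (fun i => ((codeEquiv F).hom ≫ g).edge (c i))
      (((codeEquiv F).hom ≫ g).edge (.root S)) := by
    rw [Inn_eq_innerSet _ hc]; exact hy
  refine (Code.ofHom_opOf (F ≫ wPush L g) h hy').symm.trans ?_
  refine (WOp.full_push_of_mem g (opOf F h) hy').trans ?_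
  rw [Inn_eq_innerSet (treeHom F) hc]
  refine iSup_congr fun x => iSup_congr fun hx => ?_
  rw [Code.ofHom_opOf F h (by rw [Inn_eq_innerSet _ hc]; exact hx)]
  rfl

end Dendroidal

namespace Dendroidal

/-! ### Strings of maps in terms of codes -/

variable {S S' T T' : PTree} {n : SimplexCategory}

theorem mem_region_cases {f : S ⟶ T} {x : Edge T} (hx : x ∈ region f)
    (hx' : x ∉ innerRegion f) : ∃ s, (s = .root S ∨ s ∈ leaves S) ∧ x = f.edge s := by
  rcases (mem_region_iff f).1 hx with h | h | ⟨l, hl, h⟩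
  · exact absurd h hx'
  · exact ⟨_, .inl rfl, h⟩
  · exact ⟨l, .inr hl, h⟩

theorem not_mem_innerRegion {f : S ⟶ T} {s : Edge S} (hs : s = .root S ∨ s ∈ leaves S) :
    f.edge s ∉ innerRegion f := by
  rintro ⟨-, h2, h3⟩
  rcases hs with rfl | hs
  · exact h2 rfl
  · exact h3 s hs (.rfl' _)

/-- If an inner edge of the smaller region were above the image of a leaf `l` of `S`, then `l` would
be comparable with the image of the root of `S'`, hence above it, hence above the image of a leaf of
`S'`. This contradicts innerness. -/
theorem innerRegion_comp_subset (g : S' ⟶ S) (f : S ⟶ T) :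
    innerRegion (g ≫ f) ⊆ innerRegion f := by
  rintro x ⟨h1, h2, h3⟩
  have h0 : Above (f.edge (g.edge (.root S'))) (f.edge (.root S)) := hom_above f (.root _)
  refine ⟨h1.trans h0, ?_, fun l hl h => ?_⟩
  · rintro rfl
    exact h2 (h1.antisymm h0)
  · have hl' : Above l (g.edge (.root S')) := by
      have : Above l (g.edge (.root S')) ∨ Above (g.edge (.root S')) l := by
        rcases h.total h1 with h' | h'
        · exact hom_comparable f h'
        · exact (hom_comparable f h').symm
      rcases this with h' | h'
      · exact h'
      · rw [eq_of_above_leaf hl h']; exact .rfl' _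
    obtain ⟨y, hy, hly⟩ := (g.broad (leaves_broad S')).cover_leaf l hl hl'
    obtain ⟨l', hl', rfl⟩ := Multiset.mem_map.1 hy
    exact h3 l' hl' (h.trans (hom_above f hly))

theorem mem_region_comp_face {v : S' ⟶ S} {j : S ⟶ T} (hj : IsFace j) {z : Edge S} :
    j.edge z ∈ region (v ≫ j) ↔ z ∈ region v := by
  simp only [region, comp_edge, Set.mem_ofPred_eq, hj.above_iff]
  exact and_congr_right fun _ => forall₂_congr fun l _ => imp_congr_right fun _ => hj.eq_iff

namespace NWString

/-- The face of `T` given by a tree of the string. -/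
def face (x : NWString n S T) (i : Fin (n.len + 1)) : x.J.obj i ⟶ T :=
  x.J.map (homOfLE (Fin.le_last i)) ≫ x.last

/-- The tall map from `S` to a tree of the string. -/
def tall (x : NWString n S T) (i : Fin (n.len + 1)) : S ⟶ x.J.obj i :=
  x.fst ≫ x.J.map (homOfLE (Fin.zero_le i))

/-- The composite of the string. -/
def toHom (x : NWString n S T) : S ⟶ T := x.fst ≫ x.face 0

theorem isFace_face (x : NWString n S T) (i) : IsFace (x.face i) :=
  (x.inner_map _).1.1.comp x.face_last.1

theorem isPlanar_face (x : NWString n S T) (i) : IsPlanar (x.face i) :=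
  (x.inner_map _).2.comp x.face_last.2

theorem isTall_tall (x : NWString n S T) (i) : IsTall (x.tall i) :=
  x.tall_fst.comp (x.inner_map _).1.2

theorem map_face (x : NWString n S T) {i k : Fin (n.len + 1)} (h : i ⟶ k) :
    x.J.map h ≫ x.face k = x.face i := by
  rw [face, ← Category.assoc, ← x.J.map_comp]
  rfl

theorem face_last_eq (x : NWString n S T) : x.face (Fin.last n.len) = x.last := by
  have : x.J.map (homOfLE (Fin.le_last (Fin.last n.len))) = 𝟙 _ := x.J.map_id _
  rw [face, this, Category.id_comp]

theorem tall_face (x : NWString n S T) (i) : x.tall i ≫ x.face i = x.toHom := by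
  rw [tall, Category.assoc, map_face, toHom]

theorem leaves_face (x : NWString n S T) (i) :
    (leaves S).map x.toHom.edge = (leaves (x.J.obj i)).map (x.face i).edge := by
  rw [← x.tall_face i]
  exact (x.isTall_tall i).leaves_comp _

theorem root_face (x : NWString n S T) (i) :
    x.toHom.edge (.root S) = (x.face i).edge (.root _) := by
  rw [← x.tall_face i]
  exact (x.isTall_tall i).root_comp _

/-- All maps from `S` to the `Jᵢ` are tall, so every `Jᵢ` spans the same region of `T` as the
composite. -/
theorem region_face (x : NWString n S T) (i) : region x.toHom = region (x.face i) :=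
  region_eq (x.leaves_face i) (x.root_face i)

theorem toHom_mem_range (x : NWString n S T) (i) (s : Edge S) :
    x.toHom.edge s ∈ Set.range (x.face i).edge := ⟨(x.tall i).edge s, by
  rw [← comp_edge, tall_face]⟩

theorem face_mem_region (x : NWString n S T) {i} {y : Edge T}
    (h : y ∈ Set.range (x.face i).edge) : y ∈ region x.toHom := by
  obtain ⟨z, rfl⟩ := h
  rw [x.region_face i]
  exact edge_mem_region _ z

theorem range_face_mono (x : NWString n S T) {i k : Fin (n.len + 1)} (h : i ≤ k) {y : Edge T}
    (hy : y ∈ Set.range (x.face i).edge) : y ∈ Set.range (x.face k).edge := by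
  obtain ⟨z, rfl⟩ := hy
  exact ⟨(x.J.map (homOfLE h)).edge z, by rw [← comp_edge, map_face]⟩

/-- An inner edge has length `1` at `i` iff it is an edge of `Jᵢ`. -/
def toCode (x : NWString n S T) : Code (Len n) S T where
  hom := x.toHom
  -- The second alternative implements the default length `1` off the inner edges. Monotonicity in
  -- `i` is the inclusion of the edges of `Jᵢ` in those of the later trees.
  len y := ⟨fun i => y ∈ Set.range (x.face i).edge ∨ y ∉ innerRegion x.toHom,
    fun _ _ h => Or.imp_left (x.range_face_mono h)⟩
  len_off y hy := by
    ext i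
    exact ⟨fun _ => trivial, fun _ => .inr hy⟩
  len_edge s := by
    ext i
    exact ⟨fun _ => trivial, fun _ => .inl (x.toHom_mem_range i s)⟩

theorem toCode_hom (x : NWString n S T) : x.toCode.hom = x.toHom := rfl

theorem toCode_len {x : NWString n S T} {y : Edge T} (hy : y ∈ innerRegion x.toHom) {i} :
    x.toCode.len y i ↔ y ∈ Set.range (x.face i).edge :=
  ⟨fun h => h.resolve_right fun h' => h' hy, .inl⟩

theorem mem_range_face_of_not_inner (x : NWString n S T) {i} {y : Edge T}
    (hy : y ∈ region x.toHom) (hy' : y ∉ innerRegion x.toHom) :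
    y ∈ Set.range (x.face i).edge := by
  obtain ⟨s, -, rfl⟩ := mem_region_cases hy hy'
  exact x.toHom_mem_range i s

/-- Edges of the region that are not inner are images of edges of `S` and so belong to every `Jᵢ`;
the edges of `Jᵢ` can therefore be read off from the code. -/
theorem mem_range_face_iff (x : NWString n S T) {i} {y : Edge T} :
    y ∈ Set.range (x.face i).edge ↔ y ∈ region x.toHom ∧ x.toCode.len y i :=
  ⟨fun h => ⟨x.face_mem_region h, .inl h⟩,
    fun h => h.2.elim id (x.mem_range_face_of_not_inner h.1)⟩

/-- The code determines the edges of each `Jᵢ`, and its leaves are those of the composite; a planar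
face is determined by these data. The maps of the string are then forced because faces are
monomorphisms. -/
theorem toCode_injective : Function.Injective (toCode (n := n) (S := S) (T := T)) := by
  intro x y h
  have h1 : x.toHom = y.toHom := congrArg Code.hom h
  have h2 : ∀ i, ∃ e : x.J.obj i = y.J.obj i, eqToHom e ≫ y.face i = x.face i := by
    intro i
    refine planarFace_unique (x.isFace_face i) (x.isPlanar_face i) (y.isFace_face i)
      (y.isPlanar_face i) ?_ ?_
    · ext z
      rw [mem_range_face_iff, mem_range_face_iff, h1, h]
    · rw [← leaves_face, ← leaves_face, h1]
  choose e he using h2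
  have hJ : x.J = y.J := by
    refine CategoryTheory.Functor.ext e fun i k f => (x.isFace_face k).mono ?_
    rw [map_face, Category.assoc, Category.assoc, ← he k, eqToHom_trans_assoc, eqToHom_refl,
      Category.id_comp, map_face, he]
  obtain ⟨J, fst, last, _, _, _⟩ := x
  obtain ⟨J', fst', last', _, _, _⟩ := y
  obtain rfl : J = J' := hJ
  have h3 : last = last' := by
    have := he (Fin.last _)
    rw [face_last_eq, face_last_eq, eqToHom_refl, Category.id_comp] at this
    exact this.symm
  subst h3
  have h4 : fst = fst' := (isFace_face ⟨J, fst, last, ‹_›, ‹_›, ‹_›⟩ 0).mono h1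
  subst h4
  rfl

/-- Take for `Jᵢ` the planar face on the edges of the region having length `1` at `i`. Edges from
`S` have length `1`, so `S` maps to each `Jᵢ`; monotonicity of lengths gives the maps between the
`Jᵢ`. -/
theorem toCode_surjective : Function.Surjective (toCode (n := n) (S := S) (T := T)) := by
  intro a
  have hedge : ∀ i s, a.hom.edge s ∈ {y | y ∈ region a.hom ∧ a.len y i} := fun i s =>
    ⟨edge_mem_region _ s, by rw [a.len_edge]; trivial⟩
  choose J j hf hp hr hl h0 using fun i : Fin (n.len + 1) => exists_planarFace_region a.hom
    {y | y ∈ region a.hom ∧ a.len y i} (hedge i _) (fun l _ => hedge i l) (fun y hy => hy.1)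
  have hk : ∀ i, ∃ k : S ⟶ J i, k ≫ j i = a.hom ∧ IsTall k := fun i =>
    exists_tall_lift (hf i) a.hom (fun s => hr i ▸ hedge i s) (hl i) (h0 i)
  choose k hk hkt using hk
  have hm : ∀ {i i' : Fin (n.len + 1)} (_ : i ⟶ i'),
      ∃ u : J i ⟶ J i', u ≫ j i' = j i ∧ IsTall u := fun {i i'} h =>
    exists_tall_lift (hf i') (j i) (fun s => by
      have : (j i).edge s ∈ Set.range (j i).edge := ⟨s, rfl⟩
      rw [hr i] at this
      rw [hr i']
      exact ⟨this.1, (a.len _).monotone (leOfHom h) this.2⟩) ((hl i).symm.trans (hl i'))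
      ((h0 i).symm.trans (h0 i'))
  choose u hu hut using @hm
  let x : NWString n S T :=
    { J :=
        { obj := J
          map := fun h => u h
          map_id := fun i => (hf i).mono (by rw [hu, Category.id_comp])
          map_comp := fun f g => (hf _).mono (by rw [hu, Category.assoc, hu, hu]) }
      fst := k 0
      last := j (Fin.last _)
      tall_fst := hkt 0
      inner := fun i => by
        have hc := hu (homOfLE i.castSucc_le_succ)
        refine ⟨⟨fun s t hst => hf i.castSucc ?_, hut _⟩, fun s t hst => ?_⟩
        · rw [← hc, comp_edge, comp_edge]
          exact congrArg _ hst
        · rw [← (hf i.succ).planar_iff (hp i.succ)]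
          show PlanarLE ((u (homOfLE i.castSucc_le_succ) ≫ j i.succ).edge s)
            ((u (homOfLE i.castSucc_le_succ) ≫ j i.succ).edge t)
          rw [hc]
          exact hp _ _ _ hst
      face_last := ⟨hf _, hp _⟩ }
  have hx : ∀ i, x.face i = j i := fun i => hu _
  have hx' : x.toHom = a.hom := by rw [toHom, hx]; exact hk 0
  refine ⟨x, Code.ext_inner hx' fun y hy => ?_⟩
  ext i
  rw [toCode_hom] at hy
  rw [toCode_len hy, hx, hr]
  rw [hx'] at hy
  exact ⟨fun h => h.2, fun h => ⟨innerRegion_subset _ hy, h⟩⟩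

/-- Strings of maps are the same as codes with lengths in `Δ[1]`. -/
noncomputable def equivCode : NWString n S T ≃ Code (Len n) S T :=
  Equiv.ofBijective toCode ⟨toCode_injective, toCode_surjective⟩

theorem toCode_simp_op {m : SimplexCategory} (θ : m ⟶ n) (x : NWString n S T) :
    (x.simp_op θ).toCode.hom = x.toCode.hom ∧
      ∀ y ∈ innerRegion x.toHom, (x.simp_op θ).toCode.len y = lenMap θ (x.toCode.len y) := by
  have hf : ∀ i, (x.simp_op θ).face i = x.face (θ.toOrderHom i) := by
    intro i
    show x.J.map _ ≫ x.J.map _ ≫ x.last = _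
    rw [← Category.assoc, ← x.J.map_comp]
    rfl
  have hh : (x.simp_op θ).toHom = x.toHom := by
    rw [toHom, hf]
    exact x.tall_face _
  refine ⟨hh, fun y hy => ?_⟩
  ext i
  rw [toCode_len (hh ▸ hy), hf]
  exact (toCode_len hy).symm

/-! ### Ladders of strings in terms of codes -/

/-- Both sides say that the edges of `J'ᵢ` are the edges of `Jᵢ` in the region spanned by the
restricted map: a face is outer exactly when it misses no edge of the region it spans. -/
theorem restrictLadder_iff (f : S' ⟶ S) (x' : NWString n S' T) (x : NWString n S T) :
    RestrictLadder f x' x ↔ x'.toHom = f ≫ x.toHom ∧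
      ∀ y ∈ innerRegion (f ≫ x.toHom), x'.toCode.len y = x.toCode.len y := by
  constructor
  · rintro ⟨v, hv, h0, h1⟩
    have hface : ∀ i, v.app i ≫ x.face i = x'.face i := by
      intro i
      rw [face, ← v.naturality_assoc, h1]
      rfl
    have hh : x'.toHom = f ≫ x.toHom := by
      rw [toHom, ← hface, ← Category.assoc, h0, Category.assoc, toHom]
    refine ⟨hh, fun y hy => ?_⟩
    ext i
    rw [toCode_len (innerRegion_comp_subset _ _ hy), toCode_len (hh ▸ hy)]
    constructor
    · rintro ⟨z, rfl⟩
      exact ⟨(v.app i).edge z, by rw [← comp_edge, hface]⟩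
    · rintro ⟨z, rfl⟩
      have hz : z ∈ region (v.app i) := by
        rw [← mem_region_comp_face (x.isFace_face i), hface, ← region_face, hh]
        exact innerRegion_subset _ hy
      obtain ⟨w, rfl⟩ := (isOuterFace_iff.1 (hv i)).2 hz
      exact ⟨w, by rw [← hface]; rfl⟩
  · rintro ⟨hh, hlen⟩
    have hr : ∀ i, ∀ y ∈ region x'.toHom,
        (y ∈ Set.range (x'.face i).edge ↔ y ∈ Set.range (x.face i).edge) := by
      intro i y hy
      by_cases hy' : y ∈ innerRegion x'.toHom
      · have hy2 : y ∈ innerRegion (f ≫ x.toHom) := hh ▸ hy'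
        rw [← toCode_len hy', ← toCode_len (innerRegion_comp_subset _ _ hy2), hlen y hy2]
      · obtain ⟨s, -, rfl⟩ := mem_region_cases hy hy'
        refine ⟨fun _ => ?_, fun _ => x'.toHom_mem_range i s⟩
        rw [hh]
        exact x.toHom_mem_range i _
    have hv : ∀ i, ∃ v : x'.J.obj i ⟶ x.J.obj i, v ≫ x.face i = x'.face i := by
      intro i
      refine exists_lift (x.isFace_face i) (x'.face i) (fun z => ?_) fun k hk => ?_
      · exact (hr i _ (x'.face_mem_region ⟨z, rfl⟩)).1 ⟨z, rfl⟩
      -- The lift is not tall in general, as `f` need not be. Its values on the leaves and the root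
      -- are those of `f` followed by the tall map to `Jᵢ`, which provides the required relation.
      · have h1 : (leaves _).map k = (leaves S').map (f ≫ x.tall i).edge := by
          refine Multiset.map_injective (x.isFace_face i) ?_
          have e1 : (x.face i).edge ∘ k = (x'.face i).edge := funext hk
          have e2 : (x.face i).edge ∘ (f ≫ x.tall i).edge = x'.toHom.edge := by
            rw [hh, ← x.tall_face i]; rfl
          rw [Multiset.map_map, Multiset.map_map, e1, e2, x'.leaves_face i]
        have h2 : k (.root _) = (f ≫ x.tall i).edge (.root S') := by
          refine x.isFace_face i ?_
          rw [hk, ← x'.root_face i, hh, ← x.tall_face i]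
          rfl
        rw [h1, h2]
        exact (f ≫ x.tall i).broad (leaves_broad S')
    choose v hv using hv
    refine ⟨⟨v, fun i k h => (x.isFace_face k).mono ?_⟩, fun i => ?_, ?_, ?_⟩
    · rw [Category.assoc, hv, map_face, Category.assoc, map_face, hv]
    · rw [isOuterFace_iff]
      constructor
      · intro z w hzw
        refine x'.isFace_face i ?_
        rw [← hv, comp_edge, comp_edge]
        exact congrArg _ hzw
      · intro z hz
        have hz' : (x.face i).edge z ∈ region x'.toHom := by
          rw [x'.region_face i, ← hv, mem_region_comp_face (x.isFace_face i)]
          exact hz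
        obtain ⟨w, hw⟩ := (hr i _ hz').2 ⟨z, rfl⟩
        refine ⟨w, x.isFace_face i ?_⟩
        rw [← hw, ← hv]
        rfl
    · refine (x.isFace_face 0).mono ?_
      show (x'.fst ≫ v 0) ≫ x.face 0 = _
      rw [Category.assoc, hv, Category.assoc]
      exact hh
    · show v _ ≫ x.last = x'.last
      rw [← face_last_eq, ← face_last_eq, hv]

/-- The maximum of lengths in `Prop` is an existential, so the condition on lengths says that the
edges of `J'ᵢ` are the images of those of `Jᵢ`. This is the surjectivity of a degeneracy; the
preservation of leaves follows from tallness. -/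
theorem pushLadder_iff (g : T ⟶ T') (x : NWString n S T) (x' : NWString n S T') :
    PushLadder g x x' ↔ x'.toHom = x.toHom ≫ g ∧
      ∀ y ∈ innerRegion (x.toHom ≫ g), x'.toCode.len y =
        ⨆ z ∈ innerRegion x.toHom, ⨆ _ : g.edge z = y, x.toCode.len z := by
  have hsup : ∀ y i, (⨆ z ∈ innerRegion x.toHom, ⨆ _ : g.edge z = y, x.toCode.len z) i ↔
      ∃ z ∈ innerRegion x.toHom, g.edge z = y ∧ z ∈ Set.range (x.face i).edge := by
    intro y i
    simp only [OrderHom.iSup_apply, iSup_Prop_eq]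
    refine exists_congr fun z => ?_
    constructor
    · rintro ⟨h1, h2, h3⟩
      exact ⟨h1, h2, (toCode_len h1).1 h3⟩
    · rintro ⟨h1, h2, h3⟩
      exact ⟨h1, h2, (toCode_len h1).2 h3⟩
  -- An edge of `Jᵢ` that becomes inner was inner already, since the root and the leaves go to the
  -- root and the leaves.
  have hin : x'.toHom = x.toHom ≫ g → ∀ {z i}, z ∈ Set.range (x.face i).edge →
      g.edge z ∈ innerRegion x'.toHom → z ∈ innerRegion x.toHom := by
    intro hh z i hz hz'
    by_contra h
    obtain ⟨s, hs, rfl⟩ := mem_region_cases (x.face_mem_region hz) h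
    rw [hh] at hz'
    exact not_mem_innerRegion hs hz'
  constructor
  · rintro ⟨v, hv, h0, h1⟩
    have hface : ∀ i, v.app i ≫ x'.face i = x.face i ≫ g := by
      intro i
      rw [face, ← v.naturality_assoc, h1, face, Category.assoc]
    have hh : x'.toHom = x.toHom ≫ g := by
      rw [toHom, ← h0, Category.assoc, hface, toHom, Category.assoc]
    refine ⟨hh, fun y hy => ?_⟩
    ext i
    rw [← hh] at hy
    rw [hsup, toCode_len hy]
    constructor
    · rintro ⟨w, rfl⟩
      obtain ⟨w, rfl⟩ := (hv i).1 w
      rw [← comp_edge, hface] at hy ⊢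
      exact ⟨_, hin hh ⟨w, rfl⟩ hy, rfl, w, rfl⟩
    · rintro ⟨_, -, rfl, w, rfl⟩
      exact ⟨(v.app i).edge w, by rw [← comp_edge, hface]; rfl⟩
  · rintro ⟨hh, hlen⟩
    have hreg : ∀ i, region x'.toHom = region (x.face i ≫ g) := by
      intro i
      rw [hh, ← x.tall_face i, Category.assoc]
      exact region_eq ((x.isTall_tall i).leaves_comp _) ((x.isTall_tall i).root_comp _)
    have hr : ∀ i y, y ∈ Set.range (x'.face i).edge ↔
        ∃ z ∈ Set.range (x.face i).edge, g.edge z = y := by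
      intro i y
      by_cases hy : y ∈ innerRegion x'.toHom
      · rw [← toCode_len hy, hlen y (hh ▸ hy), hsup]
        constructor
        · rintro ⟨z, -, h2, h3⟩
          exact ⟨z, h3, h2⟩
        · rintro ⟨z, h3, rfl⟩
          exact ⟨z, hin hh h3 hy, rfl, h3⟩
      · constructor
        · intro h
          obtain ⟨s, -, rfl⟩ := mem_region_cases (x'.face_mem_region h) hy
          exact ⟨_, x.toHom_mem_range i s, by rw [hh]; rfl⟩
        · rintro ⟨_, ⟨w, rfl⟩, rfl⟩
          refine x'.mem_range_face_of_not_inner ?_ hy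
          rw [hreg i]
          exact edge_mem_region (x.face i ≫ g) w
    have hv : ∀ i, ∃ v : x.J.obj i ⟶ x'.J.obj i, v ≫ x'.face i = x.face i ≫ g ∧ IsTall v := by
      intro i
      refine exists_tall_lift (x'.isFace_face i) _ (fun w => ?_) ?_ ?_
      · exact (hr i _).2 ⟨_, ⟨w, rfl⟩, rfl⟩
      · rw [← x'.leaves_face i, hh, ← x.tall_face i, Category.assoc]
        exact ((x.isTall_tall i).leaves_comp _).symm
      · rw [← x'.root_face i, hh, ← x.tall_face i, Category.assoc]
        exact ((x.isTall_tall i).root_comp _).symm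
    choose v hv hvt using hv
    refine ⟨⟨v, fun i k h => (x'.isFace_face k).mono ?_⟩, fun i => ⟨fun w => ?_, fun l hl => ?_⟩,
      ?_, ?_⟩
    · rw [Category.assoc, hv, ← Category.assoc, map_face, Category.assoc, map_face, hv]
    · obtain ⟨_, ⟨z, rfl⟩, h⟩ := (hr i _).1 ⟨w, rfl⟩
      refine ⟨z, x'.isFace_face i ?_⟩
      rw [← h]
      exact congrArg (fun k => k.edge z) (hv i)
    · show (v i).edge l ∈ _
      rw [← (hvt i).1]
      exact Multiset.mem_map_of_mem _ hl
    · refine (x'.isFace_face 0).mono ?_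
      show (x.fst ≫ v 0) ≫ x'.face 0 = x'.toHom
      rw [Category.assoc, hv, hh, toHom, Category.assoc]
    · show v _ ≫ x'.last = x.last ≫ g
      rw [← face_last_eq, ← face_last_eq, hv]

end NWString

end Dendroidal

namespace Dendroidal

/-! ### The Segal condition -/

variable {S T U C C' : PTree} {L L' : Type} [CompleteLattice L] [CompleteLattice L']

/-- Planar outer faces without inner edges. -/
def IsCoreFace (u : C ⟶ U) : Prop :=
  IsOuterFace u ∧ IsPlanar u ∧ ∀ e : Edge C, e = .root C ∨ e ∈ leaves C

theorem stick_edge (e : Edge .stick) : e = .root _ := by cases e; rfl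

/-- The inclusion of an edge. -/
def stickMap (e : Edge U) : PTree.stick ⟶ U where
  edge _ := e
  broad := broad_map_of_order (fun _ => e) (fun _ _ _ => .rfl' e)
    (fun x y _ => by rw [stick_edge x, stick_edge y]; exact .inl (.root _))
    (show Broad ((leaves .stick).map fun _ => e) e from .refl e)

theorem stickMap_isCoreFace (e : Edge U) : IsCoreFace (stickMap e) := by
  refine ⟨isOuterFace_iff.2 ⟨fun x y _ => by rw [stick_edge x, stick_edge y], fun x hx => ?_⟩,
    fun x y _ => (PlanarLE.total e e).elim id id, fun e => .inl (stick_edge e)⟩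
  exact ⟨.root _, (hx.2 _ (Multiset.mem_singleton_self _) hx.1).symm⟩

/-- The planar face on `e` and its inputs. It is outer because every edge above `e` is `e` itself or
lies above an input. -/
theorem Vertex.exists_corolla {m : Multiset (Edge U)} {e : Edge U} (h : Vertex m e) :
    ∃ (C : PTree) (u : C ⟶ U), IsCoreFace u ∧ (leaves C).map u.edge = m ∧
      u.edge (.root C) = e := by
  have hb : Broad m e := .vertex h
  have he := h.not_mem
  obtain ⟨C, u, hu, hp, hr, hl, h0⟩ := exists_planarFace (insert e {x | x ∈ m}) m hb
    (fun x hx => .inr hx) (.inl rfl) (by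
      rintro x (rfl | hx)
      · exact .rfl' _
      · exact hb.above x hx) (by
      rintro x (rfl | hx) y hy hxy
      · rw [hxy.antisymm (hb.above y hy)]
      · exact hb.antichain.2 x hx y hy hxy)
  have hlr : ∀ x ∈ m, ∃ l ∈ leaves C, u.edge l = x := fun x hx => by
    rw [← hl] at hx
    exact Multiset.mem_map.1 hx
  refine ⟨C, u, ⟨isOuterFace_iff.2 ⟨hu, fun x hx => ?_⟩, hp, fun s => ?_⟩, hl, h0⟩
  · have hx1 := hx.1
    rw [h0] at hx1
    rcases h.cover x hx1 with rfl | ⟨y, hy, hxy⟩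
    · exact ⟨_, h0⟩
    · obtain ⟨l, hl', rfl⟩ := hlr y hy
      exact ⟨l, (hx.2 l hl' hxy).symm⟩
  · have : u.edge s ∈ Set.range u.edge := ⟨s, rfl⟩
    rw [hr] at this
    rcases this with h' | h'
    · exact .inl (hu (h'.trans h0.symm))
    · obtain ⟨l, hl', h''⟩ := hlr _ h'
      exact .inr (hu h'' ▸ hl')

/-- Otherwise `x` would be inner in the spanned region, hence an edge of `C` as the face is outer,
while `C` has only a root and leaves. -/
theorem IsCoreFace.cases_above {u : C ⟶ U} (hu : IsCoreFace u) {x : Edge U}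
    (hx : Above x (u.edge (.root C))) :
    x = u.edge (.root C) ∨ ∃ l ∈ leaves C, Above x (u.edge l) := by
  by_contra! h
  have hx' : x ∈ innerRegion u := ⟨hx, h.1, h.2⟩
  obtain ⟨s, rfl⟩ := (isOuterFace_iff.1 hu.1).2 (innerRegion_subset u hx')
  exact not_mem_innerRegion (hu.2.2 s) hx'

/-- Among the edges of `U` above the root of the vertex, only that root has its image below an inner
edge `x` over the vertex: any other lies above an input, and then so would `x`. -/
theorem IsCoreFace.root_eq {u : C ⟶ U} (hu : IsCoreFace u) {f : U ⟶ T} {x : Edge T}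
    (hx : x ∈ innerRegion (u ≫ f)) {e : Edge U} (he : Above x (f.edge e))
    (h : Above e (u.edge (.root C))) : e = u.edge (.root C) := by
  rcases hu.cases_above h with h | ⟨l, hl, h⟩
  · exact h
  · exact absurd (he.trans (hom_above f h)) (hx.2.2 l hl)

/-- The alternative is that `l` goes to the common root; then `x` would lie above the image of the
leaf `l`, although it is inner. -/
theorem IsCoreFace.leaf_above {u : C ⟶ U} {u' : C' ⟶ U} (hu' : IsCoreFace u')
    {f : U ⟶ T} {x : Edge T} (hx : x ∈ innerRegion (u ≫ f))
    (h : u.edge (.root C) = u'.edge (.root C')) {l : Edge C} (hl : l ∈ leaves C) :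
    ∃ l' ∈ leaves C', Above (u.edge l) (u'.edge l') := by
  refine (hu'.cases_above (h ▸ hom_above u (.root l))).resolve_left fun h' => ?_
  refine hx.2.2 l hl ?_
  rw [comp_edge, h', ← h]
  exact hx.1

/-- The inner edges lying over distinct vertices are distinct. -/
theorem IsCoreFace.unique {u : C ⟶ U} {u' : C' ⟶ U} (hu : IsCoreFace u)
    (hu' : IsCoreFace u') {f : U ⟶ T} {x : Edge T} (hx : x ∈ innerRegion (u ≫ f))
    (hx' : x ∈ innerRegion (u' ≫ f)) : ∃ h : C = C', eqToHom h ≫ u' = u := by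
  have h0 : u.edge (.root C) = u'.edge (.root C') := by
    have : Above (u.edge (.root C)) (u'.edge (.root C')) ∨
        Above (u'.edge (.root C')) (u.edge (.root C)) := by
      rcases hx.1.total hx'.1 with h | h
      · exact hom_comparable f h
      · exact (hom_comparable f h).symm
    rcases this with h | h
    · exact hu'.root_eq hx' hx.1 h
    · exact (hu.root_eq hx hx'.1 h).symm
  -- Each leaf of one face lies above a leaf of the other, which lies above a leaf of the first; in
  -- an antichain the two outer ones agree, so all three do.
  have key : ∀ {C C' : PTree} {u : C ⟶ U} {u' : C' ⟶ U} (_ : IsCoreFace u)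
      (_ : IsCoreFace u') (_ : x ∈ innerRegion (u ≫ f)) (_ : x ∈ innerRegion (u' ≫ f))
      (_ : u.edge (.root C) = u'.edge (.root C')), ∀ y ∈ (leaves C).map u.edge,
      y ∈ (leaves C').map u'.edge := by
    intro C C' u u' hu hu' hx hx' h0 y hy
    obtain ⟨l, hl, rfl⟩ := Multiset.mem_map.1 hy
    obtain ⟨l', hl', h1⟩ := hu'.leaf_above hx h0 hl
    obtain ⟨l'', hl'', h2⟩ := hu.leaf_above hx' h0.symm hl'
    have := (u.broad (leaves_broad C)).antichain.2 _ hy _ (Multiset.mem_map_of_mem _ hl'')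
      (h1.trans h2)
    rw [← this] at h2
    rw [h1.antisymm h2]
    exact Multiset.mem_map_of_mem _ hl'
  have hl : (leaves C).map u.edge = (leaves C').map u'.edge :=
    (Multiset.Nodup.ext (u.broad (leaves_broad C)).antichain.1
      (u'.broad (leaves_broad C')).antichain.1).2 fun y =>
      ⟨key hu hu' hx hx' h0 y, key hu' hu hx' hx h0.symm y⟩
  have hr : ∀ {C : PTree} {u : C ⟶ U} (_ : IsCoreFace u), Set.range u.edge = region u :=
    fun {C u} hu => Set.Subset.antisymm (by rintro _ ⟨s, rfl⟩; exact edge_mem_region u s)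
      (isOuterFace_iff.1 hu.1).2
  exact planarFace_unique hu.1.1 hu.2.1 hu'.1.1 hu'.2.1
    (by rw [hr hu, hr hu', region_eq hl h0]) hl

/-- Climb from the root as long as some input satisfies `P`. -/
theorem exists_highest : ∀ (U : PTree) (P : Edge U → Prop), P (.root U) →
    ∃ e, P e ∧ (e ∈ leaves U ∨ ∃ m, Vertex m e ∧ ∀ c ∈ m, ¬ P c) := by
  intro U
  induction U with
  | stick => exact fun P h => ⟨_, h, .inl (Multiset.mem_singleton_self _)⟩
  | node n t ih =>
    intro P h
    by_cases hP : ∃ i : Fin n, P (.sub i (.root _))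
    · obtain ⟨i, hi⟩ := hP
      obtain ⟨e, he, h' | ⟨m, hm, h'⟩⟩ := ih i (fun e => P (.sub i e)) hi
      · exact ⟨_, he, .inl (sub_mem_leaves.2 h')⟩
      · refine ⟨_, he, .inr ⟨_, .sub i hm, fun c hc => ?_⟩⟩
        obtain ⟨c, hc', rfl⟩ := Multiset.mem_map.1 hc
        exact h' c hc'
    · refine ⟨_, h, .inr ⟨_, .root n t, fun c hc hc' => hP ?_⟩⟩
      obtain ⟨i, -, rfl⟩ := Multiset.mem_map.1 hc
      exact ⟨i, hc'⟩

/-- Maps out of `Ω(U)` are determined by their restrictions to the edges and vertices of `U`. -/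
theorem hom_ext_core {F G : omegaOperad U ⟶ wOperad T L}
    (h : ∀ (C : PTree) (u : C ⟶ U), IsCoreFace u → omegaMap u ≫ F = omegaMap u ≫ G) :
    F = G := by
  apply codeEquiv.injective
  have h0 : (codeEquiv F).hom = (codeEquiv G).hom := hom_ext fun e =>
    congrArg (fun H => (codeEquiv H).hom.edge (.root _)) (h _ _ (stickMap_isCoreFace e))
  refine Code.ext_inner h0 fun x hx => ?_
  -- Take a highest edge `e` of `U` whose image is below `x`. It is not a leaf since `x` is inner.
  -- Then `x` is either the image of `e`, of length `1`, or an inner edge over the vertex at `e`.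
  obtain ⟨e, he, hl | ⟨m, hm, hc⟩⟩ :=
    exists_highest U (fun e => Above x ((codeEquiv F).hom.edge e)) hx.1
  · exact absurd he (hx.2.2 e hl)
  · by_cases hxe : x = (codeEquiv F).hom.edge e
    · rw [hxe, (codeEquiv F).len_edge, h0, (codeEquiv G).len_edge]
    · obtain ⟨C, u, hu, hul, hur⟩ := hm.exists_corolla
      have hxu : x ∈ innerRegion (u ≫ (codeEquiv F).hom) := by
        refine ⟨?_, ?_, fun l hl => ?_⟩
        · rw [comp_edge, hur]; exact he
        · rw [comp_edge, hur]; exact hxe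
        · exact hc _ (hul ▸ Multiset.mem_map_of_mem _ hl)
      rw [← codeEquiv_comp_len u F hxu, h C u hu, codeEquiv_comp_len u G (h0 ▸ hxu)]

/-- A family of maps out of the operads of the edges and vertices of `U` which is compatible on
edges comes from a map out of `Ω(U)`. -/
theorem exists_hom_of_core (β : ∀ {C : PTree} (u : C ⟶ U), IsCoreFace u →
    (omegaOperad C ⟶ wOperad T L))
    (hβ : ∀ {C : PTree} (u : C ⟶ U) (hu : IsCoreFace u) (s : Edge C),
      β (stickMap (u.edge s)) (stickMap_isCoreFace _) = omegaMap (stickMap s) ≫ β u hu) :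
    ∃ F : omegaOperad U ⟶ wOperad T L, ∀ {C : PTree} (u : C ⟶ U) (hu : IsCoreFace u),
      omegaMap u ≫ F = β u hu := by
  -- The edge map is read off on the sticks; compatibility makes it agree with the given maps on
  -- vertices.
  let φ : Edge U → Edge T := fun e =>
    (codeEquiv (β (stickMap e) (stickMap_isCoreFace e))).hom.edge (.root _)
  have hφ : ∀ {C : PTree} (u : C ⟶ U) (hu : IsCoreFace u) (s : Edge C),
      φ (u.edge s) = (codeEquiv (β u hu)).hom.edge s := fun u hu s =>
    congrArg (fun H => (codeEquiv H).hom.edge (.root _)) (hβ u hu s)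
  let f : U ⟶ T :=
    { edge := φ
      broad := fun {m e} h => by
        induction h with
        | refl e => exact .refl _
        | vertex h =>
          obtain ⟨C, u, hu, rfl, rfl⟩ := h.exists_corolla
          rw [Multiset.map_map, hφ u hu]
          have : φ ∘ u.edge = (codeEquiv (β u hu)).hom.edge := funext (hφ u hu)
          rw [this]
          exact (codeEquiv (β u hu)).hom.broad (leaves_broad C)
        | @trans n c e m _ _ ih ih' =>
          rw [Multiset.map_map] at ih
          have := Broad.trans ih ih'
          rwa [← Multiset.coe_mapAddMonoidHom, ← map_sum] at this }
  have hf : ∀ {C : PTree} (u : C ⟶ U) (hu : IsCoreFace u),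
      (codeEquiv (β u hu)).hom = u ≫ f := fun u hu => hom_ext fun s => (hφ u hu s).symm
  let a : Code L U T :=
    { hom := f
      -- By `IsCoreFace.unique` at most one term differs from `⊤`, so the infimum glues the lengths,
      -- with default value `1`.
      len := fun x => ⨅ p : {p : Σ C, C ⟶ U // IsCoreFace p.2}, (codeEquiv (β p.1.2 p.2)).len x
      len_off := fun x hx => iInf_eq_top.2 fun p => (codeEquiv (β p.1.2 p.2)).len_off x fun h =>
        hx (innerRegion_comp_subset p.1.2 f (hf p.1.2 p.2 ▸ h))
      -- The image of an edge `s` of `U` is not inner over any vertex: `s` would have to lie above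
      -- the root of the vertex and hence be that root.
      len_edge := fun s => iInf_eq_top.2 fun p => (codeEquiv (β p.1.2 p.2)).len_off _ fun h => by
        rw [hf] at h
        have : Above s (p.1.2.edge (.root _)) := by
          rcases hom_comparable f h.1 with h' | h'
          · exact h'
          · exact absurd (h.1.antisymm (hom_above f h')) h.2.1
        exact h.2.1 (congrArg f.edge (p.2.root_eq h (.rfl' _) this)) }
  refine ⟨codeEquiv.symm a, fun {C} u hu => codeEquiv.injective ?_⟩
  have h1 : (codeEquiv (omegaMap u ≫ codeEquiv.symm a)).hom = u ≫ f := by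
    rw [codeEquiv_comp_hom, Equiv.apply_symm_apply]
  refine Code.ext_inner (h1.trans (hf u hu).symm) fun x hx => ?_
  rw [codeEquiv_comp_len _ _ hx, Equiv.apply_symm_apply]
  rw [h1] at hx
  refine le_antisymm (iInf_le
    (fun p : {p : Σ C, C ⟶ U // IsCoreFace p.2} => (codeEquiv (β p.1.2 p.2)).len x) ⟨⟨C, u⟩, hu⟩)
    (le_iInf fun p => ?_)
  obtain ⟨⟨C', u'⟩, hu'⟩ := p
  by_cases hx' : x ∈ innerRegion (u' ≫ f)
  · obtain ⟨e, h⟩ : ∃ h : C = C', eqToHom h ≫ u' = u := hu.unique hu' hx hx'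
    subst e
    obtain rfl : u' = u := by rw [← h, eqToHom_refl, Category.id_comp]
    exact le_rfl
  · rw [(codeEquiv (β u' hu')).len_off x (by rwa [hf])]
    exact le_top

theorem IsCoreFace.mem_segalCore {u : C ⟶ U} (hu : IsCoreFace u) :
    u ∈ (segalCore U).obj (op C) := ⟨C, u, 𝟙 C, hu.1, hu.2.1, hu.2.2, Category.id_comp u⟩

/-- By Yoneda, maps out of the representable are operad maps out of `Ω(U)`, while a map out of the
core amounts to a family on the core faces. Naturality along the inclusions of single edges is all
the compatibility that gluing requires. -/
theorem operadNerve_wOperad_strictSegal (T : PTree) (L : Type) [CompleteLattice L] :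
    StrictSegal (operadNerve.obj (wOperad T L)) := by
  intro U
  constructor
  · intro g g' h
    apply yonedaEquiv.injective
    refine hom_ext_core fun C u hu => ?_
    have h1 : ∀ g : yoneda.obj U ⟶ operadNerve.obj (wOperad T L),
        omegaMap u ≫ yonedaEquiv g = g.app (op C) u := fun g => by
      have := yonedaEquiv_naturality g u
      exact this.trans (by rw [yonedaEquiv_apply]; simp)
    rw [h1, h1]
    exact congrArg (fun k => k.app (op C) ⟨u, hu.mem_segalCore⟩) h
  · intro α
    have nat : ∀ {S S' : PTree} (k : S' ⟶ S) (ψ : S ⟶ U) (hψ : ψ ∈ (segalCore U).obj (op S))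
        (hψ' : k ≫ ψ ∈ (segalCore U).obj (op S')),
        α.app (op S') ⟨k ≫ ψ, hψ'⟩ = omegaMap k ≫ α.app (op S) ⟨ψ, hψ⟩ := fun k ψ hψ _ =>
      congrArg (fun F => F ⟨ψ, hψ⟩) (α.naturality k.op)
    obtain ⟨F, hF⟩ := exists_hom_of_core (T := T) (L := L)
      (fun {C} u hu => α.app (op C) ⟨u, hu.mem_segalCore⟩) fun u hu s =>
        nat (stickMap s) u hu.mem_segalCore (stickMap_isCoreFace (u.edge s)).mem_segalCore
    refine ⟨yonedaEquiv.symm F, ?_⟩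
    ext S ⟨ψ, hψ⟩
    -- An element of the core factors through a core face, where the glued map is known.
    obtain ⟨C, u, k, hu1, hu2, hu3, rfl⟩ := hψ
    have hu : IsCoreFace u := ⟨hu1, hu2, hu3⟩
    refine Eq.trans ?_ (nat k u hu.mem_segalCore _).symm
    rw [← hF u hu]
    rfl

theorem innerRegion_stick (f : PTree.stick ⟶ T) {x : Edge T} : x ∉ innerRegion f :=
  fun h => h.2.2 _ (Multiset.mem_singleton_self _) h.1

/-- The root of the stick is its leaf, so the spanned region has no inner edges and a code is just
an edge of `T`, whatever the lengths. -/
theorem mapLen_bijective_stick (g : CompleteLatticeHom L L') : Function.Bijective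
    fun F : omegaOperad .stick ⟶ wOperad T L => F ≫ wMapLen T g := by
  constructor
  · intro F G h
    apply codeEquiv.injective
    have h' : F ≫ wMapLen T g = G ≫ wMapLen T g := h
    have h0 : (codeEquiv F).hom = (codeEquiv G).hom :=
      congrArg (fun H : omegaOperad .stick ⟶ wOperad T L' => (codeEquiv H).hom) h'
    exact Code.ext_inner h0 fun x hx => absurd hx (innerRegion_stick _)
  · intro G
    refine ⟨codeEquiv.symm ⟨(codeEquiv G).hom, fun _ => ⊤, fun _ _ => rfl, fun _ => rfl⟩, ?_⟩
    apply codeEquiv.injective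
    refine Code.ext_inner ?_ fun x hx => absurd hx (innerRegion_stick _)
    rw [codeEquiv_mapLen_hom, Equiv.apply_symm_apply]

/-- Strings of maps are the same as elements of the nerve of the Boardman–Vogt operad. -/
noncomputable def nerveStringEquiv (T : PTree) (n : SimplexCategory) (S : PTree) :
    (omegaOperad S ⟶ wOperad T (Len n)) ≃ NWString n S T :=
  codeEquiv.trans NWString.equivCode.symm

theorem toCode_nerveStringEquiv {n : SimplexCategory} (F : omegaOperad S ⟶ wOperad T (Len n)) :
    (nerveStringEquiv T n S F).toCode = codeEquiv F :=
  NWString.equivCode.apply_symm_apply _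

theorem codeEquiv_ext_iff {F : omegaOperad S ⟶ wOperad T L} {a : Code L S T} :
    codeEquiv F = a ↔ (codeEquiv F).hom = a.hom ∧
      ∀ x ∈ innerRegion (codeEquiv F).hom, (codeEquiv F).len x = a.len x := by
  refine ⟨?_, fun h => Code.ext_inner h.1 h.2⟩
  rintro rfl
  exact ⟨rfl, fun _ _ => rfl⟩

end Dendroidal

namespace Dendroidal

variable {S S' T T' : PTree}

/-! ### The operators on strings and the main theorem -/

theorem nerveStringEquiv_mapLen {m n : SimplexCategory} (θ : m ⟶ n)
    (F : omegaOperad S ⟶ wOperad T (Len n)) :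
    nerveStringEquiv T m S (F ≫ wMapLen T (lenMap θ)) = (nerveStringEquiv T n S F).simp_op θ := by
  apply NWString.toCode_injective
  obtain ⟨h1, h2⟩ := NWString.toCode_simp_op θ (nerveStringEquiv T n S F)
  rw [← NWString.toCode_hom, toCode_nerveStringEquiv] at h2
  rw [toCode_nerveStringEquiv] at h1
  rw [toCode_nerveStringEquiv, codeEquiv_ext_iff, codeEquiv_mapLen_hom]
  exact ⟨h1.symm, fun x hx => (codeEquiv_mapLen_len F _ x).trans (h2 x hx).symm⟩

theorem nerveStringEquiv_restrict_iff {n : SimplexCategory} (f : S' ⟶ S)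
    (F : omegaOperad S ⟶ wOperad T (Len n)) (F' : omegaOperad S' ⟶ wOperad T (Len n)) :
    omegaMap f ≫ F = F' ↔
      RestrictLadder f (nerveStringEquiv T n S' F') (nerveStringEquiv T n S F) := by
  rw [NWString.restrictLadder_iff, ← NWString.toCode_hom, ← NWString.toCode_hom,
    toCode_nerveStringEquiv, toCode_nerveStringEquiv, ← codeEquiv.injective.eq_iff,
    codeEquiv_ext_iff, codeEquiv_comp_hom]
  refine and_congr eq_comm (forall₂_congr fun x hx => ?_)
  rw [codeEquiv_comp_len f F hx, eq_comm]

theorem nerveStringEquiv_push_iff {n : SimplexCategory} (g : T ⟶ T')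
    (F : omegaOperad S ⟶ wOperad T (Len n)) (F' : omegaOperad S ⟶ wOperad T' (Len n)) :
    F ≫ wPush (Len n) g = F' ↔
      PushLadder g (nerveStringEquiv T n S F) (nerveStringEquiv T' n S F') := by
  rw [NWString.pushLadder_iff, ← NWString.toCode_hom, ← NWString.toCode_hom,
    toCode_nerveStringEquiv, toCode_nerveStringEquiv, ← codeEquiv.injective.eq_iff,
    codeEquiv_ext_iff, codeEquiv_push_hom]
  refine and_congr eq_comm (forall₂_congr fun x hx => ?_)
  rw [codeEquiv_push_len F g hx, eq_comm]

end Dendroidal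

theorem propositionA :
    ∃ (NW : PTree ⥤ SDSet)
      (str : ∀ (T : PTree) (n : SimplexCategory) (S : PTree),
        ((NW.obj T).obj (op n)).obj (op S) ≃ NWString n S T),
      -- the simplicial operators forget or repeat the `Jᵢ`
      (∀ (T S : PTree) {m n : SimplexCategory} (θ : m ⟶ n)
        (x : ((NW.obj T).obj (op n)).obj (op S)),
        str T m S (((NW.obj T).map θ.op).app (op S) x) = (str T n S x).simp_op θ) ∧
      -- functoriality in `S` through tall-outer factorizations
      (∀ (T : PTree) (n : SimplexCategory) {S' S : PTree} (f : S' ⟶ S)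
        (x : ((NW.obj T).obj (op n)).obj (op S)) (x' : ((NW.obj T).obj (op n)).obj (op S')),
        ((NW.obj T).obj (op n)).map f.op x = x' ↔
          RestrictLadder f (str T n S' x') (str T n S x)) ∧
      -- functoriality in `T` through degeneracy-face factorizations
      (∀ {T T' : PTree} (g : T ⟶ T') (n : SimplexCategory) (S : PTree)
        (x : ((NW.obj T).obj (op n)).obj (op S)) (x' : ((NW.obj T').obj (op n)).obj (op S)),
        ((NW.map g).app (op n)).app (op S) x = x' ↔
          PushLadder g (str T n S x) (str T' n S x')) ∧
      -- the strict Segal condition on each simplicial level, and constant object set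
      (∀ (T : PTree) (n : SimplexCategory), StrictSegal ((NW.obj T).obj (op n))) ∧
      (∀ T : PTree, ConstantObjects (NW.obj T)) ∧
      -- this is the nerve of the Boardman–Vogt operads, naturally in `T`, `n` and `S`
      Nonempty (NW ≅ W ⋙ simplicialNerve) := by
  -- With the nerve itself as the functor, the comparison is the identity. Existence and uniqueness
  -- of the restricted and the pushed strings are contained in the equivalences with ladders, as
  -- `str` is bijective.
  refine ⟨W ⋙ simplicialNerve, fun T n S => nerveStringEquiv T n S, ?_, ?_, ?_, ?_, ?_,
    ⟨Iso.refl _⟩⟩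
  · exact fun T S m n θ x => nerveStringEquiv_mapLen θ x
  · exact fun T n S' S f x x' => nerveStringEquiv_restrict_iff f x x'
  · exact fun g n S x x' => nerveStringEquiv_push_iff g x x'
  · exact fun T n => operadNerve_wOperad_strictSegal T (Len n)
  · exact fun T m n θ => mapLen_bijective_stick (lenMap θ)
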